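/- **Setting.** Let $\beta\in(0,1)$, $\rho,\gamma>0$, $k\ge 1$, $b_1,\dots,b_n\ge 0$. For $c,z\ge 0$ let $H(c,z)=[(1-\beta)c^{1-\rho}+\beta z^{1-\rho}]^{1/(1-\rho)}$ if $\rho\ne1$ and $H(c,z)=e^{(1-\beta)\ln c+\beta\ln z}$ if $\rho=1$, where for $\rho\ge1$ one sets $H(c,z)=0$ whenever $c=0$ or $z=0$. Let $u(x)=x^{1-\gamma}$ if $\gamma\neq 1$ and $u(x)=\ln x$ if $\gamma=1$, with $u(0)=-\infty$, $u^{-1}(-\infty)=0$ if $\gamma=1$ and $u(0)=+\infty$, $u^{-1}(+\infty)=0$ if $\gamma>1$. Let $\mathbb X$ be a finite nonempty set and $\{(X_t,Y_t)\}$ a time-homogeneous Markov process such that the law of $(X_{t+1},Y_{t+1})$ conditional on $(X_t,Y_t)$ depends only on $X_t\in\mathbb X$; assume $\{X_t\}$ is irreducible. Write $\mathbb E_x$ for expectation conditional on $X_t=x$. The risk-free gross return is $r_0(X_t)$ and the gross return of risky asset $i$ is $r_i(X_t,X_{t+1},Y_{t+1})$ ($i=1,\dots,n$), measurable and integrable under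 each $\mathbb E_x$. Put $$g_i(x)=\mathbb E_x\big[(r_i-r_0)\mathbf 1_{r_i>r_0}+k(r_i-r_0)\mathbf 1_{r_i<r_0}\big],\qquad R_{\bar\theta}(x,X_{t+1},Y_{t+1})=r_0(x)+\sum_{i=1}^n\bar\theta_i\,(r_i(x,X_{t+1},Y_{t+1})-r_0(x)).$$ For each $x\in\mathbb X$ let $J_x\subseteq\mathbb R^n$ be nonempty and compact and let $I_x\subseteq(0,1)$ be nonempty and closed relative to $(0,1)$. Let $\mathcal A$ be the set of pairs $(c,\theta)$ of functions on $\mathbb X$ with $c(x)\in I_x$, $\theta(x)\in J_x$ for all $x$. For $(c,\theta)\in\mathcal A$ put $$\kappa_{c,\theta}=\ln c(X_{t+1})-\ln c(X_t)+\ln(1-c(X_t))+\ln R_{\theta(X_t)}(X_t,X_{t+1},Y_{t+1}),\qquad \varpi_{c,\theta}(x)=\frac{1-c(x)}{c(x)}\sum_{i=1}^n b_i\theta_i(x)g_i(x),$$ $$\mathbb T_{c,\theta}f(x)=H\big(1,\;u^{-1}(\mathbb E_x[u(e^{\kappa_{c,\theta}}f(X_{t+1}))])+\varpi_{c,\theta}(x)\big),\qquad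 f_{0,c,\theta}(x)=H(1,\varpi_{c,\theta}^+(x)),$$ where $\mathbb T_{c,\theta}f$ is well defined if $f\ge0$ and the second argument of $H$ is nonnegative for all $x$. Let $\delta_{c,\theta}=u^{-1}(\eta_{c,\theta})$, where $\eta_{c,\theta}$ is the unique number such that: if $\gamma\ne1$, $\eta_{c,\theta}>0$ and $\mathbb E_x[u(e^{\kappa_{c,\theta}})v(X_{t+1})]=\eta_{c,\theta}v(x)$ for all $x$, for some $v:\mathbb X\to(0,\infty)$; if $\gamma=1$, $\mathbb E_x[\kappa_{c,\theta}]=-\mathbb E_x[v(X_{t+1})]+v(x)+\eta_{c,\theta}$ for all $x$, for some $v:\mathbb X\to\mathbb R$. **Assumptions.** For each $(c,\theta)\in\mathcal A$: $R_{\theta(X_t)}>0$ almost surely; $\mathbb E_x[u(e^{\kappa_{c,\theta}})]$ exists and is finite for every $x$; $\beta\delta_{c,\theta}^{1-\rho}<1$; and either $\varpi_{c,\theta}(x)\ge0$ for all $x$, or $\mathbb T_{c,\theta}f_{0,c,\theta}$ is well defined and, for some $m\ge1$, $\mathbb T_{c,\theta}^mf_{0,c,\theta}(x)>f_{0,c,\theta}(x)$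 for all $x$. Moreover $\sup_{(c,\theta)\in\mathcal A}\beta\delta_{c,\theta}^{1-\rho}<1$. **Dynamic programming operator.** For $\Phi:\mathbb X\to[0,\infty)$ put $$D_\Phi(x,\bar\theta)=\sum_{i=1}^n\bar\theta_ib_ig_i(x)+u^{-1}\big(\mathbb E_x[u(R_{\bar\theta}(x,X_{t+1},Y_{t+1})\Phi(X_{t+1}))]\big),\qquad \mathbb W\Phi(x)=\sup_{\bar c\in I_x}H\Big(\bar c,(1-\bar c)\max_{\bar\theta\in J_x}D_\Phi(x,\bar\theta)\Big).$$ The domain of $\mathbb W$ is the set of $\Phi\ge0$ with $\max_{\bar\theta\in J_x}D_\Phi(x,\bar\theta)\ge0$ for all $x$. **Theorem.** (i) Suppose $\varpi_{c,\theta}\ge0$ for all $(c,\theta)\in\mathcal A$. Then $\mathbb W$ has a unique fixed point $\Phi^*$ that is positive at every $x\in\mathbb X$; for every $\Phi$ that is positive at every $x$, all iterates $\mathbb W^n\Phi$ are in the domain of $\mathbb W$ and $\mathbb W^n\Phi\to\Phi^*$; and there is $(c^*,\theta^*)\in\mathcal A$ such that, for each $x$, $\theta^*(x)$ maximizes $D_{\Phi^*}(x,\cdot)$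 over $J_x$ and $c^*(x)$ attains the supremum over $I_x$ in $\mathbb W\Phi^*(x)$. (ii) Suppose $\varpi_{c,\theta}(x)<0$ for some $x\in\mathbb X$ and some $(c,\theta)\in\mathcal A$, and let $$\Phi_0(x)=\sup_{\bar c\in I_x}H\Big(\bar c,(1-\bar c)\max_{\bar\theta\in J_x}\Big(\sum_{i=1}^n\bar\theta_ib_ig_i(x)\Big)^+\Big).$$ Then $\Phi_0$ is in the domain of $\mathbb W$. If, in addition, there is $m\ge0$ with $\max_{\bar\theta\in J_x}D_{\mathbb W^m\Phi_0}(x,\bar\theta)>0$ for all $x\in\mathbb X$, then $\mathbb W$ has a unique fixed point $\Phi^*$ that is positive at every $x$; for every $\Phi$ in the domain of $\mathbb W$, all iterates $\mathbb W^n\Phi$ are in the domain and $\mathbb W^n\Phi\to\Phi^*$; and there is $(c^*,\theta^*)\in\mathcal A$ such that, for each $x$, $\theta^*(x)$ maximizes $D_{\Phi^*}(x,\cdot)$ over $J_x$ and $c^*(x)$ attains the supremum over $I_x$ in $\mathbb W\Phi^*(x)$. -/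

import Mathlib

open MeasureTheory ProbabilityTheory Filter Topology
open scoped ENNReal

noncomputable section

namespace NarrowFraming

/-! ### Aggregator, utility, certainty equivalent -/

/-- The aggregator `H(c, z)` on `[0, ∞)²` with discount rate `β` and inverse elasticity `ρ`, with
the convention that for `ρ ≥ 1` it vanishes when one of its arguments does. -/
def aggregator (β ρ c z : ℝ) : ℝ :=
  if 1 ≤ ρ ∧ (c = 0 ∨ z = 0) then 0
  else if ρ = 1 then Real.exp ((1 - β) * Real.log c + β * Real.log z)
  else ((1 - β) * c ^ (1 - ρ) + β * z ^ (1 - ρ)) ^ (1 / (1 - ρ))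

/-- The utility function `u` on `(0, ∞)`. -/
def util (γ a : ℝ) : ℝ := if γ = 1 then Real.log a else a ^ (1 - γ)

/-- The inverse of `u`, on the range of `u`. -/
def utilInv (γ a : ℝ) : ℝ := if γ = 1 then Real.exp a else a ^ (1 / (1 - γ))

/-- The utility function `u` extended to `[0, ∞]`: here `u 0 = -∞` for `γ = 1` and `u 0 = +∞` for
`γ > 1`. -/
def eutil (γ : ℝ) (a : ℝ≥0∞) : EReal :=
  if γ = 1 then ENNReal.log a else ((a ^ (1 - γ) : ℝ≥0∞) : EReal)

/-- The inverse of the extended `u`: here `u⁻¹ (-∞) = 0` for `γ = 1` and `u⁻¹ (+∞) = 0` for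
`γ > 1`. -/
def eutilInv (γ : ℝ) (a : EReal) : ℝ≥0∞ :=
  if γ = 1 then EReal.exp a else a.toENNReal ^ (1 / (1 - γ))

/-- The expectation of an extended real random variable, as the difference of the expectations of
its positive and negative parts. -/
def eexpect {Ω : Type*} [MeasurableSpace Ω] (μ : Measure Ω) (f : Ω → EReal) : EReal :=
  ((∫⁻ ω, (f ω).toENNReal ∂μ : ℝ≥0∞) : EReal) - ((∫⁻ ω, (-f ω).toENNReal ∂μ : ℝ≥0∞) : EReal)

/-- The certainty equivalent `u⁻¹ (E[u(Z)])` of a nonnegative random variable `Z`. -/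
def certEquiv {Ω : Type*} [MeasurableSpace Ω] (γ : ℝ) (μ : Measure Ω) (Z : Ω → ℝ) : ℝ :=
  (eutilInv γ (eexpect μ fun ω => eutil γ (ENNReal.ofReal (Z ω)))).toReal

/-- On positive reals the extended utility function is the real one. -/
theorem eutil_ofReal (γ : ℝ) {a : ℝ} (ha : 0 < a) :
    eutil γ (ENNReal.ofReal a) = ((util γ a : ℝ) : EReal) := by
  unfold eutil util
  split_ifs with h
  · exact ENNReal.log_ofReal_of_pos ha
  · rw [ENNReal.ofReal_rpow_of_pos ha, EReal.coe_ennreal_ofReal,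
      max_eq_left (Real.rpow_nonneg ha.le _)]

/-! ### Recursive utility in a Markovian environment

`P x` is the law of `(X_{t+1}, Y_{t+1})` conditional on `X_t = x`. -/

section Markov

variable {𝕏 𝕐 : Type*} [MeasurableSpace 𝕏] [MeasurableSpace 𝕐]

/-- The transition matrix of `{X_t}`. -/
def transitionMatrix (P : Kernel 𝕏 (𝕏 × 𝕐)) : Matrix 𝕏 𝕏 ℝ :=
  Matrix.of fun x y => (P x).real {p | p.1 = y}

/-- The operator `𝕌 h(x) = E[u(e^{κ(X_t, X_{t+1}, Y_{t+1})}) h(X_{t+1}) | X_t = x]`. -/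
def opU (P : Kernel 𝕏 (𝕏 × 𝕐)) (γ : ℝ) (κ : 𝕏 → 𝕏 → 𝕐 → ℝ) (h : 𝕏 → ℝ) (x : 𝕏) : ℝ :=
  ∫ p, util γ (Real.exp (κ x p.1 p.2)) * h p.1 ∂(P x)

/-- `η` is the Perron-Frobenius value of `κ`. For `γ ≠ 1` it is the eigenvalue of `𝕌` that has a
positive eigenvector `v`; for `γ = 1` it is the number for which
`E[κ | X_t = x] = -E[v(X_{t+1}) | X_t = x] + v(x) + η` has a solution `v`. -/
def IsPerronValue (P : Kernel 𝕏 (𝕏 × 𝕐)) (γ : ℝ) (κ : 𝕏 → 𝕏 → 𝕐 → ℝ) (η : ℝ) : Prop :=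
  if γ = 1 then
    ∃ v : 𝕏 → ℝ, ∀ x,
      ∫ p, κ x p.1 p.2 ∂(P x) = -(∫ p, v p.1 ∂(P x)) + v x + η
  else
    0 < η ∧ ∃ v : 𝕏 → ℝ, (∀ x, 0 < v x) ∧ ∀ x, opU P γ κ v x = η * v x

theorem IsPerronValue.le [Finite 𝕏] [Nonempty 𝕏] [MeasurableSingletonClass 𝕏]
    {P : Kernel 𝕏 (𝕏 × 𝕐)} [IsMarkovKernel P] {γ : ℝ} {κ : 𝕏 → 𝕏 → 𝕐 → ℝ} {η η' : ℝ}
    (hint : ∀ x, Integrable (fun p : 𝕏 × 𝕐 => util γ (Real.exp (κ x p.1 p.2))) (P x))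
    (h : IsPerronValue P γ κ η) (h' : IsPerronValue P γ κ η') : η ≤ η' := by
  have hbdd : ∀ (w : 𝕏 → ℝ), ∃ C, ∀ x, ‖w x‖ ≤ C := fun w => by
    obtain ⟨x, hx⟩ := Finite.exists_max (fun x => ‖w x‖)
    exact ⟨_, hx⟩
  have hmeas : ∀ (w : 𝕏 → ℝ) x, AEStronglyMeasurable (fun p : 𝕏 × 𝕐 => w p.1) (P x) :=
    fun w x => ((measurable_of_finite w).comp measurable_fst).aestronglyMeasurable
  have hi : ∀ (w : 𝕏 → ℝ) x, Integrable (fun p : 𝕏 × 𝕐 => w p.1) (P x) := fun w x => by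
    obtain ⟨C, hC⟩ := hbdd w
    exact Integrable.of_bound (hmeas w x) C (Eventually.of_forall fun p => hC p.1)
  unfold IsPerronValue at h h'
  split_ifs at h h' with hγ
  · obtain ⟨v, hv⟩ := h
    obtain ⟨v', hv'⟩ := h'
    obtain ⟨x, hx⟩ := Finite.exists_max (fun x => v x - v' x)
    have h1 : ∫ p, v p.1 - v' p.1 ∂(P x) ≤ ∫ _p, v x - v' x ∂(P x) :=
      integral_mono ((hi v x).sub (hi v' x)) (integrable_const _) fun p => hx p.1
    rw [integral_sub (hi v x) (hi v' x)] at h1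
    simp only [integral_const, probReal_univ, one_smul] at h1
    linarith [hv x, hv' x]
  · obtain ⟨-, v, hv0, hv⟩ := h
    obtain ⟨-, v', hv0', hv'⟩ := h'
    obtain ⟨x, hx⟩ := Finite.exists_max (fun x => v x / v' x)
    set t := v x / v' x with ht
    have hi2 : ∀ (w : 𝕏 → ℝ), Integrable
        (fun p : 𝕏 × 𝕐 => util γ (Real.exp (κ x p.1 p.2)) * w p.1) (P x) := fun w => by
      obtain ⟨C, hC⟩ := hbdd w
      exact (hint x).mul_bdd (c := C) (hmeas w x) (Eventually.of_forall fun p => hC p.1)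
    have h1 : opU P γ κ v x ≤ t * opU P γ κ v' x := by
      unfold opU
      rw [← integral_const_mul]
      refine integral_mono (hi2 v) ((hi2 v').const_mul t) fun p => ?_
      have hu : 0 ≤ util γ (Real.exp (κ x p.1 p.2)) := by
        unfold util
        rw [if_neg hγ]
        positivity
      have hle : v p.1 ≤ t * v' p.1 := (div_le_iff₀ (hv0' _)).1 (hx p.1)
      calc _ ≤ util γ (Real.exp (κ x p.1 p.2)) * (t * v' p.1) :=
            mul_le_mul_of_nonneg_left hle hu
        _ = _ := by ring
    rw [hv x, hv' x] at h1
    have h2 : t * v' x = v x := div_mul_cancel₀ _ (hv0' x).ne'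
    have h3 : η * v x ≤ η' * v x := by
      calc η * v x ≤ t * (η' * v' x) := h1
        _ = η' * (t * v' x) := by ring
        _ = η' * v x := by rw [h2]
    exact le_of_mul_le_mul_right h3 (hv0 x)

/-- The Perron-Frobenius value is unique. -/
theorem IsPerronValue.unique [Finite 𝕏] [Nonempty 𝕏] [MeasurableSingletonClass 𝕏]
    {P : Kernel 𝕏 (𝕏 × 𝕐)} [IsMarkovKernel P] {γ : ℝ} {κ : 𝕏 → 𝕏 → 𝕐 → ℝ} {η η' : ℝ}
    (hint : ∀ x, Integrable (fun p : 𝕏 × 𝕐 => util γ (Real.exp (κ x p.1 p.2))) (P x))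
    (h : IsPerronValue P γ κ η) (h' : IsPerronValue P γ κ η') : η = η' :=
  le_antisymm (h.le hint h') (h'.le hint h)

/-- `δ = u⁻¹(η)`, where `η` is the Perron-Frobenius value of `κ`. -/
def perronDelta (P : Kernel 𝕏 (𝕏 × 𝕐)) (γ : ℝ) (κ : 𝕏 → 𝕏 → 𝕐 → ℝ) : ℝ :=
  utilInv γ (Classical.epsilon (IsPerronValue P γ κ))

/-- The second argument of the aggregator in `𝕋 f(x)`, that is
`u⁻¹(E[u(e^κ f(X_{t+1})) | X_t = x]) + ϖ(x)`. -/
def innerT (P : Kernel 𝕏 (𝕏 × 𝕐)) (γ : ℝ) (κ : 𝕏 → 𝕏 → 𝕐 → ℝ) (ϖ f : 𝕏 → ℝ) (x : 𝕏) : ℝ :=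
  certEquiv γ (P x) (fun p => Real.exp (κ x p.1 p.2) * f p.1) + ϖ x

/-- The domain of `𝕋`: the nonnegative `f` for which `𝕋 f` is well defined. -/
def domT (P : Kernel 𝕏 (𝕏 × 𝕐)) (γ : ℝ) (κ : 𝕏 → 𝕏 → 𝕐 → ℝ) (ϖ : 𝕏 → ℝ) : Set (𝕏 → ℝ) :=
  {f | (∀ x, 0 ≤ f x) ∧ ∀ x, 0 ≤ innerT P γ κ ϖ f x}

/-- The operator `𝕋` (meaningful on its domain). -/
def opT (P : Kernel 𝕏 (𝕏 × 𝕐)) (β ρ γ : ℝ) (κ : 𝕏 → 𝕏 → 𝕐 → ℝ) (ϖ f : 𝕏 → ℝ) (x : 𝕏) : ℝ :=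
  aggregator β ρ 1 (innerT P γ κ ϖ f x)

/-- The function `f₀ = H(1, ϖ⁺)`. -/
def fZero (β ρ : ℝ) (ϖ : 𝕏 → ℝ) (x : 𝕏) : ℝ := aggregator β ρ 1 (max (ϖ x) 0)

end Markov

/-! ### Portfolio selection with narrow framing -/

/-- The data of the portfolio selection problem with `n` risky assets. -/
structure Model (𝕏 𝕐 : Type*) [MeasurableSpace 𝕏] [MeasurableSpace 𝕐] (n : ℕ) where
  /-- discount rate -/
  β : ℝ
  /-- reciprocal of the elasticity of intertemporal substitution -/
  ρ : ℝ
  /-- relative risk aversion degree -/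
  γ : ℝ
  /-- loss aversion degree -/
  k : ℝ
  /-- weights of the gain-loss utilities of the risky assets -/
  b : Fin n → ℝ
  /-- law of `(X_{t+1}, Y_{t+1})` conditional on `X_t = x` -/
  P : Kernel 𝕏 (𝕏 × 𝕐)
  /-- gross return rate of the risk-free asset -/
  r₀ : 𝕏 → ℝ
  /-- gross return rates of the risky assets -/
  r : Fin n → 𝕏 → 𝕏 → 𝕐 → ℝ
  isMarkov : IsMarkovKernel P
  β_pos : 0 < β
  β_lt_one : β < 1
  ρ_pos : 0 < ρ
  γ_pos : 0 < γ
  one_le_k : 1 ≤ k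
  b_nonneg : ∀ i, 0 ≤ b i
  measurable_r : ∀ i x, Measurable fun p : 𝕏 × 𝕐 => r i x p.1 p.2
  integrable_r : ∀ i x, Integrable (fun p : 𝕏 × 𝕐 => r i x p.1 p.2) (P x)

namespace Model

variable {𝕏 𝕐 : Type*} [MeasurableSpace 𝕏] [MeasurableSpace 𝕐] {n : ℕ}

/-- The aggregator of the model. -/
def H (M : Model 𝕏 𝕐 n) (c z : ℝ) : ℝ := aggregator M.β M.ρ c z

/-- The return of a portfolio `ϑ` held in state `x`. -/
def portReturn (M : Model 𝕏 𝕐 n) (ϑ : Fin n → ℝ) (x x' : 𝕏) (y : 𝕐) : ℝ :=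
  M.r₀ x + ∑ i, ϑ i * (M.r i x x' y - M.r₀ x)

/-- The gain-loss utility `g_i(x)` per unit of investment in asset `i`. -/
def g (M : Model 𝕏 𝕐 n) (i : Fin n) (x : 𝕏) : ℝ :=
  ∫ p, ((if M.r i x p.1 p.2 > M.r₀ x then M.r i x p.1 p.2 - M.r₀ x else 0) +
    M.k * (if M.r i x p.1 p.2 < M.r₀ x then M.r i x p.1 p.2 - M.r₀ x else 0)) ∂(M.P x)

/-- `∑ᵢ ϑᵢ bᵢ gᵢ(x)`. -/
def gainLoss (M : Model 𝕏 𝕐 n) (x : 𝕏) (ϑ : Fin n → ℝ) : ℝ := ∑ i, ϑ i * M.b i * M.g i x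

/-- `κ_{c,θ}`, the logarithm of consumption growth. -/
def kappa (M : Model 𝕏 𝕐 n) (c : 𝕏 → ℝ) (θ : 𝕏 → Fin n → ℝ) (x x' : 𝕏) (y : 𝕐) : ℝ :=
  Real.log (c x') - Real.log (c x) + Real.log (1 - c x) + Real.log (M.portReturn (θ x) x x' y)

/-- `ϖ_{c,θ}`. -/
def varpi (M : Model 𝕏 𝕐 n) (c : 𝕏 → ℝ) (θ : 𝕏 → Fin n → ℝ) (x : 𝕏) : ℝ :=
  (1 - c x) / c x * M.gainLoss x (θ x)

/-- `δ_{c,θ}`. -/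
def delta (M : Model 𝕏 𝕐 n) (c : 𝕏 → ℝ) (θ : 𝕏 → Fin n → ℝ) : ℝ :=
  perronDelta M.P M.γ (M.kappa c θ)

/-- The set `𝒜` of admissible `(c, θ)`. -/
def admissible (I : 𝕏 → Set ℝ) (J : 𝕏 → Set (Fin n → ℝ)) : Set ((𝕏 → ℝ) × (𝕏 → Fin n → ℝ)) :=
  {a | ∀ x, a.1 x ∈ I x ∧ a.2 x ∈ J x}

/-- The standing feasibility assumption. For every admissible `(c, θ)`: portfolio returns are
(almost surely) positive, `E[u(e^κ) | X_t = x]` exists and is finite, `β δ^{1-ρ} < 1`, and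
either `ϖ ≥ 0`, or `𝕋 f₀` is well defined and `𝕋^m f₀ > f₀` for some `m ≥ 1`. -/
def Feasible (M : Model 𝕏 𝕐 n) (I : 𝕏 → Set ℝ) (J : 𝕏 → Set (Fin n → ℝ)) : Prop :=
  ∀ c θ, (c, θ) ∈ admissible I J →
    (∀ x, ∀ᵐ p ∂(M.P x), 0 < M.portReturn (θ x) x p.1 p.2) ∧
    (∀ x, Integrable (fun p : 𝕏 × 𝕐 => util M.γ (Real.exp (M.kappa c θ x p.1 p.2))) (M.P x)) ∧
    M.β * M.delta c θ ^ (1 - M.ρ) < 1 ∧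
    ((∀ x, 0 ≤ M.varpi c θ x) ∨
      (fZero M.β M.ρ (M.varpi c θ) ∈ domT M.P M.γ (M.kappa c θ) (M.varpi c θ) ∧
        ∃ m : ℕ, 1 ≤ m ∧ ∀ x, fZero M.β M.ρ (M.varpi c θ) x <
          (opT M.P M.β M.ρ M.γ (M.kappa c θ) (M.varpi c θ))^[m] (fZero M.β M.ρ (M.varpi c θ)) x))

/-- `D_Φ(x, ϑ)`. -/
def D (M : Model 𝕏 𝕐 n) (Φ : 𝕏 → ℝ) (x : 𝕏) (ϑ : Fin n → ℝ) : ℝ :=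
  M.gainLoss x ϑ + certEquiv M.γ (M.P x) (fun p => M.portReturn ϑ x p.1 p.2 * Φ p.1)

/-- `max_{ϑ ∈ J_x} D_Φ(x, ϑ)`. -/
def maxD (M : Model 𝕏 𝕐 n) (J : 𝕏 → Set (Fin n → ℝ)) (Φ : 𝕏 → ℝ) (x : 𝕏) : ℝ :=
  sSup (M.D Φ x '' J x)

/-- The dynamic programming operator `𝕎` (meaningful on its domain). The outer maximum over
`I_x` is a supremum, since it may be attained only on the closure of `I_x`. -/
def W (M : Model 𝕏 𝕐 n) (I : 𝕏 → Set ℝ) (J : 𝕏 → Set (Fin n → ℝ)) (Φ : 𝕏 → ℝ) (x : 𝕏) : ℝ :=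
  sSup ((fun c => M.H c ((1 - c) * M.maxD J Φ x)) '' I x)

/-- The domain of `𝕎`. -/
def domW (M : Model 𝕏 𝕐 n) (J : 𝕏 → Set (Fin n → ℝ)) : Set (𝕏 → ℝ) :=
  {Φ | (∀ x, 0 ≤ Φ x) ∧ ∀ x, 0 ≤ M.maxD J Φ x}

/-- `Φ₀`. -/
def phiZero (M : Model 𝕏 𝕐 n) (I : 𝕏 → Set ℝ) (J : 𝕏 → Set (Fin n → ℝ)) (x : 𝕏) : ℝ :=
  sSup ((fun c => M.H c ((1 - c) * sSup ((fun ϑ => max (M.gainLoss x ϑ) 0) '' J x))) '' I x)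

/-- `(c x, θ x)` attains both maxima in the definition of `𝕎 Φ(x)`, for every `x`. -/
def IsMaximizer (M : Model 𝕏 𝕐 n) (I : 𝕏 → Set ℝ) (J : 𝕏 → Set (Fin n → ℝ)) (Φ : 𝕏 → ℝ)
    (c : 𝕏 → ℝ) (θ : 𝕏 → Fin n → ℝ) : Prop :=
  ∀ x, IsMaxOn (M.D Φ x) (J x) (θ x) ∧
    IsMaxOn (fun c' => M.H c' ((1 - c') * M.maxD J Φ x)) (I x) (c x)

/-- `𝕎` has a unique positive fixed point `Φ*`, the iterates of `𝕎` from every start in `S` stay in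
the domain and converge (pointwise) to `Φ*`, and the maxima in `𝕎 Φ*` are attained by an
admissible `(c*, θ*)`. -/
def Solvable (M : Model 𝕏 𝕐 n) (I : 𝕏 → Set ℝ) (J : 𝕏 → Set (Fin n → ℝ))
    (S : Set (𝕏 → ℝ)) : Prop :=
  ∃ Φs : 𝕏 → ℝ, ((∀ x, 0 < Φs x) ∧ Φs ∈ M.domW J ∧ M.W I J Φs = Φs) ∧
    (∀ Φ : 𝕏 → ℝ, (∀ x, 0 < Φ x) → Φ ∈ M.domW J → M.W I J Φ = Φ → Φ = Φs) ∧
    (∀ Φ ∈ S, (∀ m : ℕ, (M.W I J)^[m] Φ ∈ M.domW J) ∧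
      Tendsto (fun m : ℕ => (M.W I J)^[m] Φ) atTop (𝓝 Φs)) ∧
    ∃ c θ, (c, θ) ∈ admissible I J ∧ M.IsMaximizer I J Φs c θ

end Model

end NarrowFraming

end

/-!
The operator `𝕎` is the supremum over the admissible policies of the operators `policyOp c θ`, which
are monotone and concave, and each of these is conjugate to the operator `𝕋` of recursive utility by
multiplication with `c` (`mul_opT`). The proof constructs sub- and supersolutions of `𝕎`, lets the
monotone iterates from both sides converge, and identifies the limits by a uniqueness argument for
fixed policies.

*Certainty equivalents.* For integrable `Z ≥ 0` the inequality `1 ≤ certEquiv γ μ Z` says that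
`E[Z - u(Z)] ≤ E[Z]` for the normalised utility function `u = nutil γ`. Here `Z - u(Z)` (`utilGap`) is a
nonnegative convex function of `Z`, possibly infinite at `0`, so no indeterminate expectations occur
(`one_le_certEquiv_iff`). With homogeneity this gives monotonicity, superadditivity and, by Fatou's
lemma, upper semicontinuity of certainty equivalents for all `γ > 0` at once (`certEquiv_mono`,
`certEquiv_add_le`, `le_certEquiv_of_tendsto`). The aggregator is the certainty equivalent of a
lottery with two outcomes (`aggregator_eq_certEquiv`) and inherits these properties. Upper
semicontinuity yields optimal portfolios. An optimal consumption propensity exists in the relatively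
closed set `I x`, because the endpoints `0` and `1` are never optimal
(`exists_isMaxOn_consumption`).

*Perron-Frobenius values.* Irreducibility provides the eigenfunctions behind `δ`; in terms of
certainty equivalents, `(1 - c) CE(R_θ Ψ) = δ Ψ` with `Ψ > 0` (`exists_eigenfunction`). By
`β δ ^ (1 - ρ) < 1` the small multiples of `Ψ` are subsolutions if the gain-loss utilities are nonnegative
(`exists_subsolution`). Otherwise `Φ₀` is a subsolution.

*Supersolutions.* The gain-loss utilities are bounded by a constant `g`, so it is enough to find a
supersolution of the operator with constant gain `g` and to scale it up. For `ρ ≥ 1` a large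
constant works, as the aggregator grows sublinearly. For `ρ < 1` the iterates from `0` increase; if
they were unbounded, their normalisations and the optimal portfolios would accumulate at some `v`
and `θ` with `v ≤ β ^ (1 / (1 - ρ)) sup (1 - c) CE(R_θ v)`, which the uniform bound on
`β δ ^ (1 - ρ)` excludes (`bddAbove_iterate`, `nonpos_of_le_contValue`).

*Uniqueness.* Let `Φ` and `Ψ` be positive fixed points of `𝕎`, and let `(c, θ)` be optimal at `Φ`.
Then `Φ` is a fixed point of `policyOp c θ` and `Ψ` is a supersolution. If the gain-loss utilities
of the policy are nonnegative, the operator is strictly subhomogeneous, which gives `Φ ≤ Ψ`.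
Otherwise feasibility says that some iterate of the operator moves `F = c f₀` strictly upwards, and
concavity along the segment from `F` to `Φ` gives `Φ ≤ Ψ` (`le_of_policyOp_of_nonneg`,
`le_of_policyOp_of_lt_iterate`, `fixedPoint_le`).

*Convergence.* The iterates of a subsolution increase and those of a supersolution decrease. As `𝕎`
is continuous at positive functions with a positive continuation value (`tendsto_opW`), both limits
are fixed points, hence equal, and the iterates in between are squeezed (`exists_tendsto_iterate`).
-/

noncomputable section

namespace NarrowFraming

/-! ### The certainty equivalent -/

/-- The utility function normalised so that it vanishes at `1` and is increasing and concave for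
every `γ > 0`. -/
def nutil (γ z : ℝ) : ℝ := if γ = 1 then Real.log z else (z ^ (1 - γ) - 1) / (1 - γ)

/-- The function `z - nutil γ z` with its limit at `0`, which is infinite for `γ ≥ 1`, as a function
with values in `[1, ∞]`. Negative arguments are treated like `0`. -/
def utilGap (γ z : ℝ) : ℝ≥0∞ :=
  if 0 < z then ENNReal.ofReal (z - nutil γ z)
  else if γ < 1 then ENNReal.ofReal (1 / (1 - γ)) else ⊤

theorem nutil_le {γ z : ℝ} (hγ : 0 < γ) (hz : 0 < z) : nutil γ z ≤ z - 1 := by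
  unfold nutil
  split_ifs with h
  · exact Real.log_le_sub_one_of_pos hz
  · rcases lt_or_gt_of_ne h with h | h
    · rw [div_le_iff₀ (by linarith)]
      have := rpow_one_add_le_one_add_mul_self (s := z - 1) (by linarith)
        (p := 1 - γ) (by linarith) (by linarith)
      rw [add_sub_cancel] at this
      linarith
    · rw [div_le_iff_of_neg (by linarith)]
      rw [Real.rpow_def_of_pos hz]
      nlinarith [Real.add_one_le_exp (Real.log z * (1 - γ)), Real.log_le_sub_one_of_pos hz]

theorem nutil_mono {γ z z' : ℝ} (hz : 0 < z) (h : z ≤ z') : nutil γ z ≤ nutil γ z' := by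
  unfold nutil
  split_ifs with hγ
  · exact Real.log_le_log hz h
  · rcases lt_or_gt_of_ne hγ with h1 | h1
    · have := Real.rpow_le_rpow hz.le h (z := 1 - γ) (by linarith)
      exact div_le_div_of_nonneg_right (by linarith) (by linarith)
    · have := Real.rpow_le_rpow_of_nonpos hz h (z := 1 - γ) (by linarith)
      exact div_le_div_of_nonpos_of_le (by linarith) (by linarith)

theorem one_le_utilGap (γ z : ℝ) (hγ : 0 < γ) : 1 ≤ utilGap γ z := by
  unfold utilGap
  split_ifs with h h'
  · rw [← ENNReal.ofReal_one]
    exact ENNReal.ofReal_le_ofReal (by linarith [nutil_le hγ h])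
  · rw [← ENNReal.ofReal_one]
    apply ENNReal.ofReal_le_ofReal
    rw [le_div_iff₀ (by linarith)]; linarith
  · exact le_top

theorem concaveOn_nutil {γ : ℝ} (hγ : 0 < γ) : ConcaveOn ℝ (Set.Ioi 0) (nutil γ) := by
  by_cases h : γ = 1
  · have : nutil γ = Real.log := by funext z; simp [nutil, h]
    rw [this]
    exact strictConcaveOn_log_Ioi.concaveOn
  rcases lt_or_gt_of_ne h with h1 | h1
  · have := (Real.concaveOn_rpow (p := 1 - γ) (by linarith) (by linarith)).subset
      Set.Ioi_subset_Ici_self (convex_Ioi 0)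
    refine ((this.add_const (-1)).smul (c := (1 - γ)⁻¹) (inv_nonneg.2 (by linarith))).congr ?_
    intro z _
    simp [nutil, h, div_eq_inv_mul, sub_eq_add_neg]
  · have hc : ConvexOn ℝ (Set.Ioi 0) fun z : ℝ => z ^ (1 - γ) := by
      refine ⟨convex_Ioi 0, fun x hx y hy a b ha hb hab => ?_⟩
      have hxy : a • x + b • y ∈ Set.Ioi (0 : ℝ) := convex_Ioi (0 : ℝ) hx hy ha hb hab
      simp only [Real.rpow_def_of_pos hx, Real.rpow_def_of_pos hy, Real.rpow_def_of_pos hxy]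
      refine le_trans (Real.exp_le_exp.2 ?_) (convexOn_exp.2 (Set.mem_univ _) (Set.mem_univ _)
        ha hb hab)
      have := strictConcaveOn_log_Ioi.concaveOn.2 hx hy ha hb hab
      simp only [smul_eq_mul] at this ⊢
      nlinarith
    refine ((hc.add_const (-1)).smul (c := (γ - 1)⁻¹) (inv_nonneg.2 (by linarith))).neg.congr ?_
    intro z _
    have h1' : 1 - γ ≠ 0 := by linarith
    have h2' : γ - 1 ≠ 0 := by linarith
    simp only [Pi.neg_apply, Pi.add_apply, nutil, h, if_false, smul_eq_mul]
    field_simp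
    ring

theorem continuousOn_nutil (γ : ℝ) : ContinuousOn (nutil γ) (Set.Ioi 0) := by
  by_cases h : γ = 1
  · have : nutil γ = Real.log := by funext z; simp [nutil, h]
    rw [this]
    exact Real.continuousOn_log.mono fun z (hz : 0 < z) => hz.ne'
  · have : nutil γ = fun z => (z ^ (1 - γ) - 1) / (1 - γ) := by funext z; simp [nutil, h]
    rw [this]
    exact ((continuousOn_id.rpow_const fun z (hz : 0 < z) => Or.inl hz.ne').sub
      continuousOn_const).div_const _

theorem measurable_nutil (γ : ℝ) : Measurable (nutil γ) := by
  unfold nutil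
  split_ifs
  · exact Real.measurable_log
  · fun_prop

theorem measurable_utilGap (γ : ℝ) : Measurable (utilGap γ) := by
  unfold utilGap
  have := measurable_nutil γ
  refine Measurable.ite measurableSet_Ioi (by fun_prop) measurable_const

theorem utilGap_of_lt_one {γ z : ℝ} (hγ : γ < 1) (hz : 0 ≤ z) :
    utilGap γ z = ENNReal.ofReal (z - (z ^ (1 - γ) - 1) / (1 - γ)) := by
  unfold utilGap
  split_ifs with h0
  · rw [nutil, if_neg hγ.ne]
  · obtain rfl : z = 0 := le_antisymm (not_lt.1 h0) hz
    rw [Real.zero_rpow (by linarith)]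
    congr 1
    field_simp
    ring

/-- Convexity of `utilGap` along segments in `[0, ∞)`. -/
theorem utilGap_convex {γ : ℝ} (hγ : 0 < γ) {z z' s t : ℝ} (hz : 0 ≤ z) (hz' : 0 ≤ z')
    (hs : 0 < s) (ht : 0 < t) (hst : s + t = 1) :
    utilGap γ (s * z + t * z') ≤
      ENNReal.ofReal s * utilGap γ z + ENNReal.ofReal t * utilGap γ z' := by
  rcases lt_or_ge γ 1 with h | h
  · have key := fun z (hz : 0 ≤ z) => utilGap_of_lt_one h hz
    have h0 : 0 ≤ s * z + t * z' := by positivity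
    have hc := (Real.concaveOn_rpow (p := 1 - γ) (by linarith) (by linarith)).2
      (Set.mem_Ici.2 hz) (Set.mem_Ici.2 hz') hs.le ht.le hst
    simp only [smul_eq_mul] at hc
    have hpos : ∀ z, 0 ≤ z → 0 ≤ z - (z ^ (1 - γ) - 1) / (1 - γ) := by
      intro z hz
      by_contra hneg
      have h2 := one_le_utilGap γ z hγ
      rw [key z hz, ENNReal.ofReal_eq_zero.2 (not_le.1 hneg).le] at h2
      exact absurd h2 (by simp)
    rw [key _ hz, key _ hz', key _ h0, ← ENNReal.ofReal_mul hs.le, ← ENNReal.ofReal_mul ht.le,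
      ← ENNReal.ofReal_add (mul_nonneg hs.le (hpos z hz)) (mul_nonneg ht.le (hpos z' hz'))]
    apply ENNReal.ofReal_le_ofReal
    have hd : (s * z ^ (1 - γ) + t * z' ^ (1 - γ) - 1) / (1 - γ)
        ≤ ((s * z + t * z') ^ (1 - γ) - 1) / (1 - γ) :=
      div_le_div_of_nonneg_right (by linarith) (by linarith)
    have : s * (z - (z ^ (1 - γ) - 1) / (1 - γ)) + t * (z' - (z' ^ (1 - γ) - 1) / (1 - γ))
        = s * z + t * z' - (s * z ^ (1 - γ) + t * z' ^ (1 - γ) - (s + t)) / (1 - γ) := by ring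
    rw [this, hst]
    linarith
  · have htop : ∀ a, 0 ≤ a → ¬ 0 < a → utilGap γ a = ⊤ := fun a _ h0 => by
      rw [utilGap, if_neg h0, if_neg (not_lt.2 h)]
    by_cases h1 : 0 < z
    · by_cases h2 : 0 < z'
      · have h0 : 0 < s * z + t * z' := by positivity
        have hc := (concaveOn_nutil hγ).2 (Set.mem_Ioi.2 h1) (Set.mem_Ioi.2 h2) hs.le ht.le hst
        simp only [smul_eq_mul] at hc
        rw [utilGap, utilGap, utilGap, if_pos h0, if_pos h1, if_pos h2, ← ENNReal.ofReal_mul hs.le,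
          ← ENNReal.ofReal_mul ht.le, ← ENNReal.ofReal_add]
        · apply ENNReal.ofReal_le_ofReal
          linarith
        · exact mul_nonneg hs.le (by linarith [nutil_le hγ h1])
        · exact mul_nonneg ht.le (by linarith [nutil_le hγ h2])
      · rw [htop z' hz' h2, ENNReal.mul_top (by simpa using ht), add_top]
        exact le_top
    · rw [htop z hz h1, ENNReal.mul_top (by simpa using hs), top_add]
      exact le_top

/-- `utilGap` is continuous on `[0, ∞)`. -/
theorem tendsto_utilGap {γ : ℝ} {a : ℝ} (ha : 0 ≤ a) {z : ℕ → ℝ} (hz : ∀ m, 0 ≤ z m)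
    (h : Tendsto z atTop (𝓝 a)) :
    Tendsto (fun m => utilGap γ (z m)) atTop (𝓝 (utilGap γ a)) := by
  rcases ha.eq_or_lt with rfl | ha
  · rcases lt_or_ge γ 1 with h1 | h1
    · have key := fun z (hz : 0 ≤ z) => utilGap_of_lt_one h1 hz
      rw [key 0 le_rfl]
      simp only [fun m => key (z m) (hz m)]
      apply ENNReal.tendsto_ofReal
      exact h.sub (((h.rpow_const (Or.inr (by linarith))).sub tendsto_const_nhds).div_const _)
    · have h2 : Tendsto (fun x => -nutil γ x) (𝓝[>] 0) atTop := by
        rcases h1.eq_or_lt with rfl | h1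
        · simpa only [nutil, if_true] using! tendsto_neg_atBot_atTop.comp Real.tendsto_log_nhdsGT_zero
        · have : (fun x => -nutil γ x) = fun x => (γ - 1)⁻¹ * (x ^ (-(γ - 1)) + -1) := by
            funext x
            have h1' : 1 - γ ≠ 0 := by linarith
            have h2' : γ - 1 ≠ 0 := by linarith
            rw [nutil, if_neg h1.ne', neg_sub γ 1]
            field_simp
            ring
          rw [this]
          refine Tendsto.const_mul_atTop (inv_pos.2 (by linarith)) ?_
          exact tendsto_atTop_add_const_right _ _ (tendsto_rpow_neg_nhdsGT_zero (by linarith))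
      have h3 : utilGap γ 0 = ⊤ := by simp [utilGap, h1]
      rw [h3, ENNReal.tendsto_nhds_top_iff_nnreal]
      intro K
      have h4 : ∀ᶠ x in 𝓝[>] (0 : ℝ), (K : ℝ) < -nutil γ x := h2.eventually_gt_atTop _
      rw [eventually_nhdsWithin_iff] at h4
      filter_upwards [h.eventually h4] with m hm
      unfold utilGap
      split_ifs with h5 h6
      · rw [ENNReal.lt_ofReal_iff_toReal_lt ENNReal.coe_ne_top, ENNReal.coe_toReal]
        have := hm h5
        linarith
      · linarith
      · exact ENNReal.coe_lt_top
  · have h1 : Tendsto (fun m => ENNReal.ofReal (z m - nutil γ (z m))) atTop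
        (𝓝 (ENNReal.ofReal (a - nutil γ a))) := by
      apply ENNReal.tendsto_ofReal
      exact h.sub ((((continuousOn_nutil γ).continuousAt (Ioi_mem_nhds ha)).tendsto).comp h)
    rw [utilGap, if_pos ha]
    refine h1.congr' ?_
    filter_upwards [h.eventually (lt_mem_nhds ha)] with m hm
    rw [utilGap, if_pos hm]

section CertEquiv

variable {Ω : Type*} [MeasurableSpace Ω] {μ : Measure Ω}

theorem certEquiv_congr_ae {γ : ℝ} {Z Z' : Ω → ℝ} (h : Z =ᵐ[μ] Z') :
    certEquiv γ μ Z = certEquiv γ μ Z' := by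
  have h' : (fun ω => eutil γ (ENNReal.ofReal (Z ω))) =ᵐ[μ]
      fun ω => eutil γ (ENNReal.ofReal (Z' ω)) := h.mono fun ω hω => by simp only [hω]
  have h1 := lintegral_congr_ae (h'.mono fun ω hω => congrArg EReal.toENNReal hω)
  have h2 := lintegral_congr_ae (h'.mono fun ω hω => congrArg (fun z => EReal.toENNReal (-z)) hω)
  unfold certEquiv eexpect
  rw [h1, h2]

theorem certEquiv_nonneg (γ : ℝ) (μ : Measure Ω) (Z : Ω → ℝ) : 0 ≤ certEquiv γ μ Z :=
  ENNReal.toReal_nonneg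

theorem certEquiv_of_ne_one {γ : ℝ} (hγ : γ ≠ 1) (μ : Measure Ω) (Z : Ω → ℝ) :
    certEquiv γ μ Z =
      ((∫⁻ ω, ENNReal.ofReal (Z ω) ^ (1 - γ) ∂μ) ^ (1 / (1 - γ)) : ℝ≥0∞).toReal := by
  have h : ∀ a : ℝ≥0∞, (-(a : EReal)).toENNReal = 0 := fun a =>
    EReal.toENNReal_of_nonpos (by simpa using EReal.coe_ennreal_nonneg a)
  simp only [certEquiv, eutilInv, eexpect, eutil, if_neg hγ, EReal.toENNReal_coe, h,
    lintegral_zero, EReal.coe_ennreal_zero, sub_zero]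

theorem certEquiv_one (μ : Measure Ω) (Z : Ω → ℝ) :
    certEquiv 1 μ Z = (EReal.exp
      (((∫⁻ ω, (ENNReal.log (ENNReal.ofReal (Z ω))).toENNReal ∂μ : ℝ≥0∞) : EReal) -
        ((∫⁻ ω, (-ENNReal.log (ENNReal.ofReal (Z ω))).toENNReal ∂μ : ℝ≥0∞) : EReal))).toReal := by
  simp only [certEquiv, eutilInv, eexpect, eutil, if_true]

/-- If `f + a = g + b`, where `a` and `g` have finite integrals, then comparing `f` with `g` is
comparing `b` with `a`; this moves the terms of an inequality of integrals that may be infinite to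
the other side. -/
theorem lintegral_le_iff_of_add_eq {f a g b : Ω → ℝ≥0∞} (ha : AEMeasurable a μ)
    (hg : AEMeasurable g μ) (ha' : ∫⁻ ω, a ω ∂μ ≠ ⊤) (hg' : ∫⁻ ω, g ω ∂μ ≠ ⊤)
    (h : ∀ ω, f ω + a ω = g ω + b ω) :
    ∫⁻ ω, f ω ∂μ ≤ ∫⁻ ω, g ω ∂μ ↔ ∫⁻ ω, b ω ∂μ ≤ ∫⁻ ω, a ω ∂μ := by
  have h1 : ∫⁻ ω, f ω ∂μ + ∫⁻ ω, a ω ∂μ = ∫⁻ ω, g ω ∂μ + ∫⁻ ω, b ω ∂μ := by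
    rw [← lintegral_add_right' _ ha, ← lintegral_add_left' hg]
    simp only [h]
  constructor
  · intro h2
    have : ∫⁻ ω, g ω ∂μ + ∫⁻ ω, b ω ∂μ ≤ ∫⁻ ω, g ω ∂μ + ∫⁻ ω, a ω ∂μ := by
      rw [← h1]; gcongr
    exact (ENNReal.add_le_add_iff_left hg').1 this
  · intro h2
    have : ∫⁻ ω, f ω ∂μ + ∫⁻ ω, a ω ∂μ ≤ ∫⁻ ω, g ω ∂μ + ∫⁻ ω, a ω ∂μ := by
      rw [h1]; gcongr
    exact (ENNReal.add_le_add_iff_right ha').1 this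

theorem one_le_toReal_iff {a : ℝ≥0∞} : 1 ≤ a.toReal ↔ 1 ≤ a ∧ a ≠ ⊤ := by
  constructor
  · intro h
    have h1 : a ≠ ⊤ := by rintro rfl; simp at h; linarith
    refine ⟨?_, h1⟩
    rw [← ENNReal.ofReal_one]
    exact (ENNReal.ofReal_le_iff_le_toReal h1).2 h
  · rintro ⟨h, h1⟩
    rw [← ENNReal.ofReal_one] at h
    exact (ENNReal.ofReal_le_iff_le_toReal h1).1 h

theorem lintegral_ofReal_ne_top {Z : Ω → ℝ} (hZ : Integrable Z μ) :
    ∫⁻ ω, ENNReal.ofReal (Z ω) ∂μ ≠ ⊤ := hZ.lintegral_lt_top.ne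

theorem lintegral_ofReal_rpow_ne_top [IsFiniteMeasure μ] {Z : Ω → ℝ} (hZ : Integrable Z μ) {p : ℝ}
    (hp0 : 0 ≤ p) (hp1 : p ≤ 1) : ∫⁻ ω, ENNReal.ofReal (Z ω) ^ p ∂μ ≠ ⊤ := by
  have h : ∀ ω, ENNReal.ofReal (Z ω) ^ p ≤ 1 + ENNReal.ofReal (Z ω) := by
    intro ω
    rcases le_total (ENNReal.ofReal (Z ω)) 1 with h | h
    · exact (ENNReal.rpow_le_one h hp0).trans le_self_add
    · calc _ ≤ ENNReal.ofReal (Z ω) ^ (1 : ℝ) := ENNReal.rpow_le_rpow_of_exponent_le h hp1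
        _ ≤ _ := by rw [ENNReal.rpow_one]; exact le_add_self
  refine ne_top_of_le_ne_top ?_ (lintegral_mono h)
  rw [lintegral_add_left measurable_const]
  simp [lintegral_ofReal_ne_top hZ]

theorem lintegral_log_toENNReal_ne_top {Z : Ω → ℝ} (hZ : Integrable Z μ) :
    ∫⁻ ω, (ENNReal.log (ENNReal.ofReal (Z ω))).toENNReal ∂μ ≠ ⊤ := by
  refine ne_top_of_le_ne_top (lintegral_ofReal_ne_top hZ) (lintegral_mono fun ω => ?_)
  by_cases h0 : 0 < Z ω
  · rw [ENNReal.log_ofReal_of_pos h0, EReal.real_coe_toENNReal]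
    exact ENNReal.ofReal_le_ofReal (by linarith [Real.log_le_sub_one_of_pos h0])
  · rw [ENNReal.ofReal_of_nonpos (not_lt.1 h0)]
    simp

/-- The characterisation of the certainty equivalent from which its order, concavity and
continuity properties follow: the superlevel set at `1` is cut out by a convex functional, lower
semicontinuous by Fatou's lemma. -/
theorem one_le_certEquiv_iff [IsProbabilityMeasure μ] {γ : ℝ} (hγ : 0 < γ) {Z : Ω → ℝ}
    (hZ : Integrable Z μ) :
    1 ≤ certEquiv γ μ Z ↔
      ∫⁻ ω, utilGap γ (Z ω) ∂μ ≤ ∫⁻ ω, ENNReal.ofReal (Z ω) ∂μ := by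
  have hm : AEMeasurable (fun ω => ENNReal.ofReal (Z ω)) μ := hZ.1.aemeasurable.ennreal_ofReal
  have hfin := lintegral_ofReal_ne_top hZ
  rcases lt_trichotomy γ 1 with h | h | h
  · have hc : ENNReal.ofReal (1 / (1 - γ)) ≠ 0 := by
      rw [Ne, ENNReal.ofReal_eq_zero, not_le]; exact one_div_pos.2 (by linarith)
    rw [certEquiv_of_ne_one h.ne, one_le_toReal_iff, lintegral_le_iff_of_add_eq
      (a := fun ω => ENNReal.ofReal (1 / (1 - γ)) * ENNReal.ofReal (Z ω) ^ (1 - γ))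
      (b := fun _ => ENNReal.ofReal (1 / (1 - γ))) ((hm.pow_const _).const_mul _) hm ?_ hfin ?_]
    · rw [lintegral_const, lintegral_const_mul' _ _ ENNReal.ofReal_ne_top, measure_univ]
      have hI := lintegral_ofReal_rpow_ne_top hZ (p := 1 - γ) (by linarith) (by linarith)
      rw [ENNReal.mul_le_mul_iff_right hc ENNReal.ofReal_ne_top]
      have hp : 0 < 1 / (1 - γ) := one_div_pos.2 (by linarith)
      refine ⟨fun h1 => ?_, fun h1 => ⟨ENNReal.one_le_rpow h1 hp,
        ENNReal.rpow_ne_top_of_nonneg hp.le hI⟩⟩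
      by_contra h2
      exact absurd h1.1 (not_le.2 (ENNReal.rpow_lt_one (not_le.1 h2) hp))
    · rw [lintegral_const_mul' _ _ ENNReal.ofReal_ne_top]
      exact ENNReal.mul_ne_top ENNReal.ofReal_ne_top
        (lintegral_ofReal_rpow_ne_top hZ (by linarith) (by linarith))
    · intro ω
      have h1 : (0 : ℝ) ≤ 1 / (1 - γ) := one_div_nonneg.2 (by linarith)
      by_cases h0 : 0 < Z ω
      · rw [utilGap, if_pos h0, ENNReal.ofReal_rpow_of_pos h0, ← ENNReal.ofReal_mul h1,
          ← ENNReal.ofReal_add (by linarith [nutil_le hγ h0]) (by positivity),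
          ← ENNReal.ofReal_add h0.le h1, nutil, if_neg h.ne]
        congr 1
        ring
      · rw [utilGap, if_neg h0, if_pos h, ENNReal.ofReal_of_nonpos (not_lt.1 h0),
          ENNReal.zero_rpow_of_pos (by linarith)]
        simp
  · subst h
    rw [certEquiv_one, one_le_toReal_iff, lintegral_le_iff_of_add_eq
      (a := fun ω => (ENNReal.log (ENNReal.ofReal (Z ω))).toENNReal)
      (b := fun ω => (-ENNReal.log (ENNReal.ofReal (Z ω))).toENNReal) ?_ hm ?_ hfin ?_]
    · have hL := lintegral_log_toENNReal_ne_top hZ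
      generalize ∫⁻ ω, (ENNReal.log (ENNReal.ofReal (Z ω))).toENNReal ∂μ = a at hL ⊢
      generalize ∫⁻ ω, (-ENNReal.log (ENNReal.ofReal (Z ω))).toENNReal ∂μ = b
      rw [Ne, EReal.exp_eq_top_iff, ← EReal.exp_zero, EReal.exp_le_exp_iff]
      lift a to NNReal using hL
      by_cases hb : b = ⊤
      · rw [hb]; simp [EReal.sub_top]
      lift b to NNReal using hb
      rw [ENNReal.coe_le_coe, EReal.coe_nnreal_eq_coe_real, EReal.coe_nnreal_eq_coe_real,
        ← EReal.coe_sub, ← EReal.coe_zero, EReal.coe_le_coe_iff, sub_nonneg, NNReal.coe_le_coe]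
      exact and_iff_left (EReal.coe_ne_top _)
    · exact (EReal.continuous_toENNReal.measurable.comp ENNReal.measurable_log).comp_aemeasurable hm
    · exact lintegral_log_toENNReal_ne_top hZ
    · intro ω
      by_cases h0 : 0 < Z ω
      · rw [utilGap, if_pos h0, ENNReal.log_ofReal_of_pos h0, nutil, if_pos rfl, ← EReal.coe_neg,
          EReal.real_coe_toENNReal, EReal.real_coe_toENNReal]
        have := Real.log_le_sub_one_of_pos h0
        rcases le_total 0 (Real.log (Z ω)) with h1 | h1
        · rw [ENNReal.ofReal_of_nonpos (neg_nonpos.2 h1), add_zero,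
            ← ENNReal.ofReal_add (by linarith) h1, sub_add_cancel]
        · rw [ENNReal.ofReal_of_nonpos h1, add_zero, ← ENNReal.ofReal_add h0.le (by linarith),
            sub_eq_add_neg]
      · rw [utilGap, if_neg h0, if_neg (lt_irrefl _), ENNReal.ofReal_of_nonpos (not_lt.1 h0)]
        simp
  · have hr : 0 < γ - 1 := by linarith
    have hc : ENNReal.ofReal (1 / (γ - 1)) ≠ 0 := by
      rw [Ne, ENNReal.ofReal_eq_zero, not_le]; exact one_div_pos.2 hr
    rw [certEquiv_of_ne_one h.ne', one_le_toReal_iff, lintegral_le_iff_of_add_eq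
      (b := fun ω => ENNReal.ofReal (1 / (γ - 1)) * ENNReal.ofReal (Z ω) ^ (1 - γ))
      (a := fun _ => ENNReal.ofReal (1 / (γ - 1))) aemeasurable_const hm (by simp) hfin ?_]
    · rw [lintegral_const, lintegral_const_mul' _ _ ENNReal.ofReal_ne_top, measure_univ,
        ENNReal.mul_le_mul_iff_right hc ENNReal.ofReal_ne_top]
      have hI : ∫⁻ ω, ENNReal.ofReal (Z ω) ^ (1 - γ) ∂μ ≠ 0 := by
        rw [Ne, lintegral_eq_zero_iff' (hm.pow_const _)]
        intro h0
        obtain ⟨ω, hω⟩ := h0.exists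
        simp only [Pi.zero_apply, ENNReal.rpow_eq_zero_iff, ENNReal.ofReal_ne_top, false_and,
          or_false] at hω
        linarith [hω.2]
      have hp : 1 / (1 - γ) = -(1 / (γ - 1)) := by rw [← neg_sub γ 1, div_neg]
      have hp' : 0 < 1 / (γ - 1) := one_div_pos.2 hr
      set i := ∫⁻ ω, ENNReal.ofReal (Z ω) ^ (1 - γ) ∂μ
      rw [hp, ENNReal.rpow_neg, ENNReal.one_le_inv, Ne, ENNReal.inv_eq_top,
        ENNReal.rpow_eq_zero_iff_of_pos hp']
      refine ⟨fun h1 => ?_, fun h1 => ⟨ENNReal.rpow_le_one h1 hp'.le, hI⟩⟩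
      by_contra h2
      exact absurd h1.1 (not_le.2 (ENNReal.one_lt_rpow (not_le.1 h2) hp'))
    · intro ω
      have h1 : (0 : ℝ) ≤ 1 / (γ - 1) := one_div_nonneg.2 (by linarith)
      by_cases h0 : 0 < Z ω
      · rw [utilGap, if_pos h0, ENNReal.ofReal_rpow_of_pos h0, ← ENNReal.ofReal_mul h1,
          ← ENNReal.ofReal_add (by linarith [nutil_le hγ h0]) (by positivity),
          ← ENNReal.ofReal_add h0.le (by positivity), nutil, if_neg h.ne']
        congr 1
        have h1' : 1 - γ ≠ 0 := by linarith
        have h2' : γ - 1 ≠ 0 := by linarith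
        field_simp
        ring
      · rw [utilGap, if_neg h0, if_neg (not_lt.2 h.le), ENNReal.ofReal_of_nonpos (not_lt.1 h0),
          ENNReal.zero_rpow_of_neg (by linarith), ENNReal.mul_top hc]
        simp

/-- Homogeneity of the certainty equivalent. -/
theorem certEquiv_const_mul [IsProbabilityMeasure μ] {γ t : ℝ} (ht : 0 < t) {Z : Ω → ℝ}
    (hZ : Integrable Z μ) : certEquiv γ μ (fun ω => t * Z ω) = t * certEquiv γ μ Z := by
  have ht' : ENNReal.ofReal t ≠ 0 := by simpa using ht
  by_cases h : γ = 1
  · subst h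
    have hm : AEMeasurable (fun ω => ENNReal.ofReal (Z ω)) μ := hZ.1.aemeasurable.ennreal_ofReal
    have hL := lintegral_log_toENNReal_ne_top hZ
    have hL' := lintegral_log_toENNReal_ne_top (hZ.const_mul t)
    have hlogm : Measurable fun a : ℝ≥0∞ => (ENNReal.log a).toENNReal :=
      EReal.continuous_toENNReal.measurable.comp ENNReal.measurable_log
    have hm' : AEMeasurable (fun ω => ENNReal.ofReal (t * Z ω)) μ :=
      (hZ.const_mul t).1.aemeasurable.ennreal_ofReal
    have hpt : ∀ ω, (ENNReal.log (ENNReal.ofReal (t * Z ω))).toENNReal +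
        (-ENNReal.log (ENNReal.ofReal (Z ω))).toENNReal + ENNReal.ofReal (-Real.log t) =
        (ENNReal.log (ENNReal.ofReal (Z ω))).toENNReal +
        (-ENNReal.log (ENNReal.ofReal (t * Z ω))).toENNReal + ENNReal.ofReal (Real.log t) := by
      intro ω
      by_cases h0 : 0 < Z ω
      · rw [ENNReal.log_ofReal_of_pos h0, ENNReal.log_ofReal_of_pos (mul_pos ht h0),
          Real.log_mul ht.ne' h0.ne', ← EReal.coe_neg, ← EReal.coe_neg]
        simp only [EReal.real_coe_toENNReal]
        have key : ∀ x : ℝ, ENNReal.ofReal x = ENNReal.ofReal (max x 0) := fun x => by simp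
        rw [key (_ + _), key (- _), key (-Real.log t), key (Real.log (Z ω)), key (-(_ + _)),
          key (Real.log t), ← ENNReal.ofReal_add, ← ENNReal.ofReal_add, ← ENNReal.ofReal_add,
          ← ENNReal.ofReal_add] <;> try positivity
        congr 1
        rcases max_cases (Real.log t + Real.log (Z ω)) 0 with h1 | h1 <;>
        rcases max_cases (-Real.log (Z ω)) 0 with h2 | h2 <;>
        rcases max_cases (Real.log (Z ω)) 0 with h3 | h3 <;>
        rcases max_cases (-Real.log t) 0 with h4 | h4 <;>
        rcases max_cases (Real.log t) 0 with h5 | h5 <;>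
        rcases max_cases (-(Real.log t + Real.log (Z ω))) 0 with h6 | h6 <;>
        linarith
      · have h1 : t * Z ω ≤ 0 := mul_nonpos_of_nonneg_of_nonpos ht.le (not_lt.1 h0)
        rw [ENNReal.ofReal_of_nonpos (not_lt.1 h0), ENNReal.ofReal_of_nonpos h1]
        simp
    have hint := lintegral_congr (μ := μ) hpt
    rw [lintegral_add_right _ measurable_const, lintegral_add_right _ measurable_const,
      lintegral_add_left' (f := fun ω => (ENNReal.log (ENNReal.ofReal (t * Z ω))).toENNReal)
        (hlogm.comp_aemeasurable hm'),
      lintegral_add_left' (f := fun ω => (ENNReal.log (ENNReal.ofReal (Z ω))).toENNReal)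
        (hlogm.comp_aemeasurable hm), lintegral_const, lintegral_const,
      measure_univ, mul_one, mul_one] at hint
    have hexp : EReal.exp (Real.log t : ℝ) = ENNReal.ofReal t := by
      rw [EReal.exp_coe, Real.exp_log ht]
    rw [certEquiv_one, certEquiv_one]
    have ht2 : t = (ENNReal.ofReal t).toReal := (ENNReal.toReal_ofReal ht.le).symm
    generalize ∫⁻ ω, (ENNReal.log (ENNReal.ofReal (t * Z ω))).toENNReal ∂μ = a' at hL' hint ⊢
    generalize ∫⁻ ω, (-ENNReal.log (ENNReal.ofReal (t * Z ω))).toENNReal ∂μ = b' at hint ⊢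
    generalize ∫⁻ ω, (ENNReal.log (ENNReal.ofReal (Z ω))).toENNReal ∂μ = a at hL hint ⊢
    generalize ∫⁻ ω, (-ENNReal.log (ENNReal.ofReal (Z ω))).toENNReal ∂μ = b at hint ⊢
    lift a to NNReal using hL
    lift a' to NNReal using hL'
    by_cases hb : b = ⊤
    · have hb' : b' = ⊤ := by
        rw [hb, add_top, top_add] at hint
        simpa using hint.symm
      rw [hb, hb']
      simp [EReal.sub_top]
    have hb' : b' ≠ ⊤ := by
      rintro rfl
      rw [add_top, top_add] at hint
      simp [hb] at hint
    lift b to NNReal using hb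
    lift b' to NNReal using hb'
    have hr : (a' : ℝ) - b' = Real.log t + (a - b) := by
      have h1 := congrArg ENNReal.toReal hint
      rw [ENNReal.toReal_add (by simp) (by simp), ENNReal.toReal_add (by simp) (by simp),
        ENNReal.toReal_add (by simp) (by simp), ENNReal.toReal_add (by simp) (by simp),
        ENNReal.toReal_ofReal', ENNReal.toReal_ofReal'] at h1
      simp only [ENNReal.coe_toReal] at h1
      rcases max_cases (-Real.log t) 0 with h4 | h4 <;>
      rcases max_cases (Real.log t) 0 with h5 | h5 <;> linarith
    simp only [EReal.coe_nnreal_eq_coe_real, ← EReal.coe_sub]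
    rw [hr, EReal.exp_coe, EReal.exp_coe, Real.exp_add, Real.exp_log ht,
      ENNReal.toReal_ofReal (by positivity), ENNReal.toReal_ofReal (by positivity)]
  · have hp : 1 - γ ≠ 0 := by intro h'; exact h (by linarith)
    have h1 : ENNReal.ofReal t ^ (1 - γ) ≠ 0 := by
      simp only [ne_eq, ENNReal.rpow_eq_zero_iff, ht', ENNReal.ofReal_ne_top, false_and, or_self,
        not_false_eq_true]
    have h2 : ENNReal.ofReal t ^ (1 - γ) ≠ ⊤ := by
      simp only [ne_eq, ENNReal.rpow_eq_top_iff, ht', ENNReal.ofReal_ne_top, false_and, or_self,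
        not_false_eq_true]
    simp only [certEquiv_of_ne_one h, ENNReal.ofReal_mul ht.le,
      ENNReal.mul_rpow_of_ne_top ENNReal.ofReal_ne_top ENNReal.ofReal_ne_top]
    rw [lintegral_const_mul' _ _ h2, ENNReal.mul_rpow_eq_ite]
    simp only [h1, h2, false_and, or_self, if_false]
    rw [← ENNReal.rpow_mul, mul_one_div_cancel hp, ENNReal.rpow_one, ENNReal.toReal_mul,
      ENNReal.toReal_ofReal ht.le]

/-- On positive random variables with integrable utility the certainty equivalent is given by the
real utility function. -/
theorem certEquiv_eq_utilInv [IsProbabilityMeasure μ] {γ : ℝ} {Z : Ω → ℝ}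
    (hZ : ∀ᵐ ω ∂μ, 0 < Z ω) (hi : Integrable (fun ω => util γ (Z ω)) μ) :
    certEquiv γ μ Z = utilInv γ (∫ ω, util γ (Z ω) ∂μ) := by
  by_cases h : γ = 1
  · subst h
    simp only [util, if_true] at hi
    have h1 : ∫⁻ ω, (ENNReal.log (ENNReal.ofReal (Z ω))).toENNReal ∂μ =
        ∫⁻ ω, ENNReal.ofReal (Real.log (Z ω)) ∂μ := lintegral_congr_ae <| hZ.mono fun ω h0 => by
      simp only [ENNReal.log_ofReal_of_pos h0, EReal.real_coe_toENNReal]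
    have h2 : ∫⁻ ω, (-ENNReal.log (ENNReal.ofReal (Z ω))).toENNReal ∂μ =
        ∫⁻ ω, ENNReal.ofReal (-Real.log (Z ω)) ∂μ := lintegral_congr_ae <| hZ.mono fun ω h0 => by
      simp only [ENNReal.log_ofReal_of_pos h0, ← EReal.coe_neg, EReal.real_coe_toENNReal]
    simp only [utilInv, util, if_true]
    rw [certEquiv_one, h1, h2, integral_eq_lintegral_pos_part_sub_lintegral_neg_part hi]
    have h3 := hi.lintegral_lt_top.ne
    have h4 : ∫⁻ ω, ENNReal.ofReal (-Real.log (Z ω)) ∂μ ≠ ⊤ := hi.neg.lintegral_lt_top.ne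
    generalize ∫⁻ ω, ENNReal.ofReal (Real.log (Z ω)) ∂μ = a at h3 ⊢
    generalize ∫⁻ ω, ENNReal.ofReal (-Real.log (Z ω)) ∂μ = b at h4 ⊢
    lift a to NNReal using h3
    lift b to NNReal using h4
    simp only [EReal.coe_nnreal_eq_coe_real, ← EReal.coe_sub]
    rw [EReal.exp_coe, ENNReal.toReal_ofReal (by positivity)]
    rfl
  · simp only [util, if_neg h] at hi
    simp only [utilInv, util, if_neg h]
    rw [certEquiv_of_ne_one h, ← ENNReal.toReal_rpow, integral_eq_lintegral_of_nonneg_ae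
      (hZ.mono fun ω h0 => Real.rpow_nonneg h0.le _) hi.1]
    congr 2
    exact lintegral_congr_ae <| hZ.mono fun ω h0 => ENNReal.ofReal_rpow_of_pos h0

theorem certEquiv_pos [IsProbabilityMeasure μ] {γ : ℝ} {Z : Ω → ℝ}
    (hZ : ∀ᵐ ω ∂μ, 0 < Z ω) (hi : Integrable (fun ω => util γ (Z ω)) μ) :
    0 < certEquiv γ μ Z := by
  rw [certEquiv_eq_utilInv hZ hi]
  unfold utilInv
  split_ifs with h
  · exact Real.exp_pos _
  · simp only [util, if_neg h] at hi ⊢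
    apply Real.rpow_pos_of_pos
    rw [integral_pos_iff_support_of_nonneg_ae (hZ.mono fun ω h0 => Real.rpow_nonneg h0.le _) hi]
    have : (Function.support fun ω => Z ω ^ (1 - γ)) =ᵐ[μ] Set.univ :=
      eventuallyEq_univ.2 (hZ.mono fun ω h0 => (Real.rpow_pos_of_pos h0 _).ne')
    rw [measure_congr this, measure_univ]
    exact one_pos

theorem le_certEquiv_iff [IsProbabilityMeasure μ] {γ b : ℝ} (hb : 0 < b) {Z : Ω → ℝ}
    (hZ : Integrable Z μ) : b ≤ certEquiv γ μ Z ↔ 1 ≤ certEquiv γ μ fun ω => b⁻¹ * Z ω := by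
  rw [certEquiv_const_mul (inv_pos.2 hb) hZ, inv_mul_eq_div, le_div_iff₀ hb, one_mul]

/-- Monotonicity of `nutil`, written without subtraction. -/
theorem utilGap_add_le {γ z z' : ℝ} (hγ : 0 < γ) (h : z ≤ z') :
    utilGap γ z' + ENNReal.ofReal z ≤ utilGap γ z + ENNReal.ofReal z' := by
  by_cases h0 : 0 < z
  · have h0' := h0.trans_le h
    rw [utilGap, utilGap, if_pos h0, if_pos h0', ← ENNReal.ofReal_add _ h0.le,
      ← ENNReal.ofReal_add _ h0'.le]
    · exact ENNReal.ofReal_le_ofReal (by linarith [nutil_mono (γ := γ) h0 h])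
    · linarith [nutil_le hγ h0]
    · linarith [nutil_le hγ h0']
  · rw [ENNReal.ofReal_of_nonpos (not_lt.1 h0), add_zero]
    by_cases h0' : 0 < z'
    · rw [utilGap, utilGap, if_neg h0, if_pos h0']
      split_ifs with h1
      · rw [← ENNReal.ofReal_add (one_div_nonneg.2 (by linarith)) h0'.le]
        apply ENNReal.ofReal_le_ofReal
        rw [nutil, if_neg h1.ne, sub_div]
        have : 0 ≤ z' ^ (1 - γ) / (1 - γ) :=
          div_nonneg (Real.rpow_nonneg h0'.le _) (by linarith)
        linarith
      · simp
    · rw [utilGap, utilGap, if_neg h0, if_neg h0']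
      exact le_self_add

theorem certEquiv_mono [IsProbabilityMeasure μ] {γ : ℝ} (hγ : 0 < γ) {Z Z' : Ω → ℝ}
    (hZ : Integrable Z μ) (hZ' : Integrable Z' μ) (h : Z ≤ᵐ[μ] Z') :
    certEquiv γ μ Z ≤ certEquiv γ μ Z' := by
  rcases (certEquiv_nonneg γ μ Z).eq_or_lt with h0 | h0
  · rw [← h0]; exact certEquiv_nonneg _ _ _
  set b := certEquiv γ μ Z with hb
  have h1 := (le_certEquiv_iff h0 hZ).1 hb.le
  rw [le_certEquiv_iff h0 hZ']
  rw [one_le_certEquiv_iff hγ (hZ.const_mul _)] at h1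
  rw [one_le_certEquiv_iff hγ (hZ'.const_mul _)]
  have hm : AEMeasurable (fun ω => ENNReal.ofReal (b⁻¹ * Z ω)) μ :=
    (hZ.const_mul _).1.aemeasurable.ennreal_ofReal
  have hm' : AEMeasurable (fun ω => ENNReal.ofReal (b⁻¹ * Z' ω)) μ :=
    (hZ'.const_mul _).1.aemeasurable.ennreal_ofReal
  have h2 : ∫⁻ ω, utilGap γ (b⁻¹ * Z' ω) ∂μ + ∫⁻ ω, ENNReal.ofReal (b⁻¹ * Z ω) ∂μ ≤
      ∫⁻ ω, utilGap γ (b⁻¹ * Z ω) ∂μ + ∫⁻ ω, ENNReal.ofReal (b⁻¹ * Z' ω) ∂μ := by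
    rw [← lintegral_add_right' _ hm, ← lintegral_add_right' _ hm']
    exact lintegral_mono_ae (h.mono fun ω hω =>
      utilGap_add_le hγ (mul_le_mul_of_nonneg_left hω (inv_nonneg.2 h0.le)))
  refine (ENNReal.add_le_add_iff_right (lintegral_ofReal_ne_top (hZ.const_mul b⁻¹))).1 (h2.trans ?_)
  rw [add_comm]
  gcongr

/-- The reverse Minkowski inequality. -/
theorem certEquiv_add_le [IsProbabilityMeasure μ] {γ : ℝ} (hγ : 0 < γ) {Z Z' : Ω → ℝ}
    (hZ : Integrable Z μ) (hZ' : Integrable Z' μ) (h0 : 0 ≤ᵐ[μ] Z) (h0' : 0 ≤ᵐ[μ] Z') :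
    certEquiv γ μ Z + certEquiv γ μ Z' ≤ certEquiv γ μ fun ω => Z ω + Z' ω := by
  rcases (certEquiv_nonneg γ μ Z).eq_or_lt with ha | ha
  · rw [← ha, zero_add]
    exact certEquiv_mono hγ hZ' (hZ.add hZ') (h0.mono fun ω hω => le_add_of_nonneg_left hω)
  rcases (certEquiv_nonneg γ μ Z').eq_or_lt with hb | hb
  · rw [← hb, add_zero]
    exact certEquiv_mono hγ hZ (hZ.add hZ') (h0'.mono fun ω hω => le_add_of_nonneg_right hω)
  have h1 := (le_certEquiv_iff ha hZ).1 le_rfl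
  have h2 := (le_certEquiv_iff hb hZ').1 le_rfl
  set a := certEquiv γ μ Z
  set b := certEquiv γ μ Z'
  have hab : 0 < a + b := by positivity
  rw [le_certEquiv_iff (Z := fun ω => Z ω + Z' ω) hab (hZ.add hZ')]
  rw [one_le_certEquiv_iff hγ (hZ.const_mul _)] at h1
  rw [one_le_certEquiv_iff hγ (hZ'.const_mul _)] at h2
  rw [one_le_certEquiv_iff (Z := fun ω => (a + b)⁻¹ * (Z ω + Z' ω)) hγ ((hZ.add hZ').const_mul _)]
  -- the normalised sum is a convex combination of the normalised summands
  set s := a / (a + b) with hs_def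
  set t := b / (a + b) with ht_def
  have hs : 0 < s := by positivity
  have ht : 0 < t := by positivity
  have hst : s + t = 1 := by rw [hs_def, ht_def]; field_simp
  have hcomb : ∀ ω, (a + b)⁻¹ * (Z ω + Z' ω) = s * (a⁻¹ * Z ω) + t * (b⁻¹ * Z' ω) := by
    intro ω; rw [hs_def, ht_def]; field_simp
  have hm : AEMeasurable (fun ω => utilGap γ (a⁻¹ * Z ω)) μ :=
    (measurable_utilGap γ).comp_aemeasurable (hZ.const_mul _).1.aemeasurable
  have hm' : AEMeasurable (fun ω => ENNReal.ofReal (a⁻¹ * Z ω)) μ :=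
    (hZ.const_mul _).1.aemeasurable.ennreal_ofReal
  simp only [hcomb]
  calc ∫⁻ ω, utilGap γ (s * (a⁻¹ * Z ω) + t * (b⁻¹ * Z' ω)) ∂μ
      ≤ ∫⁻ ω, ENNReal.ofReal s * utilGap γ (a⁻¹ * Z ω) +
          ENNReal.ofReal t * utilGap γ (b⁻¹ * Z' ω) ∂μ := by
        refine lintegral_mono_ae ?_
        filter_upwards [h0, h0'] with ω hω hω'
        exact utilGap_convex hγ (mul_nonneg (inv_nonneg.2 ha.le) hω)
          (mul_nonneg (inv_nonneg.2 hb.le) hω') hs ht hst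
    _ = ENNReal.ofReal s * ∫⁻ ω, utilGap γ (a⁻¹ * Z ω) ∂μ +
          ENNReal.ofReal t * ∫⁻ ω, utilGap γ (b⁻¹ * Z' ω) ∂μ := by
        rw [lintegral_add_left' (hm.const_mul _), lintegral_const_mul' _ _ ENNReal.ofReal_ne_top,
          lintegral_const_mul' _ _ ENNReal.ofReal_ne_top]
    _ ≤ ENNReal.ofReal s * ∫⁻ ω, ENNReal.ofReal (a⁻¹ * Z ω) ∂μ +
          ENNReal.ofReal t * ∫⁻ ω, ENNReal.ofReal (b⁻¹ * Z' ω) ∂μ := by gcongr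
    _ = ∫⁻ ω, ENNReal.ofReal (s * (a⁻¹ * Z ω) + t * (b⁻¹ * Z' ω)) ∂μ := by
        rw [← lintegral_const_mul' _ _ ENNReal.ofReal_ne_top,
          ← lintegral_const_mul' _ _ ENNReal.ofReal_ne_top, ← lintegral_add_left' (hm'.const_mul _)]
        refine lintegral_congr_ae ?_
        filter_upwards [h0, h0'] with ω hω hω'
        have e1 := mul_nonneg (inv_nonneg.2 ha.le) hω
        have e2 := mul_nonneg (inv_nonneg.2 hb.le) hω'
        rw [ENNReal.ofReal_add (mul_nonneg hs.le e1) (mul_nonneg ht.le e2),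
          ENNReal.ofReal_mul hs.le, ENNReal.ofReal_mul ht.le]

/-- Upper semicontinuity of the certainty equivalent, by Fatou's lemma. -/
theorem le_certEquiv_of_tendsto [IsProbabilityMeasure μ] {γ b : ℝ} (hγ : 0 < γ) {Z : Ω → ℝ}
    {Zs : ℕ → Ω → ℝ} (hZ : Integrable Z μ) (hZs : ∀ m, Integrable (Zs m) μ)
    (h0 : ∀ m, 0 ≤ᵐ[μ] Zs m) (hlim : ∀ᵐ ω ∂μ, Tendsto (fun m => Zs m ω) atTop (𝓝 (Z ω)))
    (hint : Tendsto (fun m => ∫ ω, Zs m ω ∂μ) atTop (𝓝 (∫ ω, Z ω ∂μ)))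
    (hb : ∀ᶠ m in atTop, b ≤ certEquiv γ μ (Zs m)) : b ≤ certEquiv γ μ Z := by
  rcases le_or_gt b 0 with hb0 | hb0
  · exact hb0.trans (certEquiv_nonneg _ _ _)
  have h0' : ∀ᵐ ω ∂μ, ∀ m, 0 ≤ Zs m ω := ae_all_iff.2 h0
  have hZ0 : 0 ≤ᵐ[μ] Z := by
    filter_upwards [h0', hlim] with ω h1 h2 using ge_of_tendsto' h2 h1
  rw [le_certEquiv_iff hb0 hZ, one_le_certEquiv_iff hγ (hZ.const_mul _)]
  have hofReal : ∀ {Y : Ω → ℝ}, Integrable Y μ → 0 ≤ᵐ[μ] Y →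
      ∫⁻ ω, ENNReal.ofReal (b⁻¹ * Y ω) ∂μ = ENNReal.ofReal (b⁻¹ * ∫ ω, Y ω ∂μ) := by
    intro Y hY hY0
    rw [← integral_const_mul, ofReal_integral_eq_lintegral_ofReal (hY.const_mul _)
      (hY0.mono fun ω hω => mul_nonneg (inv_nonneg.2 hb0.le) hω)]
  calc ∫⁻ ω, utilGap γ (b⁻¹ * Z ω) ∂μ
      = ∫⁻ ω, liminf (fun m => utilGap γ (b⁻¹ * Zs m ω)) atTop ∂μ := by
        refine lintegral_congr_ae ?_
        filter_upwards [h0', hlim, hZ0] with ω h1 h2 h3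
        exact (tendsto_utilGap (mul_nonneg (inv_nonneg.2 hb0.le) h3)
          (fun m => mul_nonneg (inv_nonneg.2 hb0.le) (h1 m)) (h2.const_mul _)).liminf_eq.symm
    _ ≤ liminf (fun m => ∫⁻ ω, utilGap γ (b⁻¹ * Zs m ω) ∂μ) atTop :=
        lintegral_liminf_le' fun m => (measurable_utilGap γ).comp_aemeasurable
          ((hZs m).const_mul _).1.aemeasurable
    _ ≤ liminf (fun m => ENNReal.ofReal (b⁻¹ * ∫ ω, Zs m ω ∂μ)) atTop := by
        refine liminf_le_liminf ?_
        filter_upwards [hb] with m hm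
        rw [← hofReal (hZs m) (h0 m)]
        rw [le_certEquiv_iff hb0 (hZs m)] at hm
        exact (one_le_certEquiv_iff hγ ((hZs m).const_mul _)).1 hm
    _ = ENNReal.ofReal (b⁻¹ * ∫ ω, Z ω ∂μ) :=
        (ENNReal.tendsto_ofReal (hint.const_mul _)).liminf_eq
    _ = _ := (hofReal hZ hZ0).symm

end CertEquiv

/-! ### The aggregator -/

section Aggregator

variable {β ρ : ℝ}

/-- The lottery on two outcomes with probabilities `1 - β` and `β`. -/
def twoPoint (β : ℝ) : Measure Bool :=
  ENNReal.ofReal (1 - β) • Measure.dirac true + ENNReal.ofReal β • Measure.dirac false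

theorem isProbabilityMeasure_twoPoint (hβ : 0 < β) (hβ1 : β < 1) :
    IsProbabilityMeasure (twoPoint β) := by
  constructor
  simp only [twoPoint, Measure.coe_add, Measure.coe_smul, Pi.add_apply, Pi.smul_apply,
    measure_univ, smul_eq_mul, mul_one]
  rw [← ENNReal.ofReal_add (by linarith) hβ.le]
  simp

theorem lintegral_twoPoint (f : Bool → ℝ≥0∞) :
    ∫⁻ i, f i ∂twoPoint β = ENNReal.ofReal (1 - β) * f true + ENNReal.ofReal β * f false := by
  rw [twoPoint, lintegral_add_measure, lintegral_smul_measure, lintegral_smul_measure,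
    lintegral_dirac, lintegral_dirac, smul_eq_mul, smul_eq_mul]

theorem integrable_twoPoint (hβ : 0 < β) (hβ1 : β < 1) (f : Bool → ℝ) :
    Integrable f (twoPoint β) := by
  have := isProbabilityMeasure_twoPoint hβ hβ1
  exact Integrable.of_finite

/-- The aggregator is the certainty equivalent of a two-point lottery, with `ρ` in the role of the
risk aversion degree. -/
theorem aggregator_eq_certEquiv (hβ : 0 < β) (hβ1 : β < 1) {c z : ℝ} (hc : 0 ≤ c) (hz : 0 ≤ z) :
    aggregator β ρ c z = certEquiv ρ (twoPoint β) fun i => cond i c z := by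
  have := isProbabilityMeasure_twoPoint hβ hβ1
  have hβ' : ENNReal.ofReal β ≠ 0 := by simpa using hβ
  have hβ1' : ENNReal.ofReal (1 - β) ≠ 0 := by simpa using hβ1
  by_cases hpos : 0 < c ∧ 0 < z
  · have h1 : ∀ᵐ i ∂twoPoint β, 0 < cond i c z :=
      Eventually.of_forall fun i => by cases i <;> simp [hpos.1, hpos.2]
    rw [certEquiv_eq_utilInv h1 (integrable_twoPoint hβ hβ1 _)]
    have h2 : ∀ f : Bool → ℝ, ∫ i, f i ∂twoPoint β = (1 - β) * f true + β * f false := by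
      intro f
      rw [twoPoint, integral_add_measure, integral_smul_measure, integral_smul_measure,
        integral_dirac, integral_dirac, ENNReal.toReal_ofReal (by linarith),
        ENNReal.toReal_ofReal hβ.le, smul_eq_mul, smul_eq_mul]
      · exact (integrable_dirac (by simp)).smul_measure ENNReal.ofReal_ne_top
      · exact (integrable_dirac (by simp)).smul_measure ENNReal.ofReal_ne_top
    rw [h2]
    unfold aggregator utilInv util
    simp only [hpos.1.ne', hpos.2.ne', or_self, and_false, if_false, cond_true, cond_false]
    split_ifs <;> rfl
  · have h0 : c = 0 ∨ z = 0 := by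
      by_contra h; push Not at h
      exact hpos ⟨lt_of_le_of_ne hc h.1.symm, lt_of_le_of_ne hz h.2.symm⟩
    rcases lt_trichotomy ρ 1 with h | h | h
    · have hp : 0 < 1 - ρ := by linarith
      rw [certEquiv_of_ne_one h.ne, lintegral_twoPoint]
      simp only [aggregator, not_le.2 h, false_and, if_false, h.ne, cond_true, cond_false]
      rw [ENNReal.ofReal_rpow_of_nonneg hc hp.le, ENNReal.ofReal_rpow_of_nonneg hz hp.le,
        ← ENNReal.ofReal_mul (by linarith), ← ENNReal.ofReal_mul hβ.le,
        ← ENNReal.ofReal_add (mul_nonneg (by linarith) (Real.rpow_nonneg hc _))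
          (mul_nonneg hβ.le (Real.rpow_nonneg hz _)), ← ENNReal.toReal_rpow,
        ENNReal.toReal_ofReal (add_nonneg (mul_nonneg (by linarith) (Real.rpow_nonneg hc _))
          (mul_nonneg hβ.le (Real.rpow_nonneg hz _)))]
    · subst h
      rw [certEquiv_one]
      simp only [lintegral_twoPoint, aggregator, le_refl, h0, true_and, if_true, cond_true,
        cond_false]
      have hx : ∀ x : ℝ, (ENNReal.log (ENNReal.ofReal x)).toENNReal ≠ ⊤ := by
        intro x
        rw [EReal.toENNReal_ne_top_iff, Ne, ENNReal.log_eq_top_iff]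
        exact ENNReal.ofReal_ne_top
      have hb : ENNReal.ofReal (1 - β) * (-ENNReal.log (ENNReal.ofReal c)).toENNReal +
          ENNReal.ofReal β * (-ENNReal.log (ENNReal.ofReal z)).toENNReal = ⊤ := by
        rcases h0 with rfl | rfl
        · simp [ENNReal.mul_top hβ1']
        · simp [ENNReal.mul_top hβ']
      rw [hb]
      simp [EReal.sub_top]
    · have hp : 1 - ρ < 0 := by linarith
      rw [certEquiv_of_ne_one h.ne', lintegral_twoPoint]
      simp only [aggregator, h.le, h0, true_and, if_true, cond_true, cond_false]
      have ht : ENNReal.ofReal (1 - β) * ENNReal.ofReal c ^ (1 - ρ) +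
          ENNReal.ofReal β * ENNReal.ofReal z ^ (1 - ρ) = ⊤ := by
        rcases h0 with rfl | rfl
        · rw [ENNReal.ofReal_zero, ENNReal.zero_rpow_of_neg hp, ENNReal.mul_top hβ1', top_add]
        · rw [ENNReal.ofReal_zero, ENNReal.zero_rpow_of_neg hp, ENNReal.mul_top hβ', add_top]
      rw [ht, ENNReal.top_rpow_of_neg (one_div_neg.2 hp), ENNReal.toReal_zero]

theorem aggregator_nonneg (hβ : 0 < β) (hβ1 : β < 1) {c z : ℝ} (hc : 0 ≤ c) (hz : 0 ≤ z) :
    0 ≤ aggregator β ρ c z := by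
  rw [aggregator_eq_certEquiv hβ hβ1 hc hz]; exact certEquiv_nonneg _ _ _

theorem aggregator_pos (hβ : 0 < β) (hβ1 : β < 1) {c z : ℝ} (hc : 0 < c) (hz : 0 < z) :
    0 < aggregator β ρ c z := by
  have := isProbabilityMeasure_twoPoint hβ hβ1
  rw [aggregator_eq_certEquiv hβ hβ1 hc.le hz.le]
  exact certEquiv_pos (Eventually.of_forall fun i => by cases i <;> simp [hc, hz])
    (integrable_twoPoint hβ hβ1 _)

theorem aggregator_mono (hβ : 0 < β) (hβ1 : β < 1) (hρ : 0 < ρ) {c c' z z' : ℝ} (hc : 0 ≤ c)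
    (hz : 0 ≤ z) (hcc : c ≤ c') (hzz : z ≤ z') : aggregator β ρ c z ≤ aggregator β ρ c' z' := by
  have := isProbabilityMeasure_twoPoint hβ hβ1
  rw [aggregator_eq_certEquiv hβ hβ1 hc hz,
    aggregator_eq_certEquiv hβ hβ1 (hc.trans hcc) (hz.trans hzz)]
  exact certEquiv_mono hρ (integrable_twoPoint hβ hβ1 _) (integrable_twoPoint hβ hβ1 _)
    (Eventually.of_forall fun i => by cases i <;> simp [hcc, hzz])

theorem aggregator_mul (hβ : 0 < β) (hβ1 : β < 1) {t c z : ℝ} (ht : 0 < t) (hc : 0 ≤ c)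
    (hz : 0 ≤ z) : aggregator β ρ (t * c) (t * z) = t * aggregator β ρ c z := by
  have := isProbabilityMeasure_twoPoint hβ hβ1
  rw [aggregator_eq_certEquiv hβ hβ1 hc hz,
    aggregator_eq_certEquiv hβ hβ1 (by positivity) (by positivity),
    ← certEquiv_const_mul ht (integrable_twoPoint hβ hβ1 _)]
  congr 1
  funext i; cases i <;> rfl

theorem aggregator_add_le (hβ : 0 < β) (hβ1 : β < 1) (hρ : 0 < ρ) {c c' z z' : ℝ} (hc : 0 ≤ c)
    (hz : 0 ≤ z) (hc' : 0 ≤ c') (hz' : 0 ≤ z') :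
    aggregator β ρ c z + aggregator β ρ c' z' ≤ aggregator β ρ (c + c') (z + z') := by
  have := isProbabilityMeasure_twoPoint hβ hβ1
  rw [aggregator_eq_certEquiv hβ hβ1 hc hz, aggregator_eq_certEquiv hβ hβ1 hc' hz',
    aggregator_eq_certEquiv hβ hβ1 (by positivity) (by positivity)]
  refine (certEquiv_add_le hρ (integrable_twoPoint hβ hβ1 _) (integrable_twoPoint hβ hβ1 _)
    (Eventually.of_forall fun i => by cases i <;> simpa)
    (Eventually.of_forall fun i => by cases i <;> simpa)).trans_eq ?_
  congr 1
  funext i; cases i <;> rfl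

/-- Concavity of the aggregator in its second argument. -/
theorem aggregator_concave (hβ : 0 < β) (hβ1 : β < 1) (hρ : 0 < ρ) {c z z' s t : ℝ} (hc : 0 ≤ c)
    (hz : 0 ≤ z) (hz' : 0 ≤ z') (hs : 0 ≤ s) (ht : 0 ≤ t) (hst : s + t = 1) :
    s * aggregator β ρ c z + t * aggregator β ρ c z' ≤ aggregator β ρ c (s * z + t * z') := by
  rcases hs.eq_or_lt with rfl | hs
  · obtain rfl : t = 1 := by linarith
    simp
  rcases ht.eq_or_lt with rfl | ht
  · obtain rfl : s = 1 := by linarith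
    simp
  rw [← aggregator_mul hβ hβ1 hs hc hz, ← aggregator_mul hβ hβ1 ht hc hz']
  refine (aggregator_add_le hβ hβ1 hρ (by positivity) (by positivity) (by positivity)
    (by positivity)).trans_eq ?_
  rw [← add_mul, hst, one_mul]

theorem aggregator_strictMono_left (hβ : 0 < β) (hβ1 : β < 1) {c c' z : ℝ}
    (hc : 0 < c) (hcc : c < c') (hz : 0 < z) : aggregator β ρ c z < aggregator β ρ c' z := by
  have hc' := hc.trans hcc
  simp only [aggregator, hc.ne', hc'.ne', hz.ne', or_self, and_false, if_false]
  split_ifs with h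
  · rw [Real.exp_lt_exp]
    have := mul_lt_mul_of_pos_left (Real.log_lt_log hc hcc) (sub_pos.2 hβ1)
    linarith
  · have p1 := Real.rpow_pos_of_pos hc (1 - ρ)
    have p1' := Real.rpow_pos_of_pos hc' (1 - ρ)
    have p2 := Real.rpow_pos_of_pos hz (1 - ρ)
    have p3 : 0 < 1 - β := by linarith
    rcases lt_or_gt_of_ne h with h | h
    · apply Real.rpow_lt_rpow (by positivity) _ (one_div_pos.2 (by linarith))
      have := mul_lt_mul_of_pos_left (Real.rpow_lt_rpow hc.le hcc (z := 1 - ρ) (by linarith)) p3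
      linarith
    · apply Real.rpow_lt_rpow_of_neg (by positivity) _ (one_div_neg.2 (by linarith))
      have := mul_lt_mul_of_pos_left (Real.rpow_lt_rpow_of_neg hc hcc (z := 1 - ρ) (by linarith)) p3
      linarith

/-- The aggregator is continuous on `[0, ∞)²` away from the origin. For `ρ ≥ 1` the formulas used
here extend the defining ones to the axes, where the aggregator is set to `0`. -/
theorem continuousOn_aggregator (hβ : 0 < β) (hβ1 : β < 1) :
    ContinuousOn (fun p : ℝ × ℝ => aggregator β ρ p.1 p.2)
      {p | 0 ≤ p.1 ∧ 0 ≤ p.2 ∧ 0 < p.1 + p.2} := by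
  rcases lt_trichotomy ρ 1 with h | h | h
  · have : (fun p : ℝ × ℝ => aggregator β ρ p.1 p.2) =
        fun p => ((1 - β) * p.1 ^ (1 - ρ) + β * p.2 ^ (1 - ρ)) ^ (1 / (1 - ρ)) := by
      funext p; simp [aggregator, not_le.2 h, h.ne]
    rw [this]
    have h1 : 0 ≤ 1 - ρ := by linarith
    exact (((continuous_const.mul (continuous_fst.rpow_const fun _ => Or.inr h1)).add
      (continuous_const.mul (continuous_snd.rpow_const fun _ => Or.inr h1))).rpow_const
        fun _ => Or.inr (one_div_nonneg.2 h1)).continuousOn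
  · subst h
    refine ContinuousOn.congr (f := fun p : ℝ × ℝ => p.1 ^ (1 - β) * p.2 ^ β) ?_ ?_
    · exact ((continuous_fst.rpow_const fun _ => Or.inr (by linarith)).mul
        (continuous_snd.rpow_const fun _ => Or.inr hβ.le)).continuousOn
    · rintro ⟨c, z⟩ ⟨hc, hz, -⟩
      simp only at hc hz
      simp only [aggregator, le_refl, true_and, if_true]
      split_ifs with h0
      · rcases h0 with rfl | rfl
        · rw [Real.zero_rpow (by linarith), zero_mul]
        · rw [Real.zero_rpow hβ.ne', mul_zero]
      · push Not at h0
        rw [Real.rpow_def_of_pos (lt_of_le_of_ne hc h0.1.symm),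
          Real.rpow_def_of_pos (lt_of_le_of_ne hz h0.2.symm), ← Real.exp_add]
        ring_nf
  · have hs : 0 < ρ - 1 := by linarith
    have hβ' : 0 < 1 - β := by linarith
    have hden : ∀ p ∈ {p : ℝ × ℝ | 0 ≤ p.1 ∧ 0 ≤ p.2 ∧ 0 < p.1 + p.2},
        0 < (1 - β) * p.2 ^ (ρ - 1) + β * p.1 ^ (ρ - 1) := by
      rintro ⟨c, z⟩ ⟨hc, hz, hcz⟩
      simp only at hc hz hcz ⊢
      rcases hc.eq_or_lt with rfl | hc'
      · have := Real.rpow_pos_of_pos (show 0 < z by linarith) (ρ - 1)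
        have := Real.rpow_nonneg (le_refl (0 : ℝ)) (ρ - 1)
        positivity
      · have := Real.rpow_pos_of_pos hc' (ρ - 1)
        have := Real.rpow_nonneg hz (ρ - 1)
        positivity
    refine ContinuousOn.congr (f := fun p : ℝ × ℝ =>
      p.1 * p.2 / ((1 - β) * p.2 ^ (ρ - 1) + β * p.1 ^ (ρ - 1)) ^ (1 / (ρ - 1))) ?_ ?_
    · refine ContinuousOn.div (by fun_prop) ?_ fun p hp => (Real.rpow_pos_of_pos (hden p hp) _).ne'
      exact ((continuous_const.mul (continuous_snd.rpow_const fun _ => Or.inr hs.le)).add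
        (continuous_const.mul (continuous_fst.rpow_const fun _ => Or.inr hs.le))).continuousOn.rpow_const
          fun p hp => Or.inl (hden p hp).ne'
    · rintro ⟨c, z⟩ hp
      have hd := hden _ hp
      obtain ⟨hc, hz, hcz⟩ := hp
      simp only at hc hz hcz hd
      simp only [aggregator, h.le, true_and]
      split_ifs with h0 h1
      · rcases h0 with rfl | rfl <;> simp
      · exact absurd h1 h.ne'
      · push Not at h0
        have hc0 := lt_of_le_of_ne hc h0.1.symm
        have hz0 := lt_of_le_of_ne hz h0.2.symm
        have e1 : (1 - β) * c ^ (1 - ρ) + β * z ^ (1 - ρ) =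
            ((1 - β) * z ^ (ρ - 1) + β * c ^ (ρ - 1)) * (c * z) ^ (1 - ρ) := by
          rw [Real.mul_rpow hc hz, ← neg_sub ρ 1, Real.rpow_neg hc, Real.rpow_neg hz]
          have p1 := Real.rpow_pos_of_pos hc0 (ρ - 1)
          have p2 := Real.rpow_pos_of_pos hz0 (ρ - 1)
          field_simp
        rw [e1, Real.mul_rpow hd.le (Real.rpow_nonneg (by positivity) _), ← Real.rpow_mul
          (by positivity), mul_one_div_cancel (by linarith), Real.rpow_one, ← neg_sub ρ 1,
          one_div_neg_eq_neg_one_div, Real.rpow_neg hd.le]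
        field_simp

end Aggregator

/-! ### The consumption choice -/

section Consumption

variable {β ρ : ℝ} {I : Set ℝ}

/-- The value of the optimal consumption propensity in `I`, if the wealth that is not consumed is
worth `d` per unit. -/
def consValue (β ρ : ℝ) (I : Set ℝ) (d : ℝ) : ℝ :=
  sSup ((fun c => aggregator β ρ c ((1 - c) * d)) '' I)

/-- Near `0` the gain `B ε ^ s`, with `s < 1`, outweighs a loss of order `ε`. -/
theorem eventually_lt_add_rpow {A B s : ℝ} (hA : 0 < A) (hB : 0 < B) (hs1 : s < 1) :
    ∀ᶠ ε in 𝓝[>] (0 : ℝ), A < A * (1 - ε) ^ s + B * ε ^ s := by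
  have hlim : Tendsto (fun ε : ℝ => ε ^ (1 - s)) (𝓝[>] 0) (𝓝 0) := by
    have := (Real.continuousAt_rpow_const (0 : ℝ) (1 - s) (Or.inr (by linarith))).tendsto
    rw [Real.zero_rpow (by linarith)] at this
    exact this.mono_left nhdsWithin_le_nhds
  filter_upwards [hlim.eventually (gt_mem_nhds (div_pos hB hA)), self_mem_nhdsWithin,
    nhdsWithin_le_nhds (gt_mem_nhds one_pos)] with ε h1 (h2 : 0 < ε) h3
  rw [lt_div_iff₀ hA] at h1
  have h4 : 1 - ε ≤ (1 - ε) ^ s := by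
    calc 1 - ε = (1 - ε) ^ (1 : ℝ) := (Real.rpow_one _).symm
      _ ≤ _ := Real.rpow_le_rpow_of_exponent_ge (by linarith) (by linarith) hs1.le
  have h5 : ε = ε ^ (1 - s) * ε ^ s := by
    rw [← Real.rpow_add h2, sub_add_cancel, Real.rpow_one]
  have h6 := Real.rpow_pos_of_pos h2 s
  have h7 : A * ε < B * ε ^ s := by
    calc A * ε = (ε ^ (1 - s) * A) * ε ^ s := by nth_rewrite 1 [h5]; ring
      _ < B * ε ^ s := mul_lt_mul_of_pos_right h1 h6
  have h8 := mul_le_mul_of_nonneg_left h4 hA.le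
  linarith

/-- Consuming a little is better than consuming nothing: for `ρ < 1` because the aggregator has
infinite slope there, for `ρ ≥ 1` because it vanishes there. -/
theorem eventually_aggregator_zero_lt (hβ : 0 < β) (hβ1 : β < 1) (hρ : 0 < ρ) {d : ℝ}
    (hd : 0 < d) :
    ∀ᶠ c in 𝓝[>] (0 : ℝ), aggregator β ρ 0 d < aggregator β ρ c ((1 - c) * d) := by
  rcases lt_or_ge ρ 1 with h | h
  · have hs : 0 < 1 - ρ := by linarith
    have hd' := Real.rpow_pos_of_pos hd (1 - ρ)
    filter_upwards [eventually_lt_add_rpow (s := 1 - ρ) (mul_pos hβ hd') (sub_pos.2 hβ1)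
      (by linarith), self_mem_nhdsWithin, nhdsWithin_le_nhds (gt_mem_nhds one_pos)]
      with c h1 (h2 : 0 < c) h3
    simp only [aggregator, not_le.2 h, false_and, if_false, h.ne]
    rw [Real.zero_rpow hs.ne', mul_zero, zero_add, Real.mul_rpow (by linarith) hd.le]
    refine Real.rpow_lt_rpow (by positivity) ?_ (one_div_pos.2 hs)
    linarith
  · filter_upwards [self_mem_nhdsWithin, nhdsWithin_le_nhds (gt_mem_nhds one_pos)]
      with c (h2 : 0 < c) h3
    have : aggregator β ρ 0 d = 0 := by simp [aggregator, h]
    rw [this]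
    exact aggregator_pos hβ hβ1 h2 (mul_pos (by linarith) hd)

/-- Saving a little is better than saving nothing, for the same reasons. -/
theorem eventually_aggregator_one_lt (hβ : 0 < β) (hβ1 : β < 1) (hρ : 0 < ρ) {d : ℝ}
    (hd : 0 < d) :
    ∀ᶠ ε in 𝓝[>] (0 : ℝ), aggregator β ρ 1 0 < aggregator β ρ (1 - ε) (ε * d) := by
  rcases lt_or_ge ρ 1 with h | h
  · have hs : 0 < 1 - ρ := by linarith
    have hd' := Real.rpow_pos_of_pos hd (1 - ρ)
    filter_upwards [eventually_lt_add_rpow (s := 1 - ρ) (sub_pos.2 hβ1) (mul_pos hβ hd')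
      (by linarith), self_mem_nhdsWithin, nhdsWithin_le_nhds (gt_mem_nhds one_pos)]
      with ε h1 (h2 : 0 < ε) h3
    simp only [aggregator, not_le.2 h, false_and, if_false, h.ne]
    rw [Real.zero_rpow hs.ne', mul_zero, add_zero, Real.mul_rpow h2.le hd.le, Real.one_rpow,
      mul_one]
    refine Real.rpow_lt_rpow (by linarith) ?_ (one_div_pos.2 hs)
    linarith
  · filter_upwards [self_mem_nhdsWithin, nhdsWithin_le_nhds (gt_mem_nhds one_pos)]
      with c (h2 : 0 < c) h3
    have : aggregator β ρ 1 0 = 0 := by simp [aggregator, h]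
    rw [this]
    exact aggregator_pos hβ hβ1 (by linarith) (mul_pos h2 hd)

theorem bddAbove_consumption (hβ : 0 < β) (hβ1 : β < 1) (hρ : 0 < ρ) (hI : I ⊆ Set.Ioo 0 1)
    {d : ℝ} (hd : 0 ≤ d) :
    BddAbove ((fun c => aggregator β ρ c ((1 - c) * d)) '' I) := by
  refine ⟨aggregator β ρ 1 d, ?_⟩
  rintro _ ⟨c, hc, rfl⟩
  obtain ⟨h1, h2⟩ := hI hc
  refine aggregator_mono hβ hβ1 hρ h1.le (mul_nonneg (by linarith) hd) h2.le ?_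
  nlinarith

theorem le_consValue (hβ : 0 < β) (hβ1 : β < 1) (hρ : 0 < ρ) (hI : I ⊆ Set.Ioo 0 1)
    {c d : ℝ} (hc : c ∈ I) (hd : 0 ≤ d) :
    aggregator β ρ c ((1 - c) * d) ≤ consValue β ρ I d :=
  le_csSup (bddAbove_consumption hβ hβ1 hρ hI hd) ⟨c, hc, rfl⟩

theorem consValue_le (hne : I.Nonempty) {d K : ℝ}
    (h : ∀ c ∈ I, aggregator β ρ c ((1 - c) * d) ≤ K) : consValue β ρ I d ≤ K :=
  csSup_le (hne.image _) (by rintro _ ⟨c, hc, rfl⟩; exact h c hc)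

theorem consValue_mono (hβ : 0 < β) (hβ1 : β < 1) (hρ : 0 < ρ) (hI : I ⊆ Set.Ioo 0 1)
    (hne : I.Nonempty) {d d' : ℝ} (hd : 0 ≤ d) (h : d ≤ d') :
    consValue β ρ I d ≤ consValue β ρ I d' := by
  refine consValue_le hne fun c hc => ?_
  have hc1 : 0 ≤ 1 - c := by linarith [(hI hc).2]
  exact (aggregator_mono hβ hβ1 hρ (hI hc).1.le (mul_nonneg hc1 hd) le_rfl
    (mul_le_mul_of_nonneg_left h hc1)).trans (le_consValue hβ hβ1 hρ hI hc (hd.trans h))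

theorem consValue_nonneg (hβ : 0 < β) (hβ1 : β < 1) (hρ : 0 < ρ) (hI : I ⊆ Set.Ioo 0 1)
    (hne : I.Nonempty) {d : ℝ} (hd : 0 ≤ d) : 0 ≤ consValue β ρ I d := by
  obtain ⟨c, hc⟩ := hne
  exact (aggregator_nonneg hβ hβ1 (hI hc).1.le (mul_nonneg (by linarith [(hI hc).2]) hd)).trans
    (le_consValue hβ hβ1 hρ hI hc hd)

theorem consValue_pos (hβ : 0 < β) (hβ1 : β < 1) (hρ : 0 < ρ) (hI : I ⊆ Set.Ioo 0 1)
    (hne : I.Nonempty) {d : ℝ} (hd : 0 < d) : 0 < consValue β ρ I d := by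
  obtain ⟨c, hc⟩ := hne
  exact (aggregator_pos hβ hβ1 (hI hc).1 (mul_pos (by linarith [(hI hc).2]) hd)).trans_le
    (le_consValue hβ hβ1 hρ hI hc hd.le)

theorem aggregator_mul_right_le (hβ : 0 < β) (hβ1 : β < 1) (hρ : 0 < ρ) {c z l : ℝ}
    (hc : 0 ≤ c) (hz : 0 ≤ z) (hl : 1 ≤ l) :
    aggregator β ρ c (l * z) ≤ l * aggregator β ρ c z := by
  rw [← aggregator_mul hβ hβ1 (by linarith) hc hz]
  exact aggregator_mono hβ hβ1 hρ hc (by positivity) (by nlinarith) le_rfl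

theorem consValue_mul_le (hβ : 0 < β) (hβ1 : β < 1) (hρ : 0 < ρ) (hI : I ⊆ Set.Ioo 0 1)
    (hne : I.Nonempty) {d l : ℝ} (hd : 0 ≤ d) (hl : 1 ≤ l) :
    consValue β ρ I (l * d) ≤ l * consValue β ρ I d := by
  refine consValue_le hne fun c hc => ?_
  have hc1 : 0 ≤ 1 - c := by linarith [(hI hc).2]
  rw [mul_left_comm]
  exact (aggregator_mul_right_le hβ hβ1 hρ (hI hc).1.le (mul_nonneg hc1 hd) hl).trans
    (mul_le_mul_of_nonneg_left (le_consValue hβ hβ1 hρ hI hc hd) (by linarith))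

/-- A positive continuation value makes the supremum over the consumption propensities attained:
the endpoints `0` and `1` are not optimal even in the closure of `I`. -/
theorem exists_isMaxOn_consumption (hβ : 0 < β) (hβ1 : β < 1) (hρ : 0 < ρ) (hne : I.Nonempty)
    {C : Set ℝ} (hC : IsClosed C) (hIC : I = Set.Ioo 0 1 ∩ C) {d : ℝ} (hd : 0 < d) :
    ∃ c ∈ I, IsMaxOn (fun c => aggregator β ρ c ((1 - c) * d)) I c := by
  have hsub : closure I ⊆ Set.Icc 0 1 := closure_minimal
    (fun c hc => by rw [hIC] at hc; exact Set.Ioo_subset_Icc_self hc.1) isClosed_Icc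
  have hsubC : closure I ⊆ C := closure_minimal (fun c hc => by rw [hIC] at hc; exact hc.2) hC
  have hcomp : IsCompact (closure I) := isCompact_Icc.of_isClosed_subset isClosed_closure hsub
  have hcont : ContinuousOn (fun c => aggregator β ρ c ((1 - c) * d)) (closure I) := by
    have hmap : ContinuousOn (fun c : ℝ => (c, (1 - c) * d)) (closure I) := by fun_prop
    refine (continuousOn_aggregator (ρ := ρ) hβ hβ1).comp hmap ?_
    intro c hc
    obtain ⟨h0, h1⟩ := hsub hc
    have h2 : 0 ≤ (1 - c) * d := mul_nonneg (by linarith) hd.le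
    refine ⟨h0, h2, ?_⟩
    simp only
    rcases h0.eq_or_lt with rfl | h0
    · simpa using hd
    · linarith
  obtain ⟨c, hc, hmax⟩ := hcomp.exists_isMaxOn hne.closure hcont
  have hmem : c ∈ I := by
    obtain ⟨h0, h1⟩ := hsub hc
    have hfreq := mem_closure_iff_frequently.1 hc
    rw [hIC]
    refine ⟨⟨lt_of_le_of_ne h0 ?_, lt_of_le_of_ne h1 ?_⟩, hsubC hc⟩
    · rintro rfl
      have h2 := eventually_nhdsWithin_iff.1 (eventually_aggregator_zero_lt hβ hβ1 hρ hd)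
      obtain ⟨c', h3, h4⟩ := (hfreq.and_eventually h2).exists
      have h5 := h4 (by rw [hIC] at h3; exact h3.1.1)
      have h6 := hmax (subset_closure h3)
      simp only [Set.mem_ofPred_eq, sub_zero, one_mul] at h6
      exact absurd h5 (not_lt.2 h6)
    · rintro rfl
      have h2 := eventually_nhdsWithin_iff.1 (eventually_aggregator_one_lt hβ hβ1 hρ hd)
      have h2' : Tendsto (fun c : ℝ => 1 - c) (𝓝 1) (𝓝 0) := by
        have := (continuous_const.sub continuous_id).tendsto (1 : ℝ) (f := fun c : ℝ => 1 - c)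
        simpa using this
      obtain ⟨c', h3, h4⟩ := (hfreq.and_eventually (h2'.eventually h2)).exists
      have h5 := h4 (by rw [hIC] at h3; exact sub_pos.2 h3.1.2)
      have h6 := hmax (subset_closure h3)
      simp only [Set.mem_ofPred_eq, sub_self, zero_mul] at h6
      rw [sub_sub_cancel] at h5
      exact absurd h5 (not_lt.2 h6)
  exact ⟨c, hmem, hmax.on_subset subset_closure⟩

theorem consValue_eq_of_isMaxOn {c d : ℝ} (hc : c ∈ I)
    (h : IsMaxOn (fun c => aggregator β ρ c ((1 - c) * d)) I c) :
    consValue β ρ I d = aggregator β ρ c ((1 - c) * d) := by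
  refine IsGreatest.csSup_eq ⟨⟨c, hc, rfl⟩, ?_⟩
  rintro _ ⟨c', hc', rfl⟩
  exact h hc'

/-- `consValue` is continuous at positive values, by its monotonicity and subhomogeneity. -/
theorem tendsto_consValue (hβ : 0 < β) (hβ1 : β < 1) (hρ : 0 < ρ) (hI : I ⊆ Set.Ioo 0 1)
    (hne : I.Nonempty) {d : ℝ} (hd : 0 < d) {ds : ℕ → ℝ} (h : Tendsto ds atTop (𝓝 d)) :
    Tendsto (fun m => consValue β ρ I (ds m)) atTop (𝓝 (consValue β ρ I d)) := by
  have hv := consValue_pos hβ hβ1 hρ hI hne hd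
  have h1 : Tendsto (fun m => max 1 (ds m / d) * consValue β ρ I d) atTop
      (𝓝 (max 1 (d / d) * consValue β ρ I d)) :=
    ((tendsto_const_nhds).max (h.div_const d)).mul_const _
  have h2 : Tendsto (fun m => consValue β ρ I d / max 1 (d / ds m)) atTop
      (𝓝 (consValue β ρ I d / max 1 (d / d))) :=
    tendsto_const_nhds.div ((tendsto_const_nhds).max (tendsto_const_nhds.div h hd.ne'))
      (by positivity)
  rw [div_self hd.ne', max_self, one_mul] at h1
  rw [div_self hd.ne', max_self, div_one] at h2
  refine tendsto_of_tendsto_of_tendsto_of_le_of_le' h2 h1 ?_ ?_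
  · filter_upwards [h.eventually (lt_mem_nhds hd)] with m hm
    rw [div_le_iff₀ (by positivity), mul_comm]
    refine le_trans ?_ (consValue_mul_le hβ hβ1 hρ hI hne hm.le (le_max_left _ _))
    refine consValue_mono hβ hβ1 hρ hI hne hd.le ?_
    calc d = d / ds m * ds m := (div_mul_cancel₀ _ hm.ne').symm
      _ ≤ _ := mul_le_mul_of_nonneg_right (le_max_right _ _) hm.le
  · filter_upwards [h.eventually (lt_mem_nhds hd)] with m hm
    refine le_trans ?_ (consValue_mul_le hβ hβ1 hρ hI hne hd.le (le_max_left 1 (ds m / d)))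
    refine consValue_mono hβ hβ1 hρ hI hne hm.le ?_
    calc ds m = ds m / d * d := (div_mul_cancel₀ _ hd.ne').symm
      _ ≤ _ := mul_le_mul_of_nonneg_right (le_max_right _ _) hd.le

end Consumption

/-! ### Perron-Frobenius values of irreducible matrices -/

section Perron

variable {𝕏 : Type*} [Fintype 𝕏]

open Matrix in
/-- Some polynomial in a nonnegative irreducible matrix has positive entries only. -/
theorem exists_sum_pow_pos [DecidableEq 𝕏] {Q : Matrix 𝕏 𝕏 ℝ} (hQ : Q.IsIrreducible) :
    ∃ K : ℕ, ∀ x y, 0 < (∑ k ∈ Finset.range K, Q ^ k) x y := by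
  have h := (Matrix.isIrreducible_iff_exists_pow_pos hQ.nonneg).1 hQ
  choose k _ hk using h
  refine ⟨(∑ p : 𝕏 × 𝕏, k p.1 p.2) + 1, fun x y => ?_⟩
  rw [Matrix.sum_apply]
  refine Finset.sum_pos' (fun i _ => Matrix.pow_apply_nonneg hQ.nonneg i x y) ⟨k x y, ?_, hk x y⟩
  rw [Finset.mem_range, Nat.lt_succ_iff]
  exact Finset.single_le_sum (f := fun p : 𝕏 × 𝕏 => k p.1 p.2) (fun _ _ => Nat.zero_le _)
    (Finset.mem_univ (x, y))

theorem mulVec_pos_of_pos {S : Matrix 𝕏 𝕏 ℝ} (hS : ∀ x y, 0 < S x y) {v : 𝕏 → ℝ}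
    (hv : ∀ x, 0 ≤ v x) {x₀ : 𝕏} (hx₀ : 0 < v x₀) (x : 𝕏) : 0 < S.mulVec v x :=
  Finset.sum_pos' (fun y _ => mul_nonneg (hS x y).le (hv y))
    ⟨x₀, Finset.mem_univ _, mul_pos (hS x x₀) hx₀⟩

theorem sum_pow_mulVec [DecidableEq 𝕏] {Q : Matrix 𝕏 𝕏 ℝ} {η : ℝ} {v : 𝕏 → ℝ}
    (h : Q.mulVec v = η • v) (K : ℕ) :
    (∑ k ∈ Finset.range K, Q ^ k).mulVec v = (∑ k ∈ Finset.range K, η ^ k) • v := by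
  have hp : ∀ k : ℕ, (Q ^ k).mulVec v = η ^ k • v := by
    intro k
    induction k with
    | zero => simp
    | succ k ih => rw [pow_succ, ← Matrix.mulVec_mulVec, h, Matrix.mulVec_smul, ih, smul_smul,
        ← pow_succ']
  rw [Matrix.sum_mulVec, Finset.sum_smul]
  exact Finset.sum_congr rfl fun k _ => hp k

/-- The Perron-Frobenius theorem, by maximising `η` subject to `η v ≤ Q v` over the simplex. -/
theorem exists_pos_eigenvector [Nonempty 𝕏] {Q : Matrix 𝕏 𝕏 ℝ} (hQ : Q.IsIrreducible) :
    ∃ η : ℝ, 0 < η ∧ ∃ v : 𝕏 → ℝ, (∀ x, 0 < v x) ∧ Q.mulVec v = η • v := by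
  classical
  obtain ⟨K, hS⟩ := exists_sum_pow_pos hQ
  set S := ∑ k ∈ Finset.range K, Q ^ k with hS_def
  have hcomm : S * Q = Q * S := by
    rw [hS_def, Finset.sum_mul, Finset.mul_sum]
    exact Finset.sum_congr rfl fun k _ => by rw [← pow_succ, ← pow_succ']
  set C : ℝ := ∑ x, ∑ y, Q x y
  have hC : 0 ≤ C := Finset.sum_nonneg fun x _ => Finset.sum_nonneg fun y _ => hQ.nonneg x y
  have hbound : ∀ η : ℝ, ∀ v ∈ stdSimplex ℝ 𝕏, (∀ x, η * v x ≤ Q.mulVec v x) → η ≤ C := by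
    rintro η v ⟨hv0, hv1⟩ h
    calc η = ∑ x, η * v x := by rw [← Finset.mul_sum, hv1, mul_one]
      _ ≤ ∑ x, Q.mulVec v x := Finset.sum_le_sum fun x _ => h x
      _ ≤ C := Finset.sum_le_sum fun x _ => Finset.sum_le_sum fun y _ => by
          refine mul_le_of_le_one_right (hQ.nonneg x y) ?_
          rw [← hv1]
          exact Finset.single_le_sum (fun i _ => hv0 i) (Finset.mem_univ y)
  set T : Set ((𝕏 → ℝ) × ℝ) := (stdSimplex ℝ 𝕏 ×ˢ Set.Icc 0 C) ∩
    {p | ∀ x, p.2 * p.1 x ≤ Q.mulVec p.1 x}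
  have hTc : IsCompact T := by
    refine ((isCompact_stdSimplex ℝ 𝕏).prod isCompact_Icc).inter_right ?_
    rw [Set.ofPred_forall]
    refine isClosed_iInter fun x => isClosed_le (by fun_prop) ?_
    simp only [Matrix.mulVec, dotProduct]
    fun_prop
  obtain ⟨x₁⟩ := ‹Nonempty 𝕏›
  have hTne : T.Nonempty := by
    refine ⟨(Pi.single x₁ 1, 0), ⟨single_mem_stdSimplex ℝ x₁, le_rfl, hC⟩, fun x => ?_⟩
    rw [zero_mul]
    refine Finset.sum_nonneg fun y _ => mul_nonneg (hQ.nonneg x y) ?_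
    exact (single_mem_stdSimplex ℝ x₁).1 y
  obtain ⟨⟨v, η⟩, ⟨⟨hv, hη0, hηC⟩, hle⟩, hmax⟩ :=
    hTc.exists_isMaxOn hTne continuous_snd.continuousOn
  simp only at hv hη0 hηC
  have hle : ∀ x, η * v x ≤ Q.mulVec v x := hle
  obtain ⟨x₀, hx₀⟩ : ∃ x, 0 < v x := by
    by_contra! h
    have := hv.2
    rw [Finset.sum_eq_zero fun x _ => le_antisymm (h x) (hv.1 x)] at this
    exact zero_ne_one this
  have hw := mulVec_pos_of_pos hS hv.1 hx₀
  have heig : Q.mulVec v = η • v := by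
    by_contra hne
    obtain ⟨x₂, hx₂⟩ := Function.ne_iff.1 hne
    have hr := mulVec_pos_of_pos hS (v := Q.mulVec v - η • v)
      (fun x => by simpa using hle x) (x₀ := x₂)
      (by simpa using lt_of_le_of_ne (hle x₂) (fun h => hx₂ (by simpa using h.symm)))
    -- applying `S` makes the inequality `η v ≤ Q v` strict everywhere, so `η` is not maximal
    set w := S.mulVec v
    have hQw : ∀ x, η * w x < Q.mulVec w x := by
      intro x
      have := hr x
      rw [Matrix.mulVec_sub, Matrix.mulVec_mulVec, hcomm, ← Matrix.mulVec_mulVec,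
        Matrix.mulVec_smul] at this
      exact sub_pos.1 this
    obtain ⟨x₃, hx₃⟩ := Finite.exists_min fun x => Q.mulVec w x / w x
    set η' := Q.mulVec w x₃ / w x₃
    have h1 : η < η' := (lt_div_iff₀ (hw x₃)).2 (hQw x₃)
    have hsum : 0 < ∑ x, w x := Finset.sum_pos (fun x _ => hw x) ⟨x₁, Finset.mem_univ _⟩
    set w' := (∑ x, w x)⁻¹ • w with hw'
    have hw'mem : w' ∈ stdSimplex ℝ 𝕏 := by
      refine ⟨fun x => mul_nonneg (inv_nonneg.2 hsum.le) (hw x).le, ?_⟩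
      simp only [hw', Pi.smul_apply, smul_eq_mul, ← Finset.mul_sum]
      exact inv_mul_cancel₀ hsum.ne'
    have h2 : ∀ x, η' * w' x ≤ Q.mulVec w' x := by
      intro x
      have := (le_div_iff₀ (hw x)).1 (hx₃ x)
      rw [hw', Matrix.mulVec_smul, Pi.smul_apply, Pi.smul_apply, smul_eq_mul, smul_eq_mul,
        mul_left_comm]
      exact mul_le_mul_of_nonneg_left this (inv_nonneg.2 hsum.le)
    have h3 : (w', η') ∈ T := ⟨⟨hw'mem, hη0.trans h1.le, hbound η' w' hw'mem h2⟩, h2⟩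
    exact absurd h1 (not_lt.2 (hmax h3))
  have hSv := sum_pow_mulVec heig K
  have hvpos : ∀ x, 0 < v x := by
    intro x
    have h1 := hw x
    rw [hSv, Pi.smul_apply, smul_eq_mul] at h1
    refine lt_of_le_of_ne (hv.1 x) fun h => ?_
    rw [← h, mul_zero] at h1
    exact lt_irrefl _ h1
  refine ⟨η, lt_of_le_of_ne hη0 fun h => ?_, v, hvpos, heig⟩
  rw [← h, zero_smul] at heig
  obtain ⟨k, hk, hpos⟩ := (Matrix.isIrreducible_iff_exists_pow_pos hQ.nonneg).1 hQ x₀ x₀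
  have h1 : (Q ^ k).mulVec v x₀ = 0 := by
    obtain ⟨j, rfl⟩ := Nat.exists_eq_succ_of_ne_zero hk.ne'
    rw [Nat.succ_eq_add_one, pow_succ, ← Matrix.mulVec_mulVec, heig, Matrix.mulVec_zero]
    rfl
  have h2 : 0 < (Q ^ k).mulVec v x₀ := Finset.sum_pos'
    (fun y _ => mul_nonneg (Matrix.pow_apply_nonneg hQ.nonneg k x₀ y) (hvpos y).le)
    ⟨x₀, Finset.mem_univ _, mul_pos hpos (hvpos x₀)⟩
  linarith

/-- Harmonic functions of an irreducible stochastic matrix are constant. -/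
theorem eq_of_mulVec_eq_self [Nonempty 𝕏] {Q : Matrix 𝕏 𝕏 ℝ} (hQ : Q.IsIrreducible)
    (hone : Q.mulVec 1 = 1) {v : 𝕏 → ℝ} (hv : Q.mulVec v = v) (x y : 𝕏) : v x = v y := by
  classical
  obtain ⟨K, hS⟩ := exists_sum_pow_pos hQ
  obtain ⟨x₀, hx₀⟩ := Finite.exists_max v
  have h1 := sum_pow_mulVec (η := 1) (v := v x₀ • 1 - v)
    (by rw [Matrix.mulVec_sub, Matrix.mulVec_smul, hone, hv, one_smul]) K
  have hx : ∀ x, v x = v x₀ := by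
    intro x
    by_contra hne
    have h2 := mulVec_pos_of_pos hS (v := v x₀ • 1 - v) (fun x => by simpa using hx₀ x) (x₀ := x)
      (by simpa using lt_of_le_of_ne (hx₀ x) hne) x₀
    rw [h1] at h2
    simp at h2
  rw [hx x, hx y]

/-- The Poisson equation of an irreducible stochastic matrix is solvable. -/
theorem exists_poisson [Nonempty 𝕏] {Q : Matrix 𝕏 𝕏 ℝ} (hQ : Q.IsIrreducible)
    (hone : Q.mulVec 1 = 1) (b : 𝕏 → ℝ) :
    ∃ (v : 𝕏 → ℝ) (η : ℝ), ∀ x, b x = -(Q.mulVec v x) + v x + η := by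
  obtain ⟨x₀⟩ := ‹Nonempty 𝕏›
  have hrow : ∀ x, ∑ y, Q x y = 1 := fun x => by
    have := congrFun hone x
    simpa [Matrix.mulVec, dotProduct] using this
  -- normalising `η = v x₀` turns the equation into a square linear system
  let T : (𝕏 → ℝ) →ₗ[ℝ] (𝕏 → ℝ) :=
    { toFun := fun v x => -(Q.mulVec v x) + v x + v x₀
      map_add' := fun v w => by
        funext x; simp only [Matrix.mulVec_add, Pi.add_apply]; ring
      map_smul' := fun a v => by
        funext x
        simp only [Matrix.mulVec_smul, Pi.smul_apply, smul_eq_mul, RingHom.id_apply]; ring }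
  have hT : ∀ v x, T v x = -(Q.mulVec v x) + v x + v x₀ := fun _ _ => rfl
  have hinj : Function.Injective T := by
    rw [← LinearMap.ker_eq_bot, LinearMap.ker_eq_bot']
    intro v hv
    have hv' : ∀ x, -(Q.mulVec v x) + v x + v x₀ = 0 := fun x => by rw [← hT, hv]; rfl
    have : Nonempty 𝕏 := ⟨x₀⟩
    obtain ⟨x₁, hx₁⟩ := Finite.exists_max v
    obtain ⟨x₂, hx₂⟩ := Finite.exists_min v
    have h1 : Q.mulVec v x₁ ≤ v x₁ := by
      calc Q.mulVec v x₁ ≤ ∑ y, Q x₁ y * v x₁ :=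
            Finset.sum_le_sum fun y _ => mul_le_mul_of_nonneg_left (hx₁ y) (hQ.nonneg _ _)
        _ = v x₁ := by rw [← Finset.sum_mul, hrow, one_mul]
    have h2 : v x₂ ≤ Q.mulVec v x₂ := by
      calc v x₂ = ∑ y, Q x₂ y * v x₂ := by rw [← Finset.sum_mul, hrow, one_mul]
        _ ≤ Q.mulVec v x₂ :=
            Finset.sum_le_sum fun y _ => mul_le_mul_of_nonneg_left (hx₂ y) (hQ.nonneg _ _)
    have h3 : v x₀ = 0 := by linarith [hv' x₁, hv' x₂]
    have h4 : Q.mulVec v = v := by funext x; linarith [hv' x]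
    funext x
    rw [eq_of_mulVec_eq_self hQ hone h4 x x₀, h3]
    rfl
  obtain ⟨v, hv⟩ := LinearMap.injective_iff_surjective.1 hinj b
  exact ⟨v, v x₀, fun x => by rw [← hT, hv]⟩

end Perron

section PerronKernel

variable {𝕏 𝕐 : Type*} [Fintype 𝕏] [MeasurableSpace 𝕏] [MeasurableSingletonClass 𝕏]
  [MeasurableSpace 𝕐]

theorem integral_mul_comp_fst {m : Measure (𝕏 × 𝕐)} {f : 𝕏 × 𝕐 → ℝ} (hf : Integrable f m)
    (v : 𝕏 → ℝ) : ∫ p, f p * v p.1 ∂m = ∑ y, (∫ p in {p | p.1 = y}, f p ∂m) * v y := by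
  classical
  have hs : ∀ y : 𝕏, MeasurableSet {p : 𝕏 × 𝕐 | p.1 = y} := fun y =>
    measurable_fst (measurableSet_singleton y)
  have h1 : ∀ p : 𝕏 × 𝕐, f p * v p.1 = ∑ y, {p : 𝕏 × 𝕐 | p.1 = y}.indicator f p * v y := by
    intro p
    rw [Finset.sum_eq_single p.1]
    · simp
    · intro y _ hy
      rw [Set.indicator_of_notMem (fun h => hy h.symm), zero_mul]
    · simp
  simp only [h1]
  rw [integral_finsetSum _ fun y _ => (hf.indicator (hs y)).mul_const _]
  refine Finset.sum_congr rfl fun y _ => ?_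
  rw [integral_mul_const, integral_indicator (hs y)]

theorem integrable_comp_fst {m : Measure (𝕏 × 𝕐)} [IsFiniteMeasure m] (v : 𝕏 → ℝ) :
    Integrable (fun p : 𝕏 × 𝕐 => v p.1) m := by
  obtain ⟨C, hC⟩ := Set.finite_range (fun x => ‖v x‖) |>.bddAbove
  exact Integrable.of_bound ((measurable_of_finite v).comp measurable_fst).aestronglyMeasurable C
    (Eventually.of_forall fun p => hC ⟨p.1, rfl⟩)

/-- Perron-Frobenius values exist in irreducible environments. -/
theorem exists_isPerronValue [Nonempty 𝕏] {P : Kernel 𝕏 (𝕏 × 𝕐)} [IsMarkovKernel P]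
    (hirr : (transitionMatrix P).IsIrreducible) {γ : ℝ} {κ : 𝕏 → 𝕏 → 𝕐 → ℝ}
    (hint : ∀ x, Integrable (fun p : 𝕏 × 𝕐 => util γ (Real.exp (κ x p.1 p.2))) (P x)) :
    ∃ η, IsPerronValue P γ κ η := by
  have hs : ∀ y : 𝕏, MeasurableSet {p : 𝕏 × 𝕐 | p.1 = y} := fun y =>
    measurable_fst (measurableSet_singleton y)
  by_cases hγ : γ = 1
  · have hP : ∀ (v : 𝕏 → ℝ) x, ∫ p, v p.1 ∂(P x) = (transitionMatrix P).mulVec v x := by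
      intro v x
      have := integral_mul_comp_fst (m := P x) (f := fun _ => 1) (integrable_const _) v
      simpa [transitionMatrix, Matrix.mulVec, dotProduct] using this
    obtain ⟨v, η, h⟩ := exists_poisson hirr (by funext x; rw [← hP]; simp)
      fun x => ∫ p, κ x p.1 p.2 ∂(P x)
    refine ⟨η, ?_⟩
    rw [IsPerronValue, if_pos hγ]
    exact ⟨v, fun x => by rw [h x, hP]⟩
  · set U : Matrix 𝕏 𝕏 ℝ := Matrix.of fun x y =>
      ∫ p in {p : 𝕏 × 𝕐 | p.1 = y}, util γ (Real.exp (κ x p.1 p.2)) ∂(P x)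
    have hupos : ∀ a, 0 < util γ (Real.exp a) := fun a => by
      rw [util, if_neg hγ]; exact Real.rpow_pos_of_pos (Real.exp_pos _) _
    have hU : ∀ x y, 0 < U x y ↔ 0 < transitionMatrix P x y := by
      intro x y
      have hsupp : (Function.support fun p : 𝕏 × 𝕐 => util γ (Real.exp (κ x p.1 p.2))) =
          Set.univ := by
        ext p; simpa using (hupos _).ne'
      simp only [U, transitionMatrix, Matrix.of_apply]
      rw [setIntegral_pos_iff_support_of_nonneg_ae
        (Eventually.of_forall fun p => (hupos _).le) (hint x).integrableOn, hsupp, Set.univ_inter,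
        measureReal_def, ENNReal.toReal_pos_iff]
      exact (and_iff_left (measure_lt_top _ _)).symm
    have hUirr : U.IsIrreducible := by
      refine ⟨fun x y => integral_nonneg fun p => (hupos _).le, ?_⟩
      have hq : Matrix.toQuiver U = Matrix.toQuiver (transitionMatrix P) := by
        unfold Matrix.toQuiver
        simp only [hU]
      rw [hq]
      exact hirr.connected
    obtain ⟨η, hη, v, hv, h⟩ := exists_pos_eigenvector hUirr
    refine ⟨η, ?_⟩
    rw [IsPerronValue, if_neg hγ]
    refine ⟨hη, v, hv, fun x => ?_⟩
    have := congrFun h x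
    rw [Pi.smul_apply, smul_eq_mul] at this
    rw [← this, opU, integral_mul_comp_fst (hint x) v]
    rfl

end PerronKernel

/-! ### The dynamic programming operator for a general gain function -/

namespace Model

variable {𝕏 𝕐 : Type*} [MeasurableSpace 𝕏] [MeasurableSpace 𝕐] {n : ℕ}

attribute [instance] Model.isMarkov

/-- The certainty equivalent in state `x` of the continuation values `Φ` per unit of wealth, if
the portfolio `ϑ` is held. -/
def contValue (M : Model 𝕏 𝕐 n) (ϑ : Fin n → ℝ) (Φ : 𝕏 → ℝ) (x : 𝕏) : ℝ :=
  certEquiv M.γ (M.P x) fun p => M.portReturn ϑ x p.1 p.2 * Φ p.1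

/-- The portfolio `ϑ` has almost surely positive returns with integrable utility in state `x`. -/
structure IsRegular (M : Model 𝕏 𝕐 n) (x : 𝕏) (ϑ : Fin n → ℝ) : Prop where
  pos : ∀ᵐ p ∂(M.P x), 0 < M.portReturn ϑ x p.1 p.2
  integrable_util : Integrable (fun p : 𝕏 × 𝕐 => util M.γ (M.portReturn ϑ x p.1 p.2)) (M.P x)

/-- The maximal value of a portfolio in `J x`, if the gain-loss utility is replaced by an
arbitrary function `G x` of the portfolio. -/
def bestValue (M : Model 𝕏 𝕐 n) (J : 𝕏 → Set (Fin n → ℝ)) (G : 𝕏 → (Fin n → ℝ) → ℝ)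
    (Φ : 𝕏 → ℝ) (x : 𝕏) : ℝ :=
  sSup ((fun ϑ => G x ϑ + M.contValue ϑ Φ x) '' J x)

/-- The dynamic programming operator, if the gain-loss utility is replaced by an arbitrary
function `G x` of the portfolio. For `G = M.gainLoss` the functions `bestValue` and `opW` are `maxD`
and `W` by definition; constant `G` serve to construct supersolutions. -/
def opW (M : Model 𝕏 𝕐 n) (I : 𝕏 → Set ℝ) (J : 𝕏 → Set (Fin n → ℝ)) (G : 𝕏 → (Fin n → ℝ) → ℝ)
    (Φ : 𝕏 → ℝ) (x : 𝕏) : ℝ :=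
  consValue M.β M.ρ (I x) (M.bestValue J G Φ x)

/-- The properties of the constraint sets on which the analysis of the dynamic programming
operator rests. -/
structure IsRegularChoice (M : Model 𝕏 𝕐 n) (I : 𝕏 → Set ℝ) (J : 𝕏 → Set (Fin n → ℝ)) : Prop where
  nonempty_I : ∀ x, (I x).Nonempty
  closed_I : ∀ x, ∃ C : Set ℝ, IsClosed C ∧ I x = Set.Ioo 0 1 ∩ C
  nonempty_J : ∀ x, (J x).Nonempty
  compact_J : ∀ x, IsCompact (J x)
  regular : ∀ x, ∀ ϑ ∈ J x, M.IsRegular x ϑ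

variable {M : Model 𝕏 𝕐 n} {x : 𝕏} {ϑ : Fin n → ℝ} {I : 𝕏 → Set ℝ} {J : 𝕏 → Set (Fin n → ℝ)}
  {G : 𝕏 → (Fin n → ℝ) → ℝ} {Φ Φ' : 𝕏 → ℝ}

theorem integrable_portReturn (M : Model 𝕏 𝕐 n) (ϑ : Fin n → ℝ) (x : 𝕏) :
    Integrable (fun p : 𝕏 × 𝕐 => M.portReturn ϑ x p.1 p.2) (M.P x) :=
  (integrable_const _).add (integrable_finsetSum _ fun i _ =>
    ((M.integrable_r i x).sub (integrable_const _)).const_mul _)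

theorem contValue_nonneg (M : Model 𝕏 𝕐 n) (ϑ : Fin n → ℝ) (Φ : 𝕏 → ℝ) (x : 𝕏) :
    0 ≤ M.contValue ϑ Φ x := certEquiv_nonneg _ _ _

theorem IsRegularChoice.subset_I (h : M.IsRegularChoice I J) (x : 𝕏) : I x ⊆ Set.Ioo 0 1 := by
  obtain ⟨C, -, hC⟩ := h.closed_I x
  rw [hC]; exact Set.inter_subset_left

theorem IsRegularChoice.bestValue_le (h : M.IsRegularChoice I J) {K : ℝ}
    (hK : ∀ ϑ ∈ J x, G x ϑ + M.contValue ϑ Φ x ≤ K) : M.bestValue J G Φ x ≤ K :=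
  csSup_le ((h.nonempty_J x).image _) (by rintro _ ⟨ϑ, hϑ, rfl⟩; exact hK ϑ hϑ)

theorem bestValue_eq_of_isMaxOn (hϑ : ϑ ∈ J x)
    (hmax : IsMaxOn (fun ϑ => G x ϑ + M.contValue ϑ Φ x) (J x) ϑ) :
    M.bestValue J G Φ x = G x ϑ + M.contValue ϑ Φ x := by
  refine IsGreatest.csSup_eq ⟨⟨ϑ, hϑ, rfl⟩, ?_⟩
  rintro _ ⟨ϑ', hϑ', rfl⟩
  exact hmax hϑ'

theorem IsRegularChoice.opW_nonneg (h : M.IsRegularChoice I J)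
    (h0 : 0 ≤ M.bestValue J G Φ x) : 0 ≤ M.opW I J G Φ x :=
  consValue_nonneg M.β_pos M.β_lt_one M.ρ_pos (h.subset_I x) (h.nonempty_I x) h0

theorem IsRegularChoice.opW_pos (h : M.IsRegularChoice I J)
    (h0 : 0 < M.bestValue J G Φ x) : 0 < M.opW I J G Φ x :=
  consValue_pos M.β_pos M.β_lt_one M.ρ_pos (h.subset_I x) (h.nonempty_I x) h0

variable [Fintype 𝕏] [MeasurableSingletonClass 𝕏]

theorem integrable_mul_comp_fst {m : Measure (𝕏 × 𝕐)} {f : 𝕏 × 𝕐 → ℝ} (hf : Integrable f m)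
    (v : 𝕏 → ℝ) : Integrable (fun p => f p * v p.1) m := by
  obtain ⟨C, hC⟩ := Set.finite_range (fun x => ‖v x‖) |>.bddAbove
  exact hf.mul_bdd (c := C) ((measurable_of_finite v).comp measurable_fst).aestronglyMeasurable
    (Eventually.of_forall fun p => hC ⟨p.1, rfl⟩)

theorem integrable_util_mul_comp_fst {m : Measure (𝕏 × 𝕐)} [IsFiniteMeasure m] {γ : ℝ}
    {Z : 𝕏 × 𝕐 → ℝ} (hZ : ∀ᵐ p ∂m, 0 < Z p) (hi : Integrable (fun p => util γ (Z p)) m)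
    {w : 𝕏 → ℝ} (hw : ∀ x, 0 < w x) : Integrable (fun p => util γ (Z p * w p.1)) m := by
  by_cases h : γ = 1
  · refine (hi.add (integrable_comp_fst fun x => Real.log (w x))).congr ?_
    filter_upwards [hZ] with p hp
    simp only [util, if_pos h, Pi.add_apply]
    rw [Real.log_mul hp.ne' (hw _).ne']
  · refine (integrable_mul_comp_fst hi fun x => w x ^ (1 - γ)).congr ?_
    filter_upwards [hZ] with p hp
    simp only [util, if_neg h]
    rw [Real.mul_rpow hp.le (hw _).le]

theorem integrable_portReturn_mul (M : Model 𝕏 𝕐 n) (ϑ : Fin n → ℝ) (Φ : 𝕏 → ℝ) (x : 𝕏) :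
    Integrable (fun p : 𝕏 × 𝕐 => M.portReturn ϑ x p.1 p.2 * Φ p.1) (M.P x) :=
  integrable_mul_comp_fst (M.integrable_portReturn ϑ x) Φ

theorem IsRegular.contValue_mono (h : M.IsRegular x ϑ) {Φ Φ' : 𝕏 → ℝ} (hΦ : ∀ x, Φ x ≤ Φ' x) :
    M.contValue ϑ Φ x ≤ M.contValue ϑ Φ' x :=
  certEquiv_mono M.γ_pos (M.integrable_portReturn_mul _ _ _) (M.integrable_portReturn_mul _ _ _)
    (h.pos.mono fun p hp => mul_le_mul_of_nonneg_left (hΦ p.1) hp.le)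

theorem contValue_const_mul (M : Model 𝕏 𝕐 n) (ϑ : Fin n → ℝ) (Φ : 𝕏 → ℝ) (x : 𝕏) {t : ℝ}
    (ht : 0 < t) : M.contValue ϑ (fun y => t * Φ y) x = t * M.contValue ϑ Φ x := by
  unfold contValue
  rw [← certEquiv_const_mul ht (M.integrable_portReturn_mul _ _ _)]
  congr 1
  funext p
  ring

theorem IsRegular.contValue_add_le (h : M.IsRegular x ϑ) {Φ Φ' : 𝕏 → ℝ} (hΦ : ∀ x, 0 ≤ Φ x)
    (hΦ' : ∀ x, 0 ≤ Φ' x) :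
    M.contValue ϑ Φ x + M.contValue ϑ Φ' x ≤ M.contValue ϑ (fun y => Φ y + Φ' y) x := by
  unfold contValue
  simp only [mul_add]
  exact certEquiv_add_le M.γ_pos (M.integrable_portReturn_mul _ _ _)
    (M.integrable_portReturn_mul _ _ _) (h.pos.mono fun _ hp => mul_nonneg hp.le (hΦ _))
    (h.pos.mono fun _ hp => mul_nonneg hp.le (hΦ' _))

theorem IsRegular.contValue_pos (h : M.IsRegular x ϑ) {Φ : 𝕏 → ℝ} (hΦ : ∀ x, 0 < Φ x) :
    0 < M.contValue ϑ Φ x :=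
  certEquiv_pos (h.pos.mono fun _ hp => mul_pos hp (hΦ _))
    (integrable_util_mul_comp_fst h.pos h.integrable_util hΦ)

/-- The expectation of the continuation value as an explicit polynomial in the portfolio and the
continuation values, which makes its continuity in both evident. -/
theorem integral_portReturn_mul (M : Model 𝕏 𝕐 n) (ϑ : Fin n → ℝ) (Φ : 𝕏 → ℝ) (x : 𝕏) :
    ∫ p, M.portReturn ϑ x p.1 p.2 * Φ p.1 ∂(M.P x) = ∑ y, ((∫ _ in {p | p.1 = y}, M.r₀ x ∂(M.P x)) +
      ∑ i, ϑ i * ∫ p in {p | p.1 = y}, (M.r i x p.1 p.2 - M.r₀ x) ∂(M.P x)) * Φ y := by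
  rw [integral_mul_comp_fst (M.integrable_portReturn ϑ x) Φ]
  refine Finset.sum_congr rfl fun y _ => ?_
  have hi : ∀ i, Integrable (fun p : 𝕏 × 𝕐 => ϑ i * (M.r i x p.1 p.2 - M.r₀ x))
      ((M.P x).restrict {p | p.1 = y}) := fun i =>
    (((M.integrable_r i x).sub (integrable_const _)).const_mul _).integrableOn
  unfold portReturn
  rw [integral_add (integrable_const _) (integrable_finsetSum _ fun i _ => hi i),
    integral_finsetSum _ fun i _ => hi i]
  simp only [integral_const_mul]

/-- Joint upper semicontinuity in the portfolio and the continuation values. -/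
theorem le_contValue_of_tendsto {ϑs : ℕ → Fin n → ℝ} {Φs : ℕ → 𝕏 → ℝ} {Φ : 𝕏 → ℝ} {bs : ℕ → ℝ}
    {b : ℝ} (hreg : ∀ m, M.IsRegular x (ϑs m)) (hϑ : Tendsto ϑs atTop (𝓝 ϑ))
    (hΦs : ∀ m x, 0 ≤ Φs m x) (hΦ : Tendsto Φs atTop (𝓝 Φ)) (hb : Tendsto bs atTop (𝓝 b))
    (h : ∀ m, bs m ≤ M.contValue (ϑs m) (Φs m) x) : b ≤ M.contValue ϑ Φ x := by
  have hϑ' := fun i => tendsto_pi_nhds.1 hϑ i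
  have hΦ' := fun y => tendsto_pi_nhds.1 hΦ y
  refine le_of_forall_lt_imp_le_of_dense fun b' hb' => ?_
  refine le_certEquiv_of_tendsto M.γ_pos (M.integrable_portReturn_mul _ _ _)
    (fun m => M.integrable_portReturn_mul (ϑs m) (Φs m) x)
    (fun m => (hreg m).pos.mono fun p hp => mul_nonneg hp.le (hΦs m _)) ?_ ?_ ?_
  · refine Eventually.of_forall fun p => Tendsto.mul ?_ (hΦ' _)
    exact tendsto_const_nhds.add (tendsto_finsetSum _ fun i _ => (hϑ' i).mul_const _)
  · simp only [integral_portReturn_mul]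
    exact tendsto_finsetSum _ fun y _ => (tendsto_const_nhds.add
      (tendsto_finsetSum _ fun i _ => (hϑ' i).mul_const _)).mul (hΦ' y)
  · filter_upwards [hb.eventually (lt_mem_nhds hb')] with m hm using hm.le.trans (h m)

/-- The certainty equivalent is upper semicontinuous in the portfolio, hence it attains its maximum
on the compact set `J x`, although it need not be continuous. -/
theorem IsRegularChoice.exists_isMaxOn (h : M.IsRegularChoice I J) (hG : Continuous (G x))
    (hΦ : ∀ x, 0 ≤ Φ x) :
    ∃ ϑ ∈ J x, IsMaxOn (fun ϑ => G x ϑ + M.contValue ϑ Φ x) (J x) ϑ := by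
  refine UpperSemicontinuousOn.exists_isMaxOn (h.nonempty_J x) (h.compact_J x) ?_
  intro ϑ hϑ y hy
  by_contra hcon
  have hfreq : ∃ᶠ ϑ' in 𝓝[J x] ϑ, y ≤ G x ϑ' + M.contValue ϑ' Φ x ∧ ϑ' ∈ J x := by
    refine Frequently.and_eventually ?_ self_mem_nhdsWithin
    simpa [Filter.not_eventually] using hcon
  obtain ⟨ϑs, hlim, hs⟩ := exists_seq_forall_of_frequently hfreq
  have hlim' : Tendsto ϑs atTop (𝓝 ϑ) := hlim.mono_right nhdsWithin_le_nhds
  have := le_contValue_of_tendsto (M := M) (x := x) (ϑ := ϑ) (Φs := fun _ => Φ)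
    (bs := fun m => y - G x (ϑs m)) (fun m => h.regular x _ (hs m).2) hlim' (fun _ => hΦ)
    tendsto_const_nhds (tendsto_const_nhds.sub ((hG.tendsto ϑ).comp hlim'))
    (fun m => by linarith [(hs m).1])
  have hy' : G x ϑ + M.contValue ϑ Φ x < y := hy
  linarith

theorem IsRegularChoice.le_bestValue (h : M.IsRegularChoice I J) (hG : Continuous (G x))
    (hΦ : ∀ x, 0 ≤ Φ x) (hϑ : ϑ ∈ J x) : G x ϑ + M.contValue ϑ Φ x ≤ M.bestValue J G Φ x := by
  obtain ⟨ϑ', -, hmax⟩ := h.exists_isMaxOn hG hΦ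
  have hbdd : BddAbove ((fun ϑ => G x ϑ + M.contValue ϑ Φ x) '' J x) :=
    ⟨G x ϑ' + M.contValue ϑ' Φ x, by rintro _ ⟨ϑ'', h'', rfl⟩; exact hmax h''⟩
  exact le_csSup hbdd ⟨ϑ, hϑ, rfl⟩

theorem IsRegularChoice.bestValue_mono (h : M.IsRegularChoice I J) (hG : Continuous (G x))
    (hΦ : ∀ x, 0 ≤ Φ x) (hle : ∀ x, Φ x ≤ Φ' x) :
    M.bestValue J G Φ x ≤ M.bestValue J G Φ' x :=
  h.bestValue_le fun ϑ hϑ => (by gcongr; exact (h.regular x ϑ hϑ).contValue_mono hle :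
    G x ϑ + M.contValue ϑ Φ x ≤ G x ϑ + M.contValue ϑ Φ' x).trans
      (h.le_bestValue hG (fun y => (hΦ y).trans (hle y)) hϑ)

theorem IsRegularChoice.opW_mono (h : M.IsRegularChoice I J) (hG : Continuous (G x))
    (hΦ : ∀ x, 0 ≤ Φ x) (hle : ∀ x, Φ x ≤ Φ' x) (h0 : 0 ≤ M.bestValue J G Φ x) :
    M.opW I J G Φ x ≤ M.opW I J G Φ' x :=
  consValue_mono M.β_pos M.β_lt_one M.ρ_pos (h.subset_I x) (h.nonempty_I x) h0
    (h.bestValue_mono hG hΦ hle)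

/-- Continuity of `bestValue` at positive functions `Φ`: a function close to `Φ` lies between
multiples of `Φ` with factors close to `1`, and the certainty equivalent is homogeneous. -/
theorem IsRegularChoice.tendsto_bestValue [Nonempty 𝕏] (h : M.IsRegularChoice I J)
    (hG : Continuous (G x)) (hΦ : ∀ x, 0 < Φ x) {Φs : ℕ → 𝕏 → ℝ} (hΦs : ∀ m x, 0 ≤ Φs m x)
    (hlim : Tendsto Φs atTop (𝓝 Φ)) :
    Tendsto (fun m => M.bestValue J G (Φs m) x) atTop (𝓝 (M.bestValue J G Φ x)) := by
  have hlim' : ∀ y, Tendsto (fun m => Φs m y / Φ y) atTop (𝓝 1) := fun y => by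
    have := (tendsto_pi_nhds.1 hlim y).div_const (Φ y)
    rwa [div_self (hΦ y).ne'] at this
  set lo : ℕ → ℝ := fun m => Finset.univ.inf' Finset.univ_nonempty fun y => Φs m y / Φ y
  set up : ℕ → ℝ := fun m => Finset.univ.sup' Finset.univ_nonempty fun y => Φs m y / Φ y
  have hlo : Tendsto lo atTop (𝓝 1) := by
    have := Tendsto.finset_inf'_nhds_apply (f := fun y m => Φs m y / Φ y) (g := fun _ => (1 : ℝ))
      (Finset.univ_nonempty (α := 𝕏)) fun y _ => hlim' y
    simpa using this
  have hup : Tendsto up atTop (𝓝 1) := by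
    have := Tendsto.finset_sup'_nhds_apply (f := fun y m => Φs m y / Φ y) (g := fun _ => (1 : ℝ))
      (Finset.univ_nonempty (α := 𝕏)) fun y _ => hlim' y
    simpa using this
  have hlo' : ∀ m y, lo m * Φ y ≤ Φs m y := fun m y =>
    (le_div_iff₀ (hΦ y)).1 (Finset.inf'_le (fun y => Φs m y / Φ y) (Finset.mem_univ y))
  have hup' : ∀ m y, Φs m y ≤ up m * Φ y := fun m y =>
    (div_le_iff₀ (hΦ y)).1 (Finset.le_sup' (fun y => Φs m y / Φ y) (Finset.mem_univ y))
  obtain ⟨ϑ₀, hϑ₀, hmax⟩ := h.exists_isMaxOn hG fun y => (hΦ y).le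
  obtain ⟨ϑ₁, -, hmax₁⟩ := h.exists_isMaxOn (x := x) (G := fun _ _ => 0) continuous_const
    fun y => (hΦ y).le
  have hbest := bestValue_eq_of_isMaxOn hϑ₀ hmax
  refine tendsto_of_tendsto_of_tendsto_of_le_of_le'
    (g := fun m => M.bestValue J G Φ x + (lo m - 1) * M.contValue ϑ₀ Φ x)
    (h := fun m => M.bestValue J G Φ x + |up m - 1| * M.contValue ϑ₁ Φ x) ?_ ?_ ?_ ?_
  · simpa using tendsto_const_nhds.add ((hlo.sub_const 1).mul_const (M.contValue ϑ₀ Φ x))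
  · simpa using tendsto_const_nhds.add ((hup.sub_const 1).abs.mul_const (M.contValue ϑ₁ Φ x))
  · filter_upwards [hlo.eventually (lt_mem_nhds one_pos)] with m hm
    have h1 := (h.regular x ϑ₀ hϑ₀).contValue_mono (hlo' m)
    rw [contValue_const_mul _ _ _ _ hm] at h1
    have h2 := h.le_bestValue hG (hΦs m) hϑ₀
    linarith
  · filter_upwards [hup.eventually (lt_mem_nhds one_pos)] with m hm
    refine h.bestValue_le fun ϑ hϑ => ?_
    have h1 := (h.regular x ϑ hϑ).contValue_mono (hup' m)
    rw [contValue_const_mul _ _ _ _ hm] at h1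
    have h2 := h.le_bestValue hG (fun y => (hΦ y).le) hϑ
    have h3 : 0 + M.contValue ϑ Φ x ≤ 0 + M.contValue ϑ₁ Φ x := hmax₁ hϑ
    rw [zero_add, zero_add] at h3
    have h4 := M.contValue_nonneg ϑ Φ x
    have h5 : (up m - 1) * M.contValue ϑ Φ x ≤ |up m - 1| * M.contValue ϑ₁ Φ x :=
      (mul_le_mul_of_nonneg_right (le_abs_self _) h4).trans
        (mul_le_mul_of_nonneg_left h3 (abs_nonneg _))
    linarith

theorem IsRegularChoice.tendsto_opW [Nonempty 𝕏] (h : M.IsRegularChoice I J)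
    (hG : ∀ x, Continuous (G x)) (hΦ : ∀ x, 0 < Φ x) (hpos : ∀ x, 0 < M.bestValue J G Φ x)
    {Φs : ℕ → 𝕏 → ℝ} (hΦs : ∀ m x, 0 ≤ Φs m x) (hlim : Tendsto Φs atTop (𝓝 Φ)) :
    Tendsto (fun m => M.opW I J G (Φs m)) atTop (𝓝 (M.opW I J G Φ)) :=
  tendsto_pi_nhds.2 fun x => tendsto_consValue M.β_pos M.β_lt_one M.ρ_pos (h.subset_I x)
    (h.nonempty_I x) (hpos x) (h.tendsto_bestValue (hG x) hΦ hΦs hlim)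

end Model

/-! ### Fixed policies -/

namespace Model

/-- If `Ψ` dominates a point of the segment from `F` to `Φ`, and if it strictly dominates every
later point of the segment that it dominates, then it dominates `Φ`. -/
theorem le_of_segment {ι : Type*} [Finite ι] {F Φ Ψ : ι → ℝ} {s₀ : ℝ} (hs₀ : s₀ ≤ 1)
    (h0 : ∀ x, (1 - s₀) * F x + s₀ * Φ x ≤ Ψ x)
    (hstep : ∀ s, s₀ ≤ s → s < 1 → (∀ x, (1 - s) * F x + s * Φ x ≤ Ψ x) →
      ∀ x, (1 - s) * F x + s * Φ x < Ψ x) (x : ι) : Φ x ≤ Ψ x := by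
  set T : Set ℝ := Set.Icc s₀ 1 ∩ {s | ∀ x, (1 - s) * F x + s * Φ x ≤ Ψ x}
  have hT : IsCompact T := by
    refine isCompact_Icc.inter_right ?_
    rw [Set.ofPred_forall]
    exact isClosed_iInter fun x => isClosed_le (by fun_prop) continuous_const
  obtain ⟨s, ⟨⟨h1, h2⟩, h3⟩, hmax⟩ := hT.exists_isMaxOn ⟨s₀, ⟨le_rfl, hs₀⟩, h0⟩
    continuous_id.continuousOn
  rcases h2.eq_or_lt with rfl | h2
  · simpa using h3 x
  exfalso
  have h4 : ∀ᶠ s' in 𝓝 s, ∀ x, (1 - s') * F x + s' * Φ x < Ψ x := by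
    refine eventually_all.2 fun x => ?_
    have hcont : Continuous fun s' : ℝ => (1 - s') * F x + s' * Φ x := by fun_prop
    exact hcont.continuousAt.eventually (gt_mem_nhds (hstep s h1 h2 h3 x))
  obtain ⟨s', h5, h6, h7⟩ := ((h4.filter_mono nhdsWithin_le_nhds).and (Ioo_mem_nhdsGT h2)).exists
  exact absurd h6 (not_lt.2 (hmax ⟨⟨h1.trans h6.le, h7.le⟩, fun x => (h5 x).le⟩))

variable {𝕏 𝕐 : Type*} [MeasurableSpace 𝕏] [MeasurableSpace 𝕐] {n : ℕ}

/-- The operator with fixed consumption propensities `c` and portfolios `θ`. It is conjugate to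
the operator `𝕋` of recursive utility by multiplication with `c`. -/
def policyOp (M : Model 𝕏 𝕐 n) (c : 𝕏 → ℝ) (θ : 𝕏 → Fin n → ℝ) (Φ : 𝕏 → ℝ) (x : 𝕏) : ℝ :=
  M.H (c x) ((1 - c x) * M.D Φ x (θ x))

variable {M : Model 𝕏 𝕐 n} {c : 𝕏 → ℝ} {θ : 𝕏 → Fin n → ℝ} {x : 𝕏} {Φ Φ' F : 𝕏 → ℝ}

theorem D_eq (Φ : 𝕏 → ℝ) (x : 𝕏) (ϑ : Fin n → ℝ) :
    M.D Φ x ϑ = M.gainLoss x ϑ + M.contValue ϑ Φ x := rfl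

theorem gainLoss_le_D (Φ : 𝕏 → ℝ) (x : 𝕏) (ϑ : Fin n → ℝ) : M.gainLoss x ϑ ≤ M.D Φ x ϑ :=
  le_add_of_nonneg_right (M.contValue_nonneg _ _ _)

theorem continuous_gainLoss (x : 𝕏) : Continuous (M.gainLoss x) := by
  unfold gainLoss; fun_prop

variable [Fintype 𝕏] [MeasurableSingletonClass 𝕏]

theorem IsRegular.D_mono {ϑ : Fin n → ℝ} (h : M.IsRegular x ϑ) (hle : ∀ x, Φ x ≤ Φ' x) :
    M.D Φ x ϑ ≤ M.D Φ' x ϑ :=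
  add_le_add le_rfl (h.contValue_mono hle)

theorem IsRegular.D_concave {ϑ : Fin n → ℝ} (h : M.IsRegular x ϑ) (hΦ : ∀ x, 0 ≤ Φ x)
    (hΦ' : ∀ x, 0 ≤ Φ' x) {s t : ℝ} (hs : 0 ≤ s) (ht : 0 ≤ t) (hst : s + t = 1) :
    s * M.D Φ x ϑ + t * M.D Φ' x ϑ ≤ M.D (fun y => s * Φ y + t * Φ' y) x ϑ := by
  rcases hs.eq_or_lt with rfl | hs
  · obtain rfl : t = 1 := by linarith
    simp
  rcases ht.eq_or_lt with rfl | ht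
  · obtain rfl : s = 1 := by linarith
    simp
  have h1 := h.contValue_add_le (Φ := fun y => s * Φ y) (Φ' := fun y => t * Φ' y)
    (fun y => mul_nonneg hs.le (hΦ y)) (fun y => mul_nonneg ht.le (hΦ' y))
  rw [contValue_const_mul _ _ _ _ hs, contValue_const_mul _ _ _ _ ht] at h1
  simp only [D_eq]
  have : s * M.gainLoss x ϑ + t * M.gainLoss x ϑ = M.gainLoss x ϑ := by
    rw [← add_mul, hst, one_mul]
  linarith

theorem policyOp_mono (hc : ∀ x, c x ∈ Set.Ioo 0 1) (hθ : ∀ x, M.IsRegular x (θ x))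
    (hD : ∀ x, 0 ≤ M.D Φ x (θ x)) (hle : ∀ x, Φ x ≤ Φ' x) (x : 𝕏) :
    M.policyOp c θ Φ x ≤ M.policyOp c θ Φ' x := by
  have h1 : 0 ≤ 1 - c x := by linarith [(hc x).2]
  exact aggregator_mono M.β_pos M.β_lt_one M.ρ_pos (hc x).1.le (mul_nonneg h1 (hD x)) le_rfl
    (mul_le_mul_of_nonneg_left ((hθ x).D_mono hle) h1)

theorem policyOp_concave (hc : ∀ x, c x ∈ Set.Ioo 0 1) (hθ : ∀ x, M.IsRegular x (θ x))
    (hΦ : ∀ x, 0 ≤ Φ x) (hΦ' : ∀ x, 0 ≤ Φ' x) (hD : ∀ x, 0 ≤ M.D Φ x (θ x))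
    (hD' : ∀ x, 0 ≤ M.D Φ' x (θ x)) {s t : ℝ} (hs : 0 ≤ s) (ht : 0 ≤ t) (hst : s + t = 1) (x : 𝕏) :
    s * M.policyOp c θ Φ x + t * M.policyOp c θ Φ' x ≤
      M.policyOp c θ (fun y => s * Φ y + t * Φ' y) x := by
  have h1 : 0 ≤ 1 - c x := by linarith [(hc x).2]
  refine (aggregator_concave M.β_pos M.β_lt_one M.ρ_pos (hc x).1.le (mul_nonneg h1 (hD x))
    (mul_nonneg h1 (hD' x)) hs ht hst).trans ?_
  refine aggregator_mono M.β_pos M.β_lt_one M.ρ_pos (hc x).1.le ?_ le_rfl ?_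
  · exact add_nonneg (mul_nonneg hs (mul_nonneg h1 (hD x))) (mul_nonneg ht (mul_nonneg h1 (hD' x)))
  · have := mul_le_mul_of_nonneg_left ((hθ x).D_concave hΦ hΦ' hs ht hst) h1
    linarith

/-- Comparison of a fixed point with a supersolution of the operator of a fixed policy, by
concavity: it is enough that some iterate moves the lower point `F` strictly upwards. -/
theorem le_of_policyOp_of_lt_iterate (hc : ∀ x, c x ∈ Set.Ioo 0 1)
    (hθ : ∀ x, M.IsRegular x (θ x)) (hF : ∀ x, 0 ≤ F x) (hDF : ∀ x, 0 ≤ M.D F x (θ x))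
    (hFV : ∀ x, F x ≤ M.policyOp c θ F x) {m : ℕ} (hm : ∀ x, F x < (M.policyOp c θ)^[m] F x)
    {Ψ : 𝕏 → ℝ} (hΦF : ∀ x, F x ≤ Φ x) (hΦ : M.policyOp c θ Φ = Φ) (hΨF : ∀ x, F x ≤ Ψ x)
    (hΨ : ∀ x, M.policyOp c θ Ψ x ≤ Ψ x) (x : 𝕏) : Φ x ≤ Ψ x := by
  set V := M.policyOp c θ with hV
  -- everything happens above `F`, where the operator is defined, monotone and concave
  have hD : ∀ {Υ : 𝕏 → ℝ}, (∀ x, F x ≤ Υ x) → ∀ x, 0 ≤ M.D Υ x (θ x) := fun h x =>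
    (hDF x).trans ((hθ x).D_mono h)
  have hinv : ∀ {Υ : 𝕏 → ℝ}, (∀ x, F x ≤ Υ x) → ∀ x, F x ≤ V Υ x := fun h x =>
    (hFV x).trans (policyOp_mono hc hθ hDF h x)
  have hinv' : ∀ (j : ℕ) {Υ : 𝕏 → ℝ}, (∀ x, F x ≤ Υ x) → ∀ x, F x ≤ V^[j] Υ x := by
    intro j
    induction j with
    | zero => exact fun h => h
    | succ j ih => intro Υ h; rw [Function.iterate_succ_apply]; exact ih (hinv h)
  have hmono : ∀ (j : ℕ) {Υ Υ' : 𝕏 → ℝ}, (∀ x, F x ≤ Υ x) → (∀ x, Υ x ≤ Υ' x) →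
      ∀ x, V^[j] Υ x ≤ V^[j] Υ' x := by
    intro j
    induction j with
    | zero => exact fun _ h => h
    | succ j ih =>
      intro Υ Υ' h h'
      rw [Function.iterate_succ_apply, Function.iterate_succ_apply]
      exact ih (hinv h) (policyOp_mono hc hθ (hD h) h')
  have hΨj : ∀ j x, V^[j] Ψ x ≤ Ψ x := by
    intro j
    induction j with
    | zero => exact fun x => le_rfl
    | succ j ih =>
      intro x
      rw [Function.iterate_succ_apply]
      exact (hmono j (hinv hΨF) hΨ x).trans (ih x)
  have hΦj : ∀ j, V^[j] Φ = Φ := fun j => Function.iterate_fixed hΦ j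
  have hseg : ∀ {s : ℝ} {Υ : 𝕏 → ℝ}, 0 ≤ s → s ≤ 1 → (∀ x, F x ≤ Υ x) →
      ∀ x, F x ≤ (1 - s) * Υ x + s * Φ x := by
    intro s Υ h0 h1 h x
    nlinarith [mul_le_mul_of_nonneg_left (h x) (sub_nonneg.2 h1),
      mul_le_mul_of_nonneg_left (hΦF x) h0]
  have hconc : ∀ {s : ℝ}, 0 ≤ s → s ≤ 1 → ∀ j x, (1 - s) * V^[j] F x + s * Φ x ≤
      V^[j] (fun y => (1 - s) * F y + s * Φ y) x := by
    intro s h0 h1 j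
    induction j with
    | zero => exact fun x => le_rfl
    | succ j ih =>
      intro x
      rw [Function.iterate_succ_apply', Function.iterate_succ_apply']
      have hj := hinv' j (Υ := F) fun _ => le_rfl
      have e1 := policyOp_concave hc hθ (fun x => (hF x).trans (hj x))
        (fun x => (hF x).trans (hΦF x)) (hD hj) (hD hΦF) (sub_nonneg.2 h1) h0 (by ring) x
      rw [← hV, hΦ] at e1
      exact e1.trans (policyOp_mono hc hθ (hD (hseg h0 h1 hj)) ih x)
  refine le_of_segment (F := F) (s₀ := 0) zero_le_one (fun x => by simpa using hΨF x) ?_ x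
  intro s h0 h1 hle x
  calc (1 - s) * F x + s * Φ x < (1 - s) * V^[m] F x + s * Φ x := by
        have := mul_lt_mul_of_pos_left (hm x) (sub_pos.2 h1)
        linarith
    _ ≤ V^[m] (fun y => (1 - s) * F y + s * Φ y) x := hconc h0 h1.le m x
    _ ≤ V^[m] Ψ x := hmono m (hseg h0 h1.le fun _ => le_rfl) hle x
    _ ≤ Ψ x := hΨj m x

/-- Comparison of a positive fixed point with a positive supersolution of the operator of a fixed
policy with nonnegative gain-loss utility, which is strictly subhomogeneous. -/
theorem le_of_policyOp_of_nonneg [Nonempty 𝕏] (hc : ∀ x, c x ∈ Set.Ioo 0 1)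
    (hθ : ∀ x, M.IsRegular x (θ x)) (hg : ∀ x, 0 ≤ M.gainLoss x (θ x)) {Ψ : 𝕏 → ℝ}
    (hΦ0 : ∀ x, 0 < Φ x) (hΦ : M.policyOp c θ Φ = Φ) (hΨ0 : ∀ x, 0 < Ψ x)
    (hΨ : ∀ x, M.policyOp c θ Ψ x ≤ Ψ x) (x : 𝕏) : Φ x ≤ Ψ x := by
  have hD : ∀ Υ x, 0 ≤ M.D Υ x (θ x) := fun Υ x => (hg x).trans (gainLoss_le_D _ _ _)
  obtain ⟨y, hy⟩ := Finite.exists_min fun x => Ψ x / Φ x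
  have hy0 : 0 < Ψ y / Φ y := div_pos (hΨ0 y) (hΦ0 y)
  refine le_of_segment (F := fun _ => 0) (s₀ := min 1 (Ψ y / Φ y)) (min_le_left _ _) ?_ ?_ x
  · intro x
    rw [mul_zero, zero_add]
    exact (le_div_iff₀ (hΦ0 x)).1 ((min_le_right _ _).trans (hy x))
  · intro s hs0 hs1 hle x
    have hs : 0 < s := (lt_min one_pos hy0).trans_le hs0
    simp only [mul_zero, zero_add] at hle ⊢
    have hc1 : 0 < 1 - c x := by linarith [(hc x).2]
    have hDpos : 0 < M.D Φ x (θ x) := add_pos_of_nonneg_of_pos (hg x) ((hθ x).contValue_pos hΦ0)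
    calc s * Φ x = s * M.policyOp c θ Φ x := by rw [hΦ]
      _ = aggregator M.β M.ρ (s * c x) (s * ((1 - c x) * M.D Φ x (θ x))) :=
          (aggregator_mul M.β_pos M.β_lt_one hs (hc x).1.le (by positivity)).symm
      _ < aggregator M.β M.ρ (c x) (s * ((1 - c x) * M.D Φ x (θ x))) :=
          aggregator_strictMono_left M.β_pos M.β_lt_one (mul_pos hs (hc x).1)
            (mul_lt_of_lt_one_left (hc x).1 hs1) (by positivity)
      _ ≤ M.policyOp c θ (fun y => s * Φ y) x := by
          refine aggregator_mono M.β_pos M.β_lt_one M.ρ_pos (hc x).1.le (by positivity) le_rfl ?_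
          rw [mul_left_comm]
          refine mul_le_mul_of_nonneg_left ?_ hc1.le
          rw [D_eq, D_eq, contValue_const_mul _ _ _ _ hs, mul_add]
          exact add_le_add (mul_le_of_le_one_left (hg x) hs1.le) le_rfl
      _ ≤ M.policyOp c θ Ψ x := policyOp_mono hc hθ (hD _) hle x
      _ ≤ Ψ x := hΨ x

end Model

/-! ### Consequences of feasibility -/

namespace Model

/-- Every feasible portfolio in a given state is part of an admissible policy. -/
theorem exists_admissible {ι : Type*} {n : ℕ} {I : ι → Set ℝ} {J : ι → Set (Fin n → ℝ)} {x : ι}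
    (hI : ∀ x, (I x).Nonempty) (hJ : ∀ x, (J x).Nonempty)
    {ϑ : Fin n → ℝ} (hϑ : ϑ ∈ J x) : ∃ c θ, (c, θ) ∈ admissible I J ∧ θ x = ϑ := by
  classical
  choose c hc using hI
  choose θ hθ using hJ
  refine ⟨c, Function.update θ x ϑ, fun y => ⟨hc y, ?_⟩, by simp⟩
  rcases eq_or_ne y x with rfl | hy
  · simpa using hϑ
  · simpa [Function.update_of_ne hy] using hθ y

variable {𝕏 𝕐 : Type*} [MeasurableSpace 𝕏] [MeasurableSpace 𝕐] {n : ℕ} {M : Model 𝕏 𝕐 n}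
  {I : 𝕏 → Set ℝ} {J : 𝕏 → Set (Fin n → ℝ)} {c : 𝕏 → ℝ} {θ : 𝕏 → Fin n → ℝ} {x : 𝕏}

theorem IsRegularChoice.mem_Ioo (h : M.IsRegularChoice I J) (hadm : (c, θ) ∈ admissible I J)
    (x : 𝕏) : c x ∈ Set.Ioo 0 1 := h.subset_I x (hadm x).1

theorem IsRegularChoice.isRegular (h : M.IsRegularChoice I J) (hadm : (c, θ) ∈ admissible I J)
    (x : 𝕏) : M.IsRegular x (θ x) := h.regular x _ (hadm x).2

/-- The factor `c (X_{t+1})` in the growth rate of consumption is what multiplication with `c`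
absorbs. -/
theorem exp_kappa (hc : ∀ x, c x ∈ Set.Ioo 0 1) {p : 𝕏 × 𝕐}
    (hp : 0 < M.portReturn (θ x) x p.1 p.2) :
    Real.exp (M.kappa c θ x p.1 p.2) =
      (1 - c x) / c x * (M.portReturn (θ x) x p.1 p.2 * c p.1) := by
  have h1 := hc x
  have h2 := hc p.1
  unfold kappa
  rw [Real.exp_add, Real.exp_add, Real.exp_sub, Real.exp_log h2.1, Real.exp_log h1.1,
    Real.exp_log hp, Real.exp_log (sub_pos.2 h1.2)]
  ring

/-- The function `c f₀`, where `f₀` is the starting point of the recursive utility iteration. -/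
def policyZero (M : Model 𝕏 𝕐 n) (c : 𝕏 → ℝ) (θ : 𝕏 → Fin n → ℝ) (x : 𝕏) : ℝ :=
  M.H (c x) ((1 - c x) * max (M.gainLoss x (θ x)) 0)

theorem mul_fZero (hc : ∀ x, c x ∈ Set.Ioo 0 1) (x : 𝕏) :
    c x * fZero M.β M.ρ (M.varpi c θ) x = M.policyZero c θ x := by
  have h1 := hc x
  have h2 : 0 < (1 - c x) / c x := div_pos (sub_pos.2 h1.2) h1.1
  rw [fZero, ← aggregator_mul M.β_pos M.β_lt_one h1.1 zero_le_one (le_max_right _ _), mul_one,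
    mul_max_of_nonneg _ _ h1.1.le, varpi, ← mul_assoc, mul_div_cancel₀ _ h1.1.ne', mul_zero,
    policyZero, mul_max_of_nonneg _ _ (sub_pos.2 h1.2).le, mul_zero]
  rfl

theorem policyZero_nonneg (hc : ∀ x, c x ∈ Set.Ioo 0 1) (x : 𝕏) : 0 ≤ M.policyZero c θ x :=
  aggregator_nonneg M.β_pos M.β_lt_one (hc x).1.le
    (mul_nonneg (sub_pos.2 (hc x).2).le (le_max_right _ _))

theorem policyZero_le_policyOp (hc : ∀ x, c x ∈ Set.Ioo 0 1) {Φ : 𝕏 → ℝ}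
    (hD : 0 ≤ M.D Φ x (θ x)) : M.policyZero c θ x ≤ M.policyOp c θ Φ x := by
  have h1 := (sub_pos.2 (hc x).2).le
  exact aggregator_mono M.β_pos M.β_lt_one M.ρ_pos (hc x).1.le
    (mul_nonneg h1 (le_max_right _ _)) le_rfl
    (mul_le_mul_of_nonneg_left (max_le (gainLoss_le_D _ _ _) hD) h1)

theorem varpi_nonneg_iff (hc : ∀ x, c x ∈ Set.Ioo 0 1) :
    0 ≤ M.varpi c θ x ↔ 0 ≤ M.gainLoss x (θ x) := by
  have h1 := hc x
  exact mul_nonneg_iff_of_pos_left (div_pos (sub_pos.2 h1.2) h1.1)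

theorem bddAbove_max_gainLoss (hJ : IsCompact (J x)) :
    BddAbove ((fun ϑ => max (M.gainLoss x ϑ) 0) '' J x) :=
  hJ.bddAbove_image ((continuous_gainLoss x).max continuous_const).continuousOn

theorem sSup_max_gainLoss_nonneg (x : 𝕏) :
    0 ≤ sSup ((fun ϑ => max (M.gainLoss x ϑ) 0) '' J x) :=
  Real.sSup_nonneg (by rintro _ ⟨ϑ, -, rfl⟩; exact le_max_right _ _)

theorem IsRegularChoice.phiZero_nonneg (h : M.IsRegularChoice I J) (x : 𝕏) :
    0 ≤ M.phiZero I J x :=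
  consValue_nonneg M.β_pos M.β_lt_one M.ρ_pos (h.subset_I x) (h.nonempty_I x)
    (sSup_max_gainLoss_nonneg x)

theorem IsRegularChoice.policyZero_le_phiZero (h : M.IsRegularChoice I J)
    (hadm : (c, θ) ∈ admissible I J) (x : 𝕏) : M.policyZero c θ x ≤ M.phiZero I J x := by
  have hc := h.mem_Ioo hadm x
  have h1 := (sub_pos.2 hc.2).le
  refine le_trans ?_ (le_consValue M.β_pos M.β_lt_one M.ρ_pos (h.subset_I x) (hadm x).1
    (sSup_max_gainLoss_nonneg x))
  exact aggregator_mono M.β_pos M.β_lt_one M.ρ_pos hc.1.le (mul_nonneg h1 (le_max_right _ _)) le_rfl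
    (mul_le_mul_of_nonneg_left
      (le_csSup (bddAbove_max_gainLoss (h.compact_J x)) ⟨θ x, (hadm x).2, rfl⟩) h1)

variable [Fintype 𝕏] [MeasurableSingletonClass 𝕏]

theorem certEquiv_exp_kappa (hc : ∀ x, c x ∈ Set.Ioo 0 1) (hθ : ∀ x, M.IsRegular x (θ x))
    (f : 𝕏 → ℝ) (x : 𝕏) :
    certEquiv M.γ (M.P x) (fun p => Real.exp (M.kappa c θ x p.1 p.2) * f p.1) =
      (1 - c x) / c x * M.contValue (θ x) (fun y => c y * f y) x := by
  have h1 := hc x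
  rw [← contValue_const_mul _ _ _ _ (div_pos (sub_pos.2 h1.2) h1.1)]
  refine certEquiv_congr_ae ((hθ x).pos.mono fun p hp => ?_)
  simp only [exp_kappa hc hp]
  ring

/-- In state `x` a portfolio is regular if it is part of a feasible policy. -/
theorem isRegular_of_feasible (hc : ∀ x, c x ∈ Set.Ioo 0 1)
    (hpos : ∀ᵐ p ∂(M.P x), 0 < M.portReturn (θ x) x p.1 p.2)
    (hint : Integrable (fun p : 𝕏 × 𝕐 => util M.γ (Real.exp (M.kappa c θ x p.1 p.2))) (M.P x)) :
    M.IsRegular x (θ x) := by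
  have h1 := hc x
  refine ⟨hpos, ?_⟩
  refine (integrable_util_mul_comp_fst (Eventually.of_forall fun p => Real.exp_pos _) hint
    (w := fun y => ((1 - c x) / c x * c y)⁻¹) fun y =>
      inv_pos.2 (mul_pos (div_pos (sub_pos.2 h1.2) h1.1) (hc y).1)).congr ?_
  refine hpos.mono fun p hp => ?_
  have h2 := (hc p.1).1
  have h3 := sub_pos.2 h1.2
  have h4 := h1.1
  simp only
  rw [exp_kappa hc hp]
  congr 1
  field_simp

theorem isRegularChoice_of_feasible
    (hI : ∀ x, (I x).Nonempty ∧ ∃ C : Set ℝ, IsClosed C ∧ I x = Set.Ioo 0 1 ∩ C)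
    (hJ : ∀ x, (J x).Nonempty ∧ IsCompact (J x)) (hfeas : M.Feasible I J) :
    M.IsRegularChoice I J where
  nonempty_I x := (hI x).1
  closed_I x := (hI x).2
  nonempty_J x := (hJ x).1
  compact_J x := (hJ x).2
  regular x ϑ hϑ := by
    obtain ⟨c, θ, hadm, rfl⟩ := exists_admissible (fun x => (hI x).1) (fun x => (hJ x).1) hϑ
    have hc : ∀ y, c y ∈ Set.Ioo 0 1 := fun y => by
      obtain ⟨C, -, hC⟩ := (hI y).2
      have := (hadm y).1
      rw [hC] at this
      exact this.1
    obtain ⟨h1, h2, -, -⟩ := hfeas c θ hadm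
    exact isRegular_of_feasible hc (h1 x) (h2 x)

theorem util_utilInv {γ a : ℝ} (h : γ = 1 ∨ 0 < a) : util γ (utilInv γ a) = a := by
  unfold util utilInv
  split_ifs with hγ
  · exact Real.log_exp a
  · have ha := h.resolve_left hγ
    rw [← Real.rpow_mul ha.le, one_div_mul_cancel (fun h => hγ (by linarith)), Real.rpow_one]

theorem utilInv_pos {γ a : ℝ} (h : γ = 1 ∨ 0 < a) : 0 < utilInv γ a := by
  unfold utilInv
  split_ifs with hγ
  · exact Real.exp_pos _
  · exact Real.rpow_pos_of_pos (h.resolve_left hγ) _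

/-- The Perron-Frobenius value of a policy in terms of certainty equivalents: `δ` is an eigenvalue,
with a positive eigenfunction, of the homogeneous part of the operator of the policy. -/
theorem exists_eigenfunction [Nonempty 𝕏] (hirr : (transitionMatrix M.P).IsIrreducible)
    (hc : ∀ x, c x ∈ Set.Ioo 0 1) (hθ : ∀ x, M.IsRegular x (θ x))
    (hint : ∀ x, Integrable (fun p : 𝕏 × 𝕐 => util M.γ (Real.exp (M.kappa c θ x p.1 p.2))) (M.P x)) :
    0 < M.delta c θ ∧ ∃ Ψ : 𝕏 → ℝ, (∀ x, 0 < Ψ x) ∧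
      ∀ x, (1 - c x) * M.contValue (θ x) Ψ x = M.delta c θ * Ψ x := by
  have hη := Classical.epsilon_spec (exists_isPerronValue hirr hint)
  have hδ : M.delta c θ = utilInv M.γ (Classical.epsilon (IsPerronValue M.P M.γ (M.kappa c θ))) :=
    rfl
  generalize Classical.epsilon (IsPerronValue M.P M.γ (M.kappa c θ)) = η at hη hδ
  have key : ∃ v : 𝕏 → ℝ, (M.γ = 1 ∨ 0 < η) ∧ (∀ x, M.γ = 1 ∨ 0 < v x) ∧
      ∀ x, utilInv M.γ (∫ p, util M.γ (Real.exp (M.kappa c θ x p.1 p.2) * utilInv M.γ (v p.1))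
        ∂(M.P x)) = utilInv M.γ η * utilInv M.γ (v x) := by
    unfold IsPerronValue at hη
    split_ifs at hη with hγ
    · obtain ⟨v, hv⟩ := hη
      refine ⟨v, Or.inl hγ, fun x => Or.inl hγ, fun x => ?_⟩
      have hi : Integrable (fun p : 𝕏 × 𝕐 => M.kappa c θ x p.1 p.2) (M.P x) := by
        have := hint x
        simpa only [util, if_pos hγ, Real.log_exp] using this
      simp only [util, utilInv, if_pos hγ]
      simp only [← Real.exp_add, Real.log_exp]
      rw [integral_add hi (integrable_comp_fst v), hv x]
      congr 1
      ring
    · obtain ⟨h1, v, h2, h3⟩ := hη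
      refine ⟨v, Or.inr h1, fun x => Or.inr (h2 x), fun x => ?_⟩
      have h4 : ∀ p : 𝕏 × 𝕐, util M.γ (Real.exp (M.kappa c θ x p.1 p.2) * utilInv M.γ (v p.1)) =
          util M.γ (Real.exp (M.kappa c θ x p.1 p.2)) * v p.1 := by
        intro p
        have h5 := util_utilInv (γ := M.γ) (Or.inr (h2 p.1))
        have h6 := utilInv_pos (γ := M.γ) (Or.inr (h2 p.1))
        simp only [util, if_neg hγ] at h5 ⊢
        rw [Real.mul_rpow (Real.exp_pos _).le h6.le, h5]
      simp only [h4]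
      have h5 := h3 x
      unfold opU at h5
      rw [h5]
      simp only [utilInv, if_neg hγ]
      rw [Real.mul_rpow h1.le (h2 x).le]
  obtain ⟨v, h1, h2, h3⟩ := key
  have hw : ∀ x, 0 < utilInv M.γ (v x) := fun x => utilInv_pos (h2 x)
  rw [hδ]
  refine ⟨utilInv_pos h1, fun x => c x * utilInv M.γ (v x), fun x => mul_pos (hc x).1 (hw x),
    fun x => ?_⟩
  have h4 := certEquiv_exp_kappa hc hθ (fun y => utilInv M.γ (v y)) x
  rw [certEquiv_eq_utilInv (Eventually.of_forall fun p => mul_pos (Real.exp_pos _) (hw _))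
    (integrable_util_mul_comp_fst (Eventually.of_forall fun p => Real.exp_pos _) (hint x) hw),
    h3 x] at h4
  have h5 := (hc x).1
  field_simp at h4
  linarith

/-! ### Conjugacy with the recursive utility operator -/

theorem innerT_eq (hc : ∀ x, c x ∈ Set.Ioo 0 1) (hθ : ∀ x, M.IsRegular x (θ x)) (f : 𝕏 → ℝ)
    (x : 𝕏) : innerT M.P M.γ (M.kappa c θ) (M.varpi c θ) f x =
      (1 - c x) / c x * M.D (fun y => c y * f y) x (θ x) := by
  rw [innerT, certEquiv_exp_kappa hc hθ, varpi, D_eq]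
  ring

/-- Multiplication with `c` conjugates `𝕋` to the operator of the policy. -/
theorem mul_opT (hc : ∀ x, c x ∈ Set.Ioo 0 1) (hθ : ∀ x, M.IsRegular x (θ x)) {f : 𝕏 → ℝ}
    (hD : 0 ≤ M.D (fun y => c y * f y) x (θ x)) :
    c x * opT M.P M.β M.ρ M.γ (M.kappa c θ) (M.varpi c θ) f x =
      M.policyOp c θ (fun y => c y * f y) x := by
  have h1 := hc x
  have h2 : 0 < (1 - c x) / c x := div_pos (sub_pos.2 h1.2) h1.1
  rw [opT, innerT_eq hc hθ, ← aggregator_mul M.β_pos M.β_lt_one h1.1 zero_le_one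
    (mul_nonneg h2.le hD), mul_one, ← mul_assoc, mul_div_cancel₀ _ h1.1.ne']
  rfl

/-- The dichotomy in the feasibility assumption, for the operator of the policy. -/
theorem feasible_dichotomy (hc : ∀ x, c x ∈ Set.Ioo 0 1) (hθ : ∀ x, M.IsRegular x (θ x))
    (h : (∀ x, 0 ≤ M.varpi c θ x) ∨
      (fZero M.β M.ρ (M.varpi c θ) ∈ domT M.P M.γ (M.kappa c θ) (M.varpi c θ) ∧
        ∃ m : ℕ, 1 ≤ m ∧ ∀ x, fZero M.β M.ρ (M.varpi c θ) x <
          (opT M.P M.β M.ρ M.γ (M.kappa c θ) (M.varpi c θ))^[m] (fZero M.β M.ρ (M.varpi c θ)) x)) :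
    (∀ x, 0 ≤ M.gainLoss x (θ x)) ∨
      ((∀ x, 0 ≤ M.D (M.policyZero c θ) x (θ x)) ∧
        ∃ m : ℕ, ∀ x, M.policyZero c θ x < (M.policyOp c θ)^[m] (M.policyZero c θ) x) := by
  refine h.imp (fun h x => (varpi_nonneg_iff hc).1 (h x)) ?_
  rintro ⟨⟨-, hdom⟩, m, -, hm⟩
  set f₀ := fZero M.β M.ρ (M.varpi c θ)
  set T := opT M.P M.β M.ρ M.γ (M.kappa c θ) (M.varpi c θ)
  have h0 : (fun y => c y * f₀ y) = M.policyZero c θ := funext fun y => mul_fZero hc y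
  have hD : ∀ x, 0 ≤ M.D (M.policyZero c θ) x (θ x) := by
    intro x
    have h1 := hdom x
    rw [innerT_eq hc hθ, h0] at h1
    exact (mul_nonneg_iff_of_pos_left (div_pos (sub_pos.2 (hc x).2) (hc x).1)).1 h1
  refine ⟨hD, m, fun x => ?_⟩
  have key : ∀ j : ℕ, (fun y => c y * T^[j] f₀ y) = (M.policyOp c θ)^[j] (M.policyZero c θ) ∧
      ∀ x, M.policyZero c θ x ≤ (M.policyOp c θ)^[j] (M.policyZero c θ) x := by
    intro j
    induction j with
    | zero => exact ⟨h0, fun x => le_rfl⟩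
    | succ j ih =>
      have hDj : ∀ x, 0 ≤ M.D ((M.policyOp c θ)^[j] (M.policyZero c θ)) x (θ x) := fun x =>
        (hD x).trans ((hθ x).D_mono ih.2)
      simp only [Function.iterate_succ_apply']
      refine ⟨funext fun y => ?_, fun x => policyZero_le_policyOp hc (hDj x)⟩
      rw [← ih.1]
      exact mul_opT hc hθ (by rw [ih.1]; exact hDj y)
  rw [← (key m).1, ← mul_fZero hc x]
  exact mul_lt_mul_of_pos_left (hm x) (hc x).1

/-! ### The starting point of the iteration -/

/-- Feasibility makes every portfolio acceptable at `Φ₀`. -/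
theorem D_phiZero_nonneg (hreg : M.IsRegularChoice I J) (hfeas : M.Feasible I J) {ϑ : Fin n → ℝ}
    (hϑ : ϑ ∈ J x) : 0 ≤ M.D (M.phiZero I J) x ϑ := by
  obtain ⟨c, θ, hadm, rfl⟩ := exists_admissible hreg.nonempty_I hreg.nonempty_J hϑ
  have hc' := hreg.mem_Ioo hadm
  have hθ' := hreg.isRegular hadm
  rcases feasible_dichotomy hc' hθ' (hfeas c θ hadm).2.2.2 with h | h
  · exact (h x).trans (gainLoss_le_D _ _ _)
  · exact (h.1 x).trans ((hθ' x).D_mono (hreg.policyZero_le_phiZero hadm))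

theorem IsRegularChoice.D_le_maxD (h : M.IsRegularChoice I J) {Φ : 𝕏 → ℝ} (hΦ : ∀ x, 0 ≤ Φ x)
    {ϑ : Fin n → ℝ} (hϑ : ϑ ∈ J x) : M.D Φ x ϑ ≤ M.maxD J Φ x :=
  h.le_bestValue (continuous_gainLoss x) hΦ hϑ

theorem phiZero_mem_domW (hreg : M.IsRegularChoice I J) (hfeas : M.Feasible I J) :
    M.phiZero I J ∈ M.domW J := by
  refine ⟨hreg.phiZero_nonneg, fun x => ?_⟩
  obtain ⟨ϑ, hϑ⟩ := hreg.nonempty_J x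
  exact (D_phiZero_nonneg hreg hfeas hϑ).trans (hreg.D_le_maxD hreg.phiZero_nonneg hϑ)

/-- The image of `𝕎` lies above `Φ₀`, so that iteration moves every function of the domain above
`Φ₀` in one step. -/
theorem IsRegularChoice.phiZero_le_W (h : M.IsRegularChoice I J) {Φ : 𝕏 → ℝ}
    (hΦ : Φ ∈ M.domW J) (x : 𝕏) : M.phiZero I J x ≤ M.W I J Φ x := by
  refine consValue_mono M.β_pos M.β_lt_one M.ρ_pos (h.subset_I x) (h.nonempty_I x)
    (sSup_max_gainLoss_nonneg x) (csSup_le ((h.nonempty_J x).image _) ?_)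
  rintro _ ⟨ϑ, hϑ, rfl⟩
  exact max_le ((gainLoss_le_D _ _ _).trans (h.D_le_maxD hΦ.1 hϑ)) (hΦ.2 x)

theorem IsRegularChoice.mem_domW_of_le (h : M.IsRegularChoice I J) {Φ Φ' : 𝕏 → ℝ}
    (hΦ : Φ ∈ M.domW J) (hle : ∀ x, Φ x ≤ Φ' x) : Φ' ∈ M.domW J :=
  ⟨fun x => (hΦ.1 x).trans (hle x), fun x => (hΦ.2 x).trans
    (h.bestValue_mono (continuous_gainLoss x) hΦ.1 hle)⟩

theorem IsRegularChoice.W_mono (h : M.IsRegularChoice I J) {Φ Φ' : 𝕏 → ℝ}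
    (hΦ : Φ ∈ M.domW J) (hle : ∀ x, Φ x ≤ Φ' x) (x : 𝕏) : M.W I J Φ x ≤ M.W I J Φ' x :=
  h.opW_mono (continuous_gainLoss x) hΦ.1 hle (hΦ.2 x)

theorem W_mem_domW (hreg : M.IsRegularChoice I J) (hfeas : M.Feasible I J) {Φ : 𝕏 → ℝ}
    (hΦ : Φ ∈ M.domW J) : M.W I J Φ ∈ M.domW J :=
  hreg.mem_domW_of_le (phiZero_mem_domW hreg hfeas) (hreg.phiZero_le_W hΦ)

theorem iterate_mem_domW (hreg : M.IsRegularChoice I J) (hfeas : M.Feasible I J) {Φ : 𝕏 → ℝ}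
    (hΦ : Φ ∈ M.domW J) (m : ℕ) : (M.W I J)^[m] Φ ∈ M.domW J := by
  induction m with
  | zero => exact hΦ
  | succ m ih => rw [Function.iterate_succ_apply']; exact W_mem_domW hreg hfeas ih

theorem iterate_mono (hreg : M.IsRegularChoice I J) (hfeas : M.Feasible I J) {Φ Φ' : 𝕏 → ℝ}
    (hΦ : Φ ∈ M.domW J) (hle : ∀ x, Φ x ≤ Φ' x) (m : ℕ) (x : 𝕏) :
    (M.W I J)^[m] Φ x ≤ (M.W I J)^[m] Φ' x := by
  induction m generalizing x with
  | zero => exact hle x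
  | succ m ih =>
    rw [Function.iterate_succ_apply', Function.iterate_succ_apply']
    exact hreg.W_mono (iterate_mem_domW hreg hfeas hΦ m) ih x

end Model

/-! ### Supersolutions -/

namespace Model

variable {𝕏 𝕐 : Type*} [Fintype 𝕏] [MeasurableSpace 𝕏] [MeasurableSingletonClass 𝕏]
  [MeasurableSpace 𝕐] {n : ℕ} {M : Model 𝕏 𝕐 n} {I : 𝕏 → Set ℝ} {J : 𝕏 → Set (Fin n → ℝ)}
  {c : 𝕏 → ℝ} {θ : 𝕏 → Fin n → ℝ} {x : 𝕏}

/-- For `ρ ≥ 1` the aggregator is continuous and vanishes on the boundary; by homogeneity this makes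
its growth sublinear. -/
theorem tendsto_aggregator_zero {β ρ z : ℝ} (hβ : 0 < β) (hβ1 : β < 1) (hρ : 1 ≤ ρ) (hz : 0 < z) :
    Tendsto (fun t => aggregator β ρ t z) (𝓝[>] 0) (𝓝 0) := by
  have h0 : aggregator β ρ 0 z = 0 := by simp [aggregator, hρ]
  have h1 := (continuousOn_aggregator (ρ := ρ) hβ hβ1) (0, z)
    (by simp only [Set.mem_ofPred_eq]; exact ⟨le_rfl, hz.le, by simpa using hz⟩)
  have h2 : Tendsto (fun t : ℝ => (t, z)) (𝓝[>] 0)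
      (𝓝[{p : ℝ × ℝ | 0 ≤ p.1 ∧ 0 ≤ p.2 ∧ 0 < p.1 + p.2}] (0, z)) := by
    refine tendsto_nhdsWithin_iff.2 ⟨?_, ?_⟩
    · exact ((by fun_prop : Continuous fun t : ℝ => (t, z)).tendsto 0).mono_left nhdsWithin_le_nhds
    · filter_upwards [self_mem_nhdsWithin] with t (ht : 0 < t)
      exact ⟨ht.le, hz.le, add_pos ht hz⟩
  have := h1.tendsto.comp h2
  simp only [h0] at this
  exact this

/-- For `ρ ≥ 1` a large constant is a supersolution, since the aggregator grows sublinearly. -/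
theorem exists_supersolution_of_one_le [Nonempty 𝕏] (hreg : M.IsRegularChoice I J) (hρ : 1 ≤ M.ρ)
    {g : ℝ} (hg : 0 < g) :
    ∃ u : 𝕏 → ℝ, (∀ x, 0 < u x) ∧ ∀ x, M.opW I J (fun _ _ => g) u x ≤ u x := by
  obtain ⟨x₀, hx₀⟩ := Finite.exists_max fun x => M.bestValue J (fun _ _ => 0) (fun _ => 1) x
  set C := M.bestValue J (fun _ _ => 0) (fun _ => 1) x₀
  have hA : ∀ x, ∀ ϑ ∈ J x, M.contValue ϑ (fun _ => 1) x ≤ C := fun x ϑ hϑ => by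
    have := hreg.le_bestValue (G := fun _ _ => 0) continuous_const (fun _ => zero_le_one) hϑ
    rw [zero_add] at this
    exact this.trans (hx₀ x)
  have hC : 0 ≤ C := by
    obtain ⟨ϑ, hϑ⟩ := hreg.nonempty_J x₀
    exact (M.contValue_nonneg _ _ _).trans (hA x₀ ϑ hϑ)
  have hgC : 0 < g + C := by linarith
  obtain ⟨t, h1, h2, h3⟩ := (((tendsto_aggregator_zero M.β_pos M.β_lt_one hρ hgC).eventually
    (gt_mem_nhds one_pos)).and (Ioo_mem_nhdsGT one_pos)).exists
  refine ⟨fun _ => t⁻¹, fun _ => inv_pos.2 h2, fun x => consValue_le (hreg.nonempty_I x) ?_⟩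
  intro c hc
  obtain ⟨hc0, hc1⟩ := hreg.subset_I x hc
  have ht1 : 1 ≤ t⁻¹ := (one_le_inv₀ h2).2 h3.le
  have hbest : M.bestValue J (fun _ _ => g) (fun _ => t⁻¹) x ≤ t⁻¹ * (g + C) := by
    refine hreg.bestValue_le fun ϑ hϑ => ?_
    have e1 := M.contValue_const_mul ϑ (fun _ => 1) x (inv_pos.2 h2)
    simp only [mul_one] at e1
    rw [e1]
    have e2 := mul_le_mul_of_nonneg_left (hA x ϑ hϑ) (inv_pos.2 h2).le
    nlinarith
  have hbest0 : 0 ≤ M.bestValue J (fun _ _ => g) (fun _ => t⁻¹) x := by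
    obtain ⟨ϑ, hϑ⟩ := hreg.nonempty_J x
    exact (add_nonneg hg.le (M.contValue_nonneg _ _ _)).trans
      (hreg.le_bestValue (G := fun _ _ => g) continuous_const (fun _ => (inv_pos.2 h2).le) hϑ)
  calc aggregator M.β M.ρ c ((1 - c) * M.bestValue J (fun _ _ => g) (fun _ => t⁻¹) x)
      ≤ aggregator M.β M.ρ (t⁻¹ * t) (t⁻¹ * (g + C)) := by
        refine aggregator_mono M.β_pos M.β_lt_one M.ρ_pos hc0.le
          (mul_nonneg (by linarith) hbest0) ?_ ?_
        · rw [inv_mul_cancel₀ h2.ne']; exact hc1.le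
        · nlinarith
    _ = t⁻¹ * aggregator M.β M.ρ t (g + C) :=
        aggregator_mul M.β_pos M.β_lt_one (inv_pos.2 h2) h2.le hgC.le
    _ ≤ t⁻¹ := mul_le_of_le_one_right (inv_pos.2 h2).le h1.le

/-- If the factor `B`, applied with the highest saving rates and with some portfolios, does not make
`v` smaller, then `v` has no positive values: otherwise a policy with nearly the highest saving
rates would violate the uniform bound on the Perron-Frobenius values. -/
theorem nonpos_of_le_contValue [Nonempty 𝕏] (hirr : (transitionMatrix M.P).IsIrreducible)
    (hreg : M.IsRegularChoice I J) (hfeas : M.Feasible I J) {B q : ℝ} (hB : 0 < B) (hq : q < 1)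
    (hδ : ∀ c θ, (c, θ) ∈ admissible I J → B * M.delta c θ ≤ q)
    (hθ : ∀ x, θ x ∈ J x) {v : 𝕏 → ℝ}
    (hv : ∀ x, v x ≤ B * sSup ((fun c => 1 - c) '' I x) * M.contValue (θ x) v x) (x : 𝕏) :
    v x ≤ 0 := by
  set s : 𝕏 → ℝ := fun x => sSup ((fun c => 1 - c) '' I x)
  have hbdd : ∀ x, BddAbove ((fun c => 1 - c) '' I x) := fun x =>
    ⟨1, by rintro _ ⟨c, hc, rfl⟩; linarith [(hreg.subset_I x hc).1]⟩
  have hs : ∀ x, 0 < s x := fun x => by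
    obtain ⟨c, hc⟩ := hreg.nonempty_I x
    exact (sub_pos.2 (hreg.subset_I x hc).2).trans_le (le_csSup (hbdd x) ⟨c, hc, rfl⟩)
  -- consumption propensities so small that `1 - c` almost attains the supremum `s`
  have hch : ∀ x, ∃ c ∈ I x, max q (1 / 2) * s x < 1 - c := fun x => by
    have h1 : max q (1 / 2) * s x < s x :=
      mul_lt_of_lt_one_left (hs x) (max_lt hq (by norm_num))
    obtain ⟨_, ⟨c, hc, rfl⟩, h2⟩ := exists_lt_of_lt_csSup ((hreg.nonempty_I x).image _) h1
    exact ⟨c, hc, h2⟩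
  choose c hc hcs using hch
  have hadm : (c, θ) ∈ admissible I J := fun x => ⟨hc x, hθ x⟩
  obtain ⟨hδ0, Ψ, hΨ, heig⟩ := exists_eigenfunction hirr (hreg.mem_Ioo hadm) (hreg.isRegular hadm)
    (hfeas c θ hadm).2.1
  obtain ⟨y, hy⟩ := Finite.exists_max fun x => v x / Ψ x
  by_contra! hpos
  set t := v y / Ψ y with ht_def
  have ht : 0 < t := (div_pos hpos (hΨ x)).trans_le (hy x)
  have hvt : ∀ x, v x ≤ t * Ψ x := fun x => (div_le_iff₀ (hΨ x)).1 (hy x)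
  have hvy : v y = t * Ψ y := by rw [ht_def, div_mul_cancel₀ _ (hΨ y).ne']
  have h1 := (hreg.isRegular hadm y).contValue_mono hvt
  rw [contValue_const_mul _ _ _ _ ht] at h1
  have hc1 : 0 < 1 - c y := sub_pos.2 (hreg.mem_Ioo hadm y).2
  have hvpos : 0 < v y := by rw [hvy]; exact mul_pos ht (hΨ y)
  -- the eigenfunction turns the growth condition at `y` into a bound on `1 - c y`
  have h2 : (1 - c y) * v y ≤ B * s y * (M.delta c θ * v y) := by
    calc (1 - c y) * v y ≤ (1 - c y) * (B * s y * M.contValue (θ y) v y) :=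
          mul_le_mul_of_nonneg_left (hv y) hc1.le
      _ ≤ (1 - c y) * (B * s y * (t * M.contValue (θ y) Ψ y)) := by
          have := mul_pos hB (hs y)
          gcongr
      _ = B * s y * (t * ((1 - c y) * M.contValue (θ y) Ψ y)) := by ring
      _ = B * s y * (M.delta c θ * v y) := by rw [heig y, hvy]; ring
  have h3 : 1 - c y ≤ B * M.delta c θ * s y :=
    le_of_mul_le_mul_right (h2.trans_eq (by ring)) hvpos
  have h4 : B * M.delta c θ * s y ≤ max q (1 / 2) * s y :=
    mul_le_mul_of_nonneg_right ((hδ c θ hadm).trans (le_max_left _ _)) (hs y).le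
  exact absurd (hcs y) (not_lt.2 (h3.trans h4))

/-- The unbounded iterates of the operator with constant gain `g` would, after normalisation, have
a limit that grows faster than the Perron-Frobenius values permit. -/
theorem bddAbove_iterate [Nonempty 𝕏] (hirr : (transitionMatrix M.P).IsIrreducible)
    (hreg : M.IsRegularChoice I J) (hfeas : M.Feasible I J) (hρ : M.ρ < 1)
    {q : ℝ} (hq : q < 1)
    (hsup : ∀ c θ, (c, θ) ∈ admissible I J → M.β * M.delta c θ ^ (1 - M.ρ) ≤ q)
    {g : ℝ} (hg : 0 < g) {us : ℕ → 𝕏 → ℝ} (hus0 : ∀ m x, 0 ≤ us m x)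
    (hmono : ∀ x, Monotone fun m => us m x)
    (hus : ∀ m x, us (m + 1) x = M.opW I J (fun _ _ => g) (us m) x) :
    ∃ K, ∀ m x, us m x ≤ K := by
  by_contra! hunb
  have hβ := M.β_pos
  have hβ1 := M.β_lt_one
  set r := 1 - M.ρ with hr_def
  have hr : 0 < r := by linarith
  set s : 𝕏 → ℝ := fun x => sSup ((fun c => 1 - c) '' I x) with hs_def
  have hbdd : ∀ x, BddAbove ((fun c => 1 - c) '' I x) := fun x =>
    ⟨1, by rintro _ ⟨c, hc, rfl⟩; linarith [(hreg.subset_I x hc).1]⟩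
  have hs : ∀ x, 0 < s x := fun x => by
    obtain ⟨c, hc⟩ := hreg.nonempty_I x
    exact (sub_pos.2 (hreg.subset_I x hc).2).trans_le (le_csSup (hbdd x) ⟨c, hc, rfl⟩)
  set N : ℕ → ℝ := fun m => Finset.univ.sup' Finset.univ_nonempty (us m) with hN_def
  have hN : ∀ m x, us m x ≤ N m := fun m x => Finset.le_sup' (us m) (Finset.mem_univ x)
  have hNtop : Tendsto N atTop atTop := by
    refine tendsto_atTop.2 fun K => ?_
    obtain ⟨m, x, h⟩ := hunb K
    filter_upwards [eventually_ge_atTop m] with m' hm'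
    exact h.le.trans ((hmono x hm').trans (hN m' x))
  have hch : ∀ m x, ∃ ϑ ∈ J x, IsMaxOn (fun ϑ => g + M.contValue ϑ (us m) x) (J x) ϑ := fun m x =>
    hreg.exists_isMaxOn (G := fun _ _ => g) continuous_const (hus0 m)
  choose θs hθs hmax using hch
  have hN0 : ∀ m, 0 ≤ N m := fun m => by
    obtain ⟨x⟩ := ‹Nonempty 𝕏›
    exact (hus0 m x).trans (hN m x)
  -- a convergent subsequence of the normalised iterates and of the optimal portfolios
  set vs : ℕ → 𝕏 → ℝ := fun m x => (N m)⁻¹ * us m x with hvs_def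
  have hvs0 : ∀ m x, 0 ≤ vs m x := fun m x => mul_nonneg (inv_nonneg.2 (hN0 m)) (hus0 m x)
  have hmem : ∀ m, (vs m, θs m) ∈
      (Set.univ.pi fun _ : 𝕏 => Set.Icc (0 : ℝ) 1) ×ˢ (Set.univ.pi fun x => J x) := fun m => by
    refine ⟨fun x _ => ⟨hvs0 m x, ?_⟩, fun x _ => hθs m x⟩
    exact inv_mul_le_one_of_le₀ (hN m x) (hN0 m)
  obtain ⟨⟨v, θ⟩, ⟨hv, hθ⟩, φ, hφ, hlim⟩ := ((isCompact_univ_pi fun _ => isCompact_Icc).prod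
    (isCompact_univ_pi hreg.compact_J)).tendsto_subseq hmem
  have hlimv : Tendsto (fun m => vs (φ m)) atTop (𝓝 v) := (continuous_fst.tendsto _).comp hlim
  have hlimθ : Tendsto (fun m => θs (φ m)) atTop (𝓝 θ) := (continuous_snd.tendsto _).comp hlim
  have hNφ : Tendsto (fun m => N (φ m)) atTop atTop := hNtop.comp hφ.tendsto_atTop
  have hNinv : Tendsto (fun m => (N (φ m))⁻¹) atTop (𝓝 0) := tendsto_inv_atTop_zero.comp hNφ
  have hθ' : ∀ x, θ x ∈ J x := fun x => hθ x (Set.mem_univ x)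
  set B : ℝ := M.β ^ (1 / r) with hB_def
  have hB : 0 < B := Real.rpow_pos_of_pos hβ _
  have hq0 : ∀ c θ, (c, θ) ∈ admissible I J → 0 < M.delta c θ := fun c θ hadm =>
    (exists_eigenfunction hirr (hreg.mem_Ioo hadm) (hreg.isRegular hadm) (hfeas c θ hadm).2.1).1
  have hBδ : ∀ c θ, (c, θ) ∈ admissible I J → B * M.delta c θ ≤ (max q 0) ^ (1 / r) := by
    intro c θ hadm
    have h1 := hq0 c θ hadm
    have h2 : B * M.delta c θ = (M.β * M.delta c θ ^ r) ^ (1 / r) := by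
      rw [Real.mul_rpow hβ.le (Real.rpow_nonneg h1.le _), ← Real.rpow_mul h1.le,
        mul_one_div_cancel hr.ne', Real.rpow_one]
    rw [h2]
    exact Real.rpow_le_rpow (mul_nonneg hβ.le (Real.rpow_nonneg h1.le _))
      ((hsup c θ hadm).trans (le_max_left _ _)) (one_div_nonneg.2 hr.le)
  have hq1 : (max q 0) ^ (1 / r) < 1 :=
    Real.rpow_lt_one (le_max_right _ _) (max_lt hq one_pos) (one_div_pos.2 hr)
  -- the normalised recursion, solved for the certainty equivalent
  have hrec : ∀ m x, 0 < N m →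
      (max ((vs m x ^ r - (1 - M.β) * (N m)⁻¹ ^ r) / M.β) 0) ^ (1 / r) / s x - (N m)⁻¹ * g ≤
        M.contValue (θs m x) (vs m) x := by
    intro m x hNm
    have hi := inv_pos.2 hNm
    have hcv : M.contValue (θs m x) (vs m) x = (N m)⁻¹ * M.contValue (θs m x) (us m) x :=
      M.contValue_const_mul _ _ _ hi
    have hA0 := M.contValue_nonneg (θs m x) (us m) x
    have hA0' := M.contValue_nonneg (θs m x) (vs m) x
    have h1 : us m x ≤ aggregator M.β M.ρ 1 (s x * (g + M.contValue (θs m x) (us m) x)) := by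
      calc us m x ≤ us (m + 1) x := hmono x (Nat.le_succ m)
        _ = _ := hus m x
        _ ≤ _ := by
          refine consValue_le (hreg.nonempty_I x) fun c hc => ?_
          rw [bestValue_eq_of_isMaxOn (G := fun _ _ => g) (hθs m x) (hmax m x)]
          obtain ⟨hc0, hc1⟩ := hreg.subset_I x hc
          exact aggregator_mono hβ hβ1 M.ρ_pos hc0.le (mul_nonneg (by linarith) (by linarith))
            hc1.le (mul_le_mul_of_nonneg_right (le_csSup (hbdd x) ⟨c, hc, rfl⟩) (by linarith))
    have hz0 : 0 ≤ s x * ((N m)⁻¹ * g + M.contValue (θs m x) (vs m) x) :=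
      mul_nonneg (hs x).le (by positivity)
    have h2 : vs m x ≤ aggregator M.β M.ρ (N m)⁻¹
        (s x * ((N m)⁻¹ * g + M.contValue (θs m x) (vs m) x)) := by
      calc vs m x ≤ (N m)⁻¹ * aggregator M.β M.ρ 1 (s x * (g + M.contValue (θs m x) (us m) x)) :=
            mul_le_mul_of_nonneg_left h1 hi.le
        _ = _ := by
          rw [← aggregator_mul hβ hβ1 hi zero_le_one (mul_nonneg (hs x).le (by linarith)), mul_one,
            hcv]
          congr 1
          ring
    simp only [aggregator, not_le.2 hρ, false_and, if_false, hρ.ne] at h2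
    rw [← hr_def] at h2
    set z := s x * ((N m)⁻¹ * g + M.contValue (θs m x) (vs m) x)
    have p1 := Real.rpow_nonneg hi.le r
    have p2 := Real.rpow_nonneg hz0 r
    have hb0 : 0 ≤ 1 - M.β := by linarith
    have h3 : vs m x ^ r ≤ (1 - M.β) * (N m)⁻¹ ^ r + M.β * z ^ r := by
      have := Real.rpow_le_rpow (hvs0 m x) h2 hr.le
      rwa [← Real.rpow_mul (by positivity), one_div_mul_cancel hr.ne', Real.rpow_one] at this
    have h4 : max ((vs m x ^ r - (1 - M.β) * (N m)⁻¹ ^ r) / M.β) 0 ≤ z ^ r :=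
      max_le ((div_le_iff₀ hβ).2 (by linarith)) p2
    have h5 := Real.rpow_le_rpow (le_max_right _ _) h4 (one_div_nonneg.2 hr.le)
    rw [← Real.rpow_mul hz0, mul_one_div_cancel hr.ne', Real.rpow_one] at h5
    have h6 := (div_le_iff₀' (hs x)).2 h5
    linarith
  have hineq : ∀ x, v x ≤ B * s x * M.contValue (θ x) v x := by
    intro x
    obtain ⟨m₀, hm₀⟩ := eventually_atTop.1 (hNφ.eventually_gt_atTop 0)
    have hvx := tendsto_pi_nhds.1 hlimv x
    have hv0 : 0 ≤ v x := (hv x (Set.mem_univ x)).1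
    have hb : Tendsto (fun m => (max ((vs (φ m) x ^ r - (1 - M.β) * (N (φ m))⁻¹ ^ r) / M.β) 0) ^
        (1 / r) / s x - (N (φ m))⁻¹ * g) atTop
        (𝓝 ((max ((v x ^ r - (1 - M.β) * 0 ^ r) / M.β) 0) ^ (1 / r) / s x - 0 * g)) := by
      have e1 := (hvx.rpow_const (p := r) (Or.inr hr.le)).sub
        ((hNinv.rpow_const (p := r) (Or.inr hr.le)).const_mul (1 - M.β))
      have e2 := ((e1.div_const M.β).max (tendsto_const_nhds (x := (0 : ℝ)))).rpow_const
        (p := 1 / r) (Or.inr (one_div_nonneg.2 hr.le))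
      exact (e2.div_const (s x)).sub (hNinv.mul_const g)
    rw [Real.zero_rpow hr.ne', mul_zero, sub_zero, zero_mul, sub_zero, max_eq_left
      (div_nonneg (Real.rpow_nonneg hv0 _) hβ.le), Real.div_rpow (Real.rpow_nonneg hv0 _) hβ.le,
      ← Real.rpow_mul hv0, mul_one_div_cancel hr.ne', Real.rpow_one, ← hB_def] at hb
    have h1 := le_contValue_of_tendsto (M := M) (x := x) (ϑ := θ x)
      (ϑs := fun m => θs (φ (m + m₀)) x) (Φs := fun m => vs (φ (m + m₀)))
      (fun m => hreg.regular x _ (hθs _ x))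
      ((tendsto_add_atTop_iff_nat m₀).2 (tendsto_pi_nhds.1 hlimθ x))
      (fun m => hvs0 _) ((tendsto_add_atTop_iff_nat (f := fun m => vs (φ m)) m₀).2 hlimv)
      ((tendsto_add_atTop_iff_nat m₀).2 hb)
      (fun m => hrec _ x (hm₀ _ (Nat.le_add_left _ _)))
    rw [div_div, div_le_iff₀ (mul_pos hB (hs x))] at h1
    linarith
  have hnonpos := nonpos_of_le_contValue hirr hreg hfeas hB hq1 hBδ hθ' hineq
  -- the limit has maximum `1`
  have hsupv : Tendsto (fun m => Finset.univ.sup' Finset.univ_nonempty (vs (φ m))) atTop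
      (𝓝 (Finset.univ.sup' Finset.univ_nonempty v)) :=
    Tendsto.finset_sup'_nhds_apply (f := fun x m => vs (φ m) x) _ fun x _ =>
      tendsto_pi_nhds.1 hlimv x
  have hone : ∀ᶠ m in atTop, 1 ≤ Finset.univ.sup' Finset.univ_nonempty (vs (φ m)) := by
    filter_upwards [hNφ.eventually_gt_atTop 0] with m hm
    obtain ⟨x, -, hx⟩ := Finset.exists_mem_eq_sup' Finset.univ_nonempty (us (φ m))
    have : vs (φ m) x = 1 := by
      rw [hvs_def, hN_def]
      simp only
      rw [← hx]
      exact inv_mul_cancel₀ hm.ne'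
    rw [← this]
    exact Finset.le_sup' (vs (φ m)) (Finset.mem_univ x)
  have h1 := ge_of_tendsto hsupv hone
  have h2 : Finset.univ.sup' Finset.univ_nonempty v ≤ 0 := Finset.sup'_le _ _ fun x _ => hnonpos x
  linarith

/-- The operator with constant gain `g` has a positive supersolution. -/
theorem exists_supersolution [Nonempty 𝕏] (hirr : (transitionMatrix M.P).IsIrreducible)
    (hreg : M.IsRegularChoice I J) (hfeas : M.Feasible I J) {q : ℝ} (hq : q < 1)
    (hsup : ∀ c θ, (c, θ) ∈ admissible I J → M.β * M.delta c θ ^ (1 - M.ρ) ≤ q)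
    {g : ℝ} (hg : 0 < g) :
    ∃ u : 𝕏 → ℝ, (∀ x, 0 < u x) ∧ ∀ x, M.opW I J (fun _ _ => g) u x ≤ u x := by
  rcases le_or_gt 1 M.ρ with hρ | hρ
  · exact exists_supersolution_of_one_le hreg hρ hg
  set V := M.opW I J (fun _ _ => g) with hV
  have hbest : ∀ {Φ : 𝕏 → ℝ}, (∀ x, 0 ≤ Φ x) → ∀ x, 0 < M.bestValue J (fun _ _ => g) Φ x :=
    fun hΦ x => by
      obtain ⟨ϑ, hϑ⟩ := hreg.nonempty_J x
      exact (add_pos_of_pos_of_nonneg hg (M.contValue_nonneg _ _ _)).trans_le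
        (hreg.le_bestValue (G := fun _ _ => g) continuous_const hΦ hϑ)
  have h0 : ∀ m x, 0 ≤ V^[m] (fun _ => 0) x := by
    intro m
    induction m with
    | zero => exact fun x => le_rfl
    | succ m ih =>
      intro x
      rw [Function.iterate_succ_apply']
      exact hreg.opW_nonneg (hbest ih x).le
  have hstep : ∀ m x, V^[m] (fun _ => 0) x ≤ V^[m + 1] (fun _ => 0) x := by
    intro m
    induction m with
    | zero => exact fun x => h0 1 x
    | succ m ih =>
      intro x
      rw [Function.iterate_succ_apply', Function.iterate_succ_apply' V (m + 1)]
      exact hreg.opW_mono continuous_const (h0 m) ih (hbest (h0 m) x).le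
  have hmono : ∀ x, Monotone fun m => V^[m] (fun _ => 0) x := fun x =>
    monotone_nat_of_le_succ fun m => hstep m x
  obtain ⟨K, hK⟩ := bddAbove_iterate hirr hreg hfeas hρ hq hsup hg h0 hmono
    (fun m x => by rw [Function.iterate_succ_apply'])
  -- the bounded increasing iterates converge to a fixed point
  have hbdd : ∀ x, BddAbove (Set.range fun m => V^[m] (fun _ => 0) x) := fun x =>
    ⟨K, by rintro _ ⟨m, rfl⟩; exact hK m x⟩
  set u : 𝕏 → ℝ := fun x => ⨆ m, V^[m] (fun _ => 0) x
  have hlim : Tendsto (fun m => V^[m] fun _ => 0) atTop (𝓝 u) :=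
    tendsto_pi_nhds.2 fun x => tendsto_atTop_ciSup (hmono x) (hbdd x)
  have hu : ∀ x, 0 < u x := fun x => by
    refine lt_of_lt_of_le ?_ (le_ciSup (hbdd x) 1)
    exact hreg.opW_pos (hbest (fun _ => le_rfl) x)
  refine ⟨u, hu, fun x => le_of_eq (congrFun ?_ x)⟩
  have h1 := hreg.tendsto_opW (G := fun _ _ => g) (fun _ => continuous_const) hu
    (hbest fun x => (hu x).le) h0 hlim
  refine tendsto_nhds_unique h1 ?_
  refine ((tendsto_add_atTop_iff_nat 1).2 hlim).congr fun m => ?_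
  rw [Function.iterate_succ_apply']

end Model

/-! ### Subsolutions -/

namespace Model

/-- The condition `β δ ^ (1 - ρ) < 1` makes small multiples of an eigenfunction with eigenvalue `δ`
subsolutions. -/
theorem eventually_le_aggregator {β ρ c w δ : ℝ} (hβ : 0 < β) (hβ1 : β < 1) (hc : 0 < c)
    (hw : 0 < w) (hδ : 0 < δ) (h : β * δ ^ (1 - ρ) < 1) :
    ∀ᶠ t in 𝓝[>] (0 : ℝ), t * w ≤ aggregator β ρ c (t * (δ * w)) := by
  have hlim : Tendsto (fun t : ℝ => t * w) (𝓝[>] 0) (𝓝[>] 0) := by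
    refine tendsto_nhdsWithin_iff.2 ⟨?_, ?_⟩
    · have := ((continuous_id.mul continuous_const).tendsto (0 : ℝ) (f := fun t : ℝ => t * w))
      rw [zero_mul] at this
      exact this.mono_left nhdsWithin_le_nhds
    · filter_upwards [self_mem_nhdsWithin] with t (ht : 0 < t) using mul_pos ht hw
  suffices hsuff : ∀ᶠ a in 𝓝[>] (0 : ℝ), a ≤ aggregator β ρ c (a * δ) by
    filter_upwards [hlim.eventually hsuff] with t ht
    rwa [mul_assoc, mul_comm w δ] at ht
  have hβ' : 0 < 1 - β := by linarith
  rcases lt_trichotomy ρ 1 with hρ | rfl | hρ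
  · have hr : 0 < 1 - ρ := by linarith
    have hpos : 0 < ((1 - β) * c ^ (1 - ρ)) ^ (1 / (1 - ρ)) :=
      Real.rpow_pos_of_pos (mul_pos hβ' (Real.rpow_pos_of_pos hc _)) _
    filter_upwards [self_mem_nhdsWithin, nhdsWithin_le_nhds (gt_mem_nhds hpos)]
      with a (ha : 0 < a) ha'
    refine ha'.le.trans ?_
    simp only [aggregator, not_le.2 hρ, false_and, if_false, hρ.ne]
    have p1 := Real.rpow_pos_of_pos hc (1 - ρ)
    refine Real.rpow_le_rpow (by positivity) ?_ (one_div_nonneg.2 hr.le)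
    exact le_add_of_nonneg_right (mul_nonneg hβ.le (Real.rpow_nonneg (by positivity) _))
  · have hev := Real.tendsto_log_nhdsGT_zero.eventually_le_atBot
      (((1 - β) * Real.log c + β * Real.log δ) / (1 - β))
    filter_upwards [self_mem_nhdsWithin, hev] with a (ha : 0 < a) ha'
    have h1 : ¬ (c = 0 ∨ a * δ = 0) := by
      rintro (h | h)
      · exact hc.ne' h
      · exact (mul_pos ha hδ).ne' h
    simp only [aggregator, le_refl, true_and, h1, if_false, if_true]
    rw [Real.log_mul ha.ne' hδ.ne']
    rw [le_div_iff₀ hβ'] at ha'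
    calc a = Real.exp (Real.log a) := (Real.exp_log ha).symm
      _ ≤ _ := Real.exp_le_exp.2 (by linarith)
  · have hr : 0 < ρ - 1 := by linarith
    have hev := (tendsto_rpow_neg_nhdsGT_zero (y := 1 - ρ) (by linarith)).eventually_ge_atTop
      ((1 - β) * c ^ (1 - ρ) / (1 - β * δ ^ (1 - ρ)))
    filter_upwards [self_mem_nhdsWithin, hev] with a (ha : 0 < a) ha'
    have h1 : ¬ (c = 0 ∨ a * δ = 0) := by
      rintro (h | h)
      · exact hc.ne' h
      · exact (mul_pos ha hδ).ne' h
    simp only [aggregator, h1, and_false, if_false, hρ.ne']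
    rw [div_le_iff₀ (by linarith)] at ha'
    have p1 := Real.rpow_pos_of_pos hc (1 - ρ)
    have p2 := Real.rpow_pos_of_pos (mul_pos ha hδ) (1 - ρ)
    have h2 : (1 - β) * c ^ (1 - ρ) + β * (a * δ) ^ (1 - ρ) ≤ a ^ (1 - ρ) := by
      rw [Real.mul_rpow ha.le hδ.le]
      linarith
    have h3 := Real.rpow_le_rpow_of_nonpos (by positivity) h2
      (z := 1 / (1 - ρ)) (one_div_nonpos.2 (by linarith))
    rwa [← Real.rpow_mul ha.le, mul_one_div_cancel (by linarith), Real.rpow_one] at h3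

variable {𝕏 𝕐 : Type*} [MeasurableSpace 𝕏] [MeasurableSpace 𝕐] {n : ℕ} {M : Model 𝕏 𝕐 n}
  {I : 𝕏 → Set ℝ} {J : 𝕏 → Set (Fin n → ℝ)} {c : 𝕏 → ℝ} {θ : 𝕏 → Fin n → ℝ} {x : 𝕏} {Φ : 𝕏 → ℝ}

/-- At `Φ` the operator of a policy that is optimal at `Φ` agrees with `𝕎`. -/
theorem IsMaximizer.policyOp_eq (hadm : (c, θ) ∈ admissible I J) (h : M.IsMaximizer I J Φ c θ) :
    M.policyOp c θ Φ = M.W I J Φ := by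
  funext x
  have h1 : M.maxD J Φ x = M.D Φ x (θ x) := bestValue_eq_of_isMaxOn (hadm x).2 (h x).1
  have h2 : M.W I J Φ x = M.H (c x) ((1 - c x) * M.maxD J Φ x) :=
    consValue_eq_of_isMaxOn (hadm x).1 (h x).2
  rw [h2, h1]
  rfl

variable [Fintype 𝕏] [MeasurableSingletonClass 𝕏]

theorem IsRegularChoice.policyOp_le_W (h : M.IsRegularChoice I J)
    (hadm : (c, θ) ∈ admissible I J) (hΦ : Φ ∈ M.domW J) (hD : 0 ≤ M.D Φ x (θ x)) :
    M.policyOp c θ Φ x ≤ M.W I J Φ x := by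
  have hc := h.mem_Ioo hadm x
  have h1 := (sub_pos.2 hc.2).le
  exact (aggregator_mono M.β_pos M.β_lt_one M.ρ_pos hc.1.le (mul_nonneg h1 hD) le_rfl
    (mul_le_mul_of_nonneg_left (h.D_le_maxD hΦ.1 (hadm x).2) h1)).trans
      (le_consValue M.β_pos M.β_lt_one M.ρ_pos (h.subset_I x) (hadm x).1 (hΦ.2 x))

/-- With nonnegative gain-loss utilities, the small multiples of the Perron-Frobenius eigenfunction
of any policy are subsolutions. -/
theorem exists_subsolution [Nonempty 𝕏] (hirr : (transitionMatrix M.P).IsIrreducible)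
    (hreg : M.IsRegularChoice I J) (hfeas : M.Feasible I J)
    (hg : ∀ x, ∀ ϑ ∈ J x, 0 ≤ M.gainLoss x ϑ) :
    ∃ Ψ : 𝕏 → ℝ, (∀ x, 0 < Ψ x) ∧
      ∀ᶠ t in 𝓝[>] (0 : ℝ), ∀ x, t * Ψ x ≤ M.W I J (fun y => t * Ψ y) x := by
  choose c hc using hreg.nonempty_I
  choose θ hθ using hreg.nonempty_J
  have hadm : (c, θ) ∈ admissible I J := fun x => ⟨hc x, hθ x⟩
  obtain ⟨-, hint, hlt, -⟩ := hfeas c θ hadm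
  have hc' := hreg.mem_Ioo hadm
  obtain ⟨hδ, Ψ, hΨ, heig⟩ := exists_eigenfunction hirr hc' (hreg.isRegular hadm) hint
  refine ⟨Ψ, hΨ, ?_⟩
  filter_upwards [self_mem_nhdsWithin, eventually_all.2 fun x =>
    eventually_le_aggregator M.β_pos M.β_lt_one (hc' x).1 (hΨ x) hδ hlt] with t (ht : 0 < t) h x
  have hDg : ∀ Υ y ϑ, ϑ ∈ J y → 0 ≤ M.D Υ y ϑ := fun Υ y ϑ hϑ =>
    (hg y ϑ hϑ).trans (gainLoss_le_D _ _ _)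
  have hΨt : ∀ x, 0 ≤ t * Ψ x := fun x => (mul_pos ht (hΨ x)).le
  have hdom : (fun y => t * Ψ y) ∈ M.domW J := by
    refine ⟨hΨt, fun y => ?_⟩
    exact (hDg _ y _ (hθ y)).trans (hreg.D_le_maxD hΨt (hθ y))
  refine (h x).trans (le_trans ?_ (hreg.policyOp_le_W hadm hdom (hDg _ x _ (hθ x))))
  refine aggregator_mono M.β_pos M.β_lt_one M.ρ_pos (hc' x).1.le
    (mul_nonneg ht.le (mul_nonneg hδ.le (hΨ x).le)) le_rfl ?_
  rw [← heig x, D_eq, contValue_const_mul _ _ _ _ ht, mul_add, mul_left_comm]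
  exact le_add_of_nonneg_left (mul_nonneg (sub_pos.2 (hc' x).2).le (hg x _ (hθ x)))

/-! ### Uniqueness -/

theorem IsRegularChoice.exists_isMaximizer (h : M.IsRegularChoice I J) (hΦ : ∀ x, 0 ≤ Φ x)
    (hpos : ∀ x, 0 < M.maxD J Φ x) :
    ∃ c θ, (c, θ) ∈ admissible I J ∧ M.IsMaximizer I J Φ c θ := by
  have h1 : ∀ x, ∃ ϑ ∈ J x, IsMaxOn (M.D Φ x) (J x) ϑ := fun x =>
    h.exists_isMaxOn (continuous_gainLoss x) hΦ
  have h2 : ∀ x, ∃ c ∈ I x, IsMaxOn (fun c' => M.H c' ((1 - c') * M.maxD J Φ x)) (I x) c :=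
    fun x => by
      obtain ⟨C, hC, hIC⟩ := h.closed_I x
      exact exists_isMaxOn_consumption M.β_pos M.β_lt_one M.ρ_pos (h.nonempty_I x) hC hIC (hpos x)
  choose θ hθ hθ' using h1
  choose c hc hc' using h2
  exact ⟨c, θ, fun x => ⟨hc x, hθ x⟩, fun x => ⟨hθ' x, hc' x⟩⟩

/-- A positive fixed point lies below every other one: the policy that is optimal at the first one
has it as a fixed point and the second one as a supersolution. -/
theorem fixedPoint_le [Nonempty 𝕏] (hreg : M.IsRegularChoice I J) (hfeas : M.Feasible I J)
    {Ψ : 𝕏 → ℝ} (hΦ0 : ∀ x, 0 < Φ x) (hΦdom : Φ ∈ M.domW J) (hΦ : M.W I J Φ = Φ)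
    (hpos : ∀ x, 0 < M.maxD J Φ x) (hΨ0 : ∀ x, 0 < Ψ x) (hΨdom : Ψ ∈ M.domW J)
    (hΨ : M.W I J Ψ = Ψ) (x : 𝕏) : Φ x ≤ Ψ x := by
  obtain ⟨c, θ, hadm, hmax⟩ := hreg.exists_isMaximizer (fun x => (hΦ0 x).le) hpos
  have hc := hreg.mem_Ioo hadm
  have hθ := hreg.isRegular hadm
  have hVΦ : M.policyOp c θ Φ = Φ := (hmax.policyOp_eq hadm).trans hΦ
  have hge : ∀ {Υ : 𝕏 → ℝ}, Υ ∈ M.domW J → M.W I J Υ = Υ → ∀ x, M.phiZero I J x ≤ Υ x :=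
    fun hdom h x => (hreg.phiZero_le_W hdom x).trans_eq (congrFun h x)
  have hVΨ : ∀ x, M.policyOp c θ Ψ x ≤ Ψ x := fun x =>
    (hreg.policyOp_le_W hadm hΨdom ((D_phiZero_nonneg hreg hfeas (hadm x).2).trans
      ((hθ x).D_mono (hge hΨdom hΨ)))).trans_eq (congrFun hΨ x)
  rcases feasible_dichotomy hc hθ (hfeas c θ hadm).2.2.2 with hg | ⟨hD, m, hm⟩
  · exact le_of_policyOp_of_nonneg hc hθ hg hΦ0 hVΦ hΨ0 hVΨ x
  · have hF := hreg.policyZero_le_phiZero hadm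
    exact le_of_policyOp_of_lt_iterate hc hθ (policyZero_nonneg hc) hD
      (fun x => policyZero_le_policyOp hc (hD x)) hm
      (fun x => (hF x).trans (hge hΦdom hΦ x)) hVΦ (fun x => (hF x).trans (hge hΨdom hΨ x)) hVΨ x

/-! ### Convergence -/

/-- If the gains are at most a constant `g`, then `𝕎` is below the operator with constant gains
`g`, also after scaling the argument up. -/
theorem W_mul_le (hreg : M.IsRegularChoice I J) {g l : ℝ} (hg : 0 < g)
    (hgK : ∀ x, ∀ ϑ ∈ J x, M.gainLoss x ϑ ≤ g) (hl : 1 ≤ l) {u : 𝕏 → ℝ} (hu : ∀ x, 0 < u x)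
    (x : 𝕏) (h0 : 0 ≤ M.maxD J (fun x => l * u x) x) :
    M.W I J (fun x => l * u x) x ≤ l * M.opW I J (fun _ _ => g) u x := by
  have hl0 : 0 < l := one_pos.trans_le hl
  have hbest : ∀ ϑ ∈ J x, g + M.contValue ϑ u x ≤ M.bestValue J (fun _ _ => g) u x :=
    fun ϑ hϑ => hreg.le_bestValue (G := fun _ _ => g) continuous_const (fun y => (hu y).le) hϑ
  have hbest0 : 0 ≤ M.bestValue J (fun _ _ => g) u x := by
    obtain ⟨ϑ, hϑ⟩ := hreg.nonempty_J x
    exact (add_nonneg hg.le (M.contValue_nonneg _ _ _)).trans (hbest ϑ hϑ)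
  have hle : M.bestValue J M.gainLoss (fun y => l * u y) x ≤
      l * M.bestValue J (fun _ _ => g) u x := by
    refine hreg.bestValue_le fun ϑ hϑ => ?_
    rw [M.contValue_const_mul ϑ u x hl0]
    have h2 := mul_le_mul_of_nonneg_left (hbest ϑ hϑ) hl0.le
    have h3 : g ≤ l * g := le_mul_of_one_le_left hg.le hl
    linarith [hgK x ϑ hϑ]
  exact (consValue_mono M.β_pos M.β_lt_one M.ρ_pos (hreg.subset_I x) (hreg.nonempty_I x)
    h0 hle).trans (consValue_mul_le M.β_pos M.β_lt_one M.ρ_pos (hreg.subset_I x)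
      (hreg.nonempty_I x) hbest0 hl)

/-- The large multiples of a supersolution for constant gains are supersolutions of `𝕎`. -/
theorem exists_supersolution_above [Nonempty 𝕏] (hirr : (transitionMatrix M.P).IsIrreducible)
    (hreg : M.IsRegularChoice I J) (hfeas : M.Feasible I J) {q : ℝ} (hq : q < 1)
    (hsup : ∀ c θ, (c, θ) ∈ admissible I J → M.β * M.delta c θ ^ (1 - M.ρ) ≤ q)
    (hΦ : Φ ∈ M.domW J) :
    ∃ U : 𝕏 → ℝ, U ∈ M.domW J ∧ (∀ x, Φ x ≤ U x) ∧ ∀ x, M.W I J U x ≤ U x := by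
  have hbdd : ∀ x, ∃ K, ∀ ϑ ∈ J x, M.gainLoss x ϑ ≤ K := fun x => by
    obtain ⟨K, hK⟩ := (hreg.compact_J x).bddAbove_image
      (continuous_gainLoss (M := M) x).continuousOn
    exact ⟨K, fun ϑ hϑ => hK ⟨ϑ, hϑ, rfl⟩⟩
  choose K hK using hbdd
  obtain ⟨x₁, hx₁⟩ := Finite.exists_max K
  set g := max (K x₁) 1
  have hg : 0 < g := one_pos.trans_le (le_max_right _ _)
  have hgK : ∀ x, ∀ ϑ ∈ J x, M.gainLoss x ϑ ≤ g := fun x ϑ hϑ =>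
    (hK x ϑ hϑ).trans ((hx₁ x).trans (le_max_left _ _))
  obtain ⟨u, hu, hWu⟩ := exists_supersolution hirr hreg hfeas hq hsup hg
  obtain ⟨x₂, hx₂⟩ := Finite.exists_max fun x => Φ x / u x
  set l := max 1 (Φ x₂ / u x₂)
  have hl1 : 1 ≤ l := le_max_left _ _
  have hl : 0 < l := one_pos.trans_le hl1
  have hΦU : ∀ x, Φ x ≤ l * u x := fun x =>
    (div_le_iff₀ (hu x)).1 ((hx₂ x).trans (le_max_right _ _))
  have hdom := hreg.mem_domW_of_le hΦ hΦU
  refine ⟨fun x => l * u x, hdom, hΦU, fun x => ?_⟩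
  exact (W_mul_le hreg hg hgK hl1 hu x (hdom.2 x)).trans
    (mul_le_mul_of_nonneg_left (hWu x) hl.le)

/-- Limits of iterates are fixed points, if they are positive with a positive continuation
value. -/
theorem W_eq_of_tendsto [Nonempty 𝕏] (hreg : M.IsRegularChoice I J) (hfeas : M.Feasible I J)
    (hΦ : Φ ∈ M.domW J) {Υ : 𝕏 → ℝ} (hΥ : ∀ x, 0 < Υ x) (hpos : ∀ x, 0 < M.maxD J Υ x)
    (hlim : Tendsto (fun m => (M.W I J)^[m] Φ) atTop (𝓝 Υ)) : M.W I J Υ = Υ := by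
  have h1 := hreg.tendsto_opW (fun x => continuous_gainLoss (M := M) x) hΥ hpos
    (fun m => (iterate_mem_domW hreg hfeas hΦ m).1) hlim
  refine tendsto_nhds_unique h1 (((tendsto_add_atTop_iff_nat 1).2 hlim).congr fun m => ?_)
  rw [Function.iterate_succ_apply']
  rfl

/-- Every start above a subsolution `L` with a positive iterate leads to a positive fixed point:
the iterates are squeezed between those of `L` and those of a supersolution, which converge
monotonically. -/
theorem exists_tendsto_iterate [Nonempty 𝕏] (hirr : (transitionMatrix M.P).IsIrreducible)
    (hreg : M.IsRegularChoice I J) (hfeas : M.Feasible I J) {q : ℝ} (hq : q < 1)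
    (hsup : ∀ c θ, (c, θ) ∈ admissible I J → M.β * M.delta c θ ^ (1 - M.ρ) ≤ q)
    {L : 𝕏 → ℝ} (hL : L ∈ M.domW J) (hLW : ∀ x, L x ≤ M.W I J L x) {m : ℕ}
    (hm : ∀ x, 0 < M.maxD J ((M.W I J)^[m] L) x) (hLΦ : ∀ x, L x ≤ Φ x) :
    ∃ Υ : 𝕏 → ℝ, (∀ x, 0 < Υ x) ∧ Υ ∈ M.domW J ∧ M.W I J Υ = Υ ∧
      Tendsto (fun m => (M.W I J)^[m] Φ) atTop (𝓝 Υ) := by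
  have hΦ := hreg.mem_domW_of_le hL hLΦ
  obtain ⟨U, hU, hΦU, hWU⟩ := exists_supersolution_above hirr hreg hfeas hq hsup hΦ
  set W := M.W I J with hW
  have hLU : ∀ j x, W^[j] L x ≤ W^[j] U x :=
    iterate_mono hreg hfeas hL fun x => (hLΦ x).trans (hΦU x)
  have hLmono : ∀ x, Monotone fun j => W^[j] L x := fun x => monotone_nat_of_le_succ fun j => by
    rw [Function.iterate_succ_apply]
    exact iterate_mono hreg hfeas hL hLW j x
  have hUanti : ∀ x, Antitone fun j => W^[j] U x := fun x => antitone_nat_of_succ_le fun j => by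
    rw [Function.iterate_succ_apply]
    exact iterate_mono hreg hfeas (W_mem_domW hreg hfeas hU) hWU j x
  have hLbdd : ∀ x, BddAbove (Set.range fun j => W^[j] L x) := fun x =>
    ⟨U x, by rintro _ ⟨j, rfl⟩; exact (hLU j x).trans (hUanti x (Nat.zero_le j))⟩
  have hUbdd : ∀ x, BddBelow (Set.range fun j => W^[j] U x) := fun x =>
    ⟨L x, by rintro _ ⟨j, rfl⟩; exact (hLmono x (Nat.zero_le j)).trans (hLU j x)⟩
  set Υ : 𝕏 → ℝ := fun x => ⨆ j, W^[j] L x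
  set Υ' : 𝕏 → ℝ := fun x => ⨅ j, W^[j] U x
  -- both monotone limits are fixed points, so they agree
  have hlim : Tendsto (fun j => W^[j] L) atTop (𝓝 Υ) :=
    tendsto_pi_nhds.2 fun x => tendsto_atTop_ciSup (hLmono x) (hLbdd x)
  have hlim' : Tendsto (fun j => W^[j] U) atTop (𝓝 Υ') :=
    tendsto_pi_nhds.2 fun x => tendsto_atTop_ciInf (hUanti x) (hUbdd x)
  have hle : ∀ j x, W^[j] L x ≤ Υ x := fun j x => le_ciSup (hLbdd x) j
  have hΥΥ' : ∀ x, Υ x ≤ Υ' x := fun x =>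
    le_of_tendsto_of_tendsto' (tendsto_pi_nhds.1 hlim x) (tendsto_pi_nhds.1 hlim' x)
      fun j => hLU j x
  have hLm := iterate_mem_domW hreg hfeas hL m
  have hpos : ∀ x, 0 < Υ x := fun x => by
    refine lt_of_lt_of_le ?_ (hle (m + 1) x)
    rw [Function.iterate_succ_apply']
    exact hreg.opW_pos (hm x)
  have hpos' : ∀ x, 0 < Υ' x := fun x => (hpos x).trans_le (hΥΥ' x)
  have hmax : ∀ x, 0 < M.maxD J Υ x := fun x => (hm x).trans_le
    (hreg.bestValue_mono (continuous_gainLoss x) hLm.1 (hle m))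
  have hmax' : ∀ x, 0 < M.maxD J Υ' x := fun x => (hmax x).trans_le
    (hreg.bestValue_mono (continuous_gainLoss x) (fun x => (hpos x).le) hΥΥ')
  have hdom := hreg.mem_domW_of_le hLm (hle m)
  have hdom' := hreg.mem_domW_of_le hdom hΥΥ'
  have hfix := W_eq_of_tendsto hreg hfeas hL hpos hmax hlim
  have hfix' := W_eq_of_tendsto hreg hfeas hU hpos' hmax' hlim'
  have heq : Υ' = Υ := funext fun x => le_antisymm
    (fixedPoint_le hreg hfeas hpos' hdom' hfix' hmax' hpos hdom hfix x) (hΥΥ' x)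
  refine ⟨Υ, hpos, hdom, hfix, tendsto_pi_nhds.2 fun x => ?_⟩
  rw [heq] at hlim'
  exact tendsto_of_tendsto_of_tendsto_of_le_of_le (tendsto_pi_nhds.1 hlim x)
    (tendsto_pi_nhds.1 hlim' x) (fun j => iterate_mono hreg hfeas hL hLΦ j x)
    (fun j => iterate_mono hreg hfeas hΦ hΦU j x)

/-- Since positive fixed points are unique, convergence from every start to some of them is
solvability. -/
theorem solvable_of_exists_tendsto [Nonempty 𝕏] (hreg : M.IsRegularChoice I J)
    (hfeas : M.Feasible I J) {S : Set (𝕏 → ℝ)} (hS : S.Nonempty) (hSdom : S ⊆ M.domW J)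
    (hpos : ∀ Φ : 𝕏 → ℝ, (∀ x, 0 < Φ x) → Φ ∈ M.domW J → M.W I J Φ = Φ → ∀ x, 0 < M.maxD J Φ x)
    (hlim : ∀ Φ ∈ S, ∃ Υ : 𝕏 → ℝ, (∀ x, 0 < Υ x) ∧ Υ ∈ M.domW J ∧ M.W I J Υ = Υ ∧
      Tendsto (fun m => (M.W I J)^[m] Φ) atTop (𝓝 Υ)) :
    M.Solvable I J S := by
  have huniq : ∀ {Φ Ψ : 𝕏 → ℝ}, (∀ x, 0 < Φ x) → Φ ∈ M.domW J → M.W I J Φ = Φ →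
      (∀ x, 0 < Ψ x) → Ψ ∈ M.domW J → M.W I J Ψ = Ψ → Φ = Ψ := fun h1 h2 h3 h4 h5 h6 =>
    funext fun x => le_antisymm (fixedPoint_le hreg hfeas h1 h2 h3 (hpos _ h1 h2 h3) h4 h5 h6 x)
      (fixedPoint_le hreg hfeas h4 h5 h6 (hpos _ h4 h5 h6) h1 h2 h3 x)
  obtain ⟨Φ₁, hΦ₁⟩ := hS
  obtain ⟨Φs, h1, h2, h3, -⟩ := hlim Φ₁ hΦ₁
  refine ⟨Φs, ⟨h1, h2, h3⟩, fun Φ hΦ0 hΦdom hΦ => huniq hΦ0 hΦdom hΦ h1 h2 h3,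
    fun Φ hΦ => ⟨iterate_mem_domW hreg hfeas (hSdom hΦ), ?_⟩,
    hreg.exists_isMaximizer (fun x => (h1 x).le) (hpos Φs h1 h2 h3)⟩
  obtain ⟨Υ, h4, h5, h6, h7⟩ := hlim Φ hΦ
  rwa [huniq h4 h5 h6 h1 h2 h3] at h7

end Model

end NarrowFraming

end

open NarrowFraming NarrowFraming.Model

theorem mainTheorem3 {𝕏 𝕐 : Type*} [Fintype 𝕏] [Nonempty 𝕏] [MeasurableSpace 𝕏]
    [MeasurableSingletonClass 𝕏] [MeasurableSpace 𝕐] {n : ℕ}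
    (M : NarrowFraming.Model 𝕏 𝕐 n) (I : 𝕏 → Set ℝ) (J : 𝕏 → Set (Fin n → ℝ))
    (hirr : (NarrowFraming.transitionMatrix M.P).IsIrreducible)
    (hI : ∀ x, (I x).Nonempty ∧ ∃ C : Set ℝ, IsClosed C ∧ I x = Set.Ioo 0 1 ∩ C)
    (hJ : ∀ x, (J x).Nonempty ∧ IsCompact (J x))
    (hfeas : M.Feasible I J)
    (hsup : ∃ q : ℝ, q < 1 ∧ ∀ c θ, (c, θ) ∈ NarrowFraming.Model.admissible I J →
      M.β * M.delta c θ ^ (1 - M.ρ) ≤ q) :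
    ((∀ c θ, (c, θ) ∈ NarrowFraming.Model.admissible I J → ∀ x, 0 ≤ M.varpi c θ x) →
      M.Solvable I J {Φ | ∀ x, 0 < Φ x}) ∧
    ((∃ c θ, (c, θ) ∈ NarrowFraming.Model.admissible I J ∧ ∃ x, M.varpi c θ x < 0) →
      M.phiZero I J ∈ M.domW J ∧
      ((∃ m : ℕ, ∀ x, 0 < M.maxD J ((M.W I J)^[m] (M.phiZero I J)) x) →
        M.Solvable I J (M.domW J))) := by
  obtain ⟨q, hq, hsup⟩ := hsup
  have hreg := isRegularChoice_of_feasible hI hJ hfeas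
  refine ⟨fun hϖ => ?_, fun _ => ⟨phiZero_mem_domW hreg hfeas, fun ⟨m, hm⟩ => ?_⟩⟩
  · have hg : ∀ x, ∀ ϑ ∈ J x, 0 ≤ M.gainLoss x ϑ := by
      intro x ϑ hϑ
      obtain ⟨c, θ, hadm, rfl⟩ := exists_admissible hreg.nonempty_I hreg.nonempty_J hϑ
      exact (varpi_nonneg_iff (hreg.mem_Ioo hadm)).1 (hϖ c θ hadm x)
    have hmax : ∀ Φ : 𝕏 → ℝ, (∀ x, 0 < Φ x) → ∀ x, 0 < M.maxD J Φ x := by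
      intro Φ hΦ x
      obtain ⟨ϑ, hϑ⟩ := hreg.nonempty_J x
      exact (add_pos_of_nonneg_of_pos (hg x ϑ hϑ) ((hreg.regular x ϑ hϑ).contValue_pos hΦ)).trans_le
        (hreg.D_le_maxD (fun x => (hΦ x).le) hϑ)
    have hdom : ∀ Φ : 𝕏 → ℝ, (∀ x, 0 < Φ x) → Φ ∈ M.domW J := fun Φ hΦ =>
      ⟨fun x => (hΦ x).le, fun x => (hmax Φ hΦ x).le⟩
    refine solvable_of_exists_tendsto hreg hfeas ⟨fun _ => 1, fun _ => one_pos⟩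
      (fun Φ hΦ => hdom Φ hΦ)
      (fun Φ hΦ _ _ => hmax Φ hΦ) fun Φ hΦ => ?_
    obtain ⟨Ψ, hΨ, hev⟩ := exists_subsolution hirr hreg hfeas hg
    have hsmall : ∀ᶠ t in 𝓝[>] (0 : ℝ), ∀ x, t * Ψ x ≤ Φ x := by
      refine eventually_all.2 fun x => ?_
      filter_upwards [nhdsWithin_le_nhds (gt_mem_nhds (div_pos (hΦ x) (hΨ x)))] with t ht
      exact ((lt_div_iff₀ (hΨ x)).1 ht).le
    obtain ⟨t, ⟨h1, h2⟩, ht⟩ := ((hev.and hsmall).and self_mem_nhdsWithin).exists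
    have hΨt : ∀ x, 0 < t * Ψ x := fun x => mul_pos ht (hΨ x)
    exact exists_tendsto_iterate hirr hreg hfeas hq hsup (hdom _ hΨt) h1 (m := 0) (hmax _ hΨt) h2
  · have h0 := phiZero_mem_domW hreg hfeas
    refine solvable_of_exists_tendsto hreg hfeas ⟨_, h0⟩ subset_rfl ?_ ?_
    · intro Φ _ hΦdom hΦ x
      have hle : ∀ x, M.phiZero I J x ≤ Φ x := fun x =>
        (hreg.phiZero_le_W hΦdom x).trans_eq (congrFun hΦ x)
      have hle' : ∀ x, (M.W I J)^[m] (M.phiZero I J) x ≤ Φ x := fun x =>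
        (iterate_mono hreg hfeas h0 hle m x).trans_eq
          (congrFun (Function.iterate_fixed hΦ m) x)
      exact (hm x).trans_le (hreg.bestValue_mono (continuous_gainLoss x)
        (iterate_mem_domW hreg hfeas h0 m).1 hle')
    · intro Φ hΦ
      -- one step moves `Φ` above `Φ₀`
      obtain ⟨Υ, h1, h2, h3, h4⟩ := exists_tendsto_iterate hirr hreg hfeas hq hsup h0
        (hreg.phiZero_le_W h0) hm (hreg.phiZero_le_W hΦ)
      refine ⟨Υ, h1, h2, h3, (tendsto_add_atTop_iff_nat 1).1 (h4.congr fun j => ?_)⟩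
      rw [← Function.iterate_succ_apply]
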